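/- Let $\mathbb K$ be a field. A \emph{net} is $\mathcal X=(A,\alpha,B,\beta)$, where $A$ is a finite set, $\alpha$ is a fixed-point-free involution of $A$, $B=\bigsqcup_{i\in A}B_i$ is a finite set partitioned into totally ordered sets $B_i$, and $\beta$ is a fixed-point-free involution of a subset $\mathrm{Dom}(\beta)\subset B$. A morphism $f:\mathcal X\to\mathcal X'$ consists of maps $f_1:A\to A'$, $f_2:B\to B'$ such that $f_1\alpha=\alpha'f_1$, $f_2$ maps $\mathrm{Dom}(\beta)$ into $\mathrm{Dom}(\beta')$ and its complement into the complement of $\mathrm{Dom}(\beta')$, $f_2\beta=\beta'f_2$ on $\mathrm{Dom}(\beta)$, and $f_2$ restricts to weakly increasing maps $B_i\to B'_{f_1(i)}$. The height of $\mathcal X$ is $\max_{i\in A}|B_i|$ (and $0$ if $A=\emptyset$). A net is connected if $A\neq\emptyset$ and any two elements of $A$ are joined by a chain of steps $i\to\alpha(i)$ and steps $i\to j$ with $b\in B_i\cap\mathrm{Dom}(\beta)$, $\beta(b)\in B_j$. A \emph{string} is a net in which every $B_i$ has one element (so $A=B$) of the form $\bullet\overset{\alpha}{\leftrightarrow}\bullet\overset{\beta}{\leftrightarrow}\bullet\overset{\alpha}{\leftrightarrow}\cdots\overset{\alpha}{\leftrightarrow}\bullet$,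 with the two ends not in $\mathrm{Dom}(\beta)$; a \emph{band} (or cycle) is a net obtained from such a picture by letting $\beta$ exchange the two ends also. In both cases $|A|\ge 2$. A \emph{covering} is an $n:1$ morphism between bands with $n\ge2$. A \emph{representation} $V=(V,F,\phi)$ of $\mathcal X$ is a finite-dimensional $\mathbb K$-vector space $V=\bigoplus_{i\in A/\alpha}V_i$ with, for each $i\in A$, an increasing exhaustive filtration $(F_j)_{j\in B_i}$ of $V_i$ (so $V_i=0$ if $B_i=\emptyset$), and, with $\mathrm{gr}_b V=F_b/F_{<b}$, isomorphisms $\phi_b:\mathrm{gr}_bV\to\mathrm{gr}_{\beta(b)}V$ for $b\in\mathrm{Dom}(\beta)$ such that $\phi_{\beta(b)}=\phi_b^{-1}$. A morphism is a linear map that preserves all $F_b$ and whose induced maps on graded pieces commute with the isomorphisms $\phi_b$. A representation is indecomposable if it is nonzero and not isomorphic to a direct sum of two nonzero representations. If $f:\mathcal X\to\mathcal X'$ is a morphism with $f_2$ injective on each $B_i$ (automatic if $\mathcal X$ has height at most $1$), the pushforward $f_*V=(W,G,\psi)$ is $W=V$ with $W_j=\bigoplus_{i\in A/\alpha,\,f_1(i)=j}V_i$;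 for $l\in B'$, $G_l=\bigoplus_{i}F_{k_i}$, where $i\in A$ runs over the elements such that $l\in B'_{f_1(i)}$ and $k_i=\max\{r\in B_i\mid f_2(r)\le l\}$ (the summand being $0$ if there is no such $r$); and $\psi_l=\bigoplus_{f_2(b)=l}\phi_b$ under $\mathrm{gr}_lW=\bigoplus_{f_2(b)=l}\mathrm{gr}_bV$. \textbf{Theorem.} Let $\mathcal X=(A,\alpha,B,\beta)$ be a net. (1) For every representation $V$ of $\mathcal X$ there are a net $\mathcal X'$ of height at most $1$, a morphism $f:\mathcal X'\to\mathcal X$ and a representation $V'$ of $\mathcal X'$ such that $f_*V'\cong V$. If $B\neq\emptyset$, then $\mathcal X'$ can be chosen of height exactly $1$; if $V\ne0$, it can be chosen such that moreover all $B'_i$ have exactly one element. (2) Let $V$ be an indecomposable representation of $\mathcal X$. Then there are a connected net $\mathcal X'$ of height $1$, which is a string or a band, a morphism $f:\mathcal X'\to\mathcal X$ which does not factor as a covering followed by a morphism, and an indecomposable representation $V'$ of $\mathcal X'$ such that $f_*V'\cong V$. Moreover, for every triple $(\mathcal X'',f'',V'')$ consisting of a connected net $\mathcal X''$ of height $1$,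 a morphism $f'':\mathcal X''\to\mathcal X$ not factoring through a covering and an indecomposable representation $V''$ of $\mathcal X''$ with $f''_*V''\cong V$, there is an isomorphism of nets $g:\mathcal X'\to\mathcal X''$ with $f''\circ g=f$ and $g_*V'\cong V''$. -/

import Mathlib

open CategoryTheory CategoryTheory.Limits

universe u v w

/-- A net `(A, α, B, β)`.  The partition of `B` into totally ordered sets `B i`, `i : A`, is given
by the map `idx : B → A` together with a partial order on `B` in which two elements are comparable
exactly when they lie in the same block.  The involution `β`, defined on a subset `Dom β` of `B`,
is a map to `Option B`; `Dom β` is the set of `b` with `β b ≠ none`. -/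
structure Net where
  A : Type u
  B : Type u
  [finA : Finite A]
  [finB : Finite B]
  [ordB : PartialOrder B]
  α : A → A
  α_invol : ∀ i, α (α i) = i
  α_ne : ∀ i, α i ≠ i
  idx : B → A
  comparable_iff : ∀ b c : B, (b ≤ c ∨ c ≤ b) ↔ idx b = idx c
  β : B → Option B
  β_invol : ∀ b c, β b = some c → β c = some b
  β_ne : ∀ b, β b ≠ some b

namespace Net

attribute [instance] Net.finA Net.finB Net.ordB

/-- A morphism of nets.  The equation `map_β` says that `f₂` maps `Dom β` into `Dom β'` and its
complement into the complement of `Dom β'`, and that `f₂` commutes with `β` on `Dom β`. -/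
@[ext]
structure Hom (X Y : Net.{u}) where
  f₁ : X.A → Y.A
  f₂ : X.B → Y.B
  map_α : ∀ i, f₁ (X.α i) = Y.α (f₁ i)
  map_β : ∀ b, Y.β (f₂ b) = (X.β b).map f₂
  map_idx : ∀ b, Y.idx (f₂ b) = f₁ (X.idx b)
  mono : Monotone f₂

instance : Category Net.{u} where
  Hom := Hom
  id X :=
    { f₁ := id
      f₂ := id
      map_α := fun _ => rfl
      map_β := fun b => by simp
      map_idx := fun _ => rfl
      mono := monotone_id }
  comp f g :=
    { f₁ := g.f₁ ∘ f.f₁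
      f₂ := g.f₂ ∘ f.f₂
      map_α := fun i => by simp [f.map_α, g.map_α]
      map_β := fun b => by simp [f.map_β, g.map_β]
      map_idx := fun b => by simp [f.map_idx, g.map_idx]
      mono := g.mono.comp f.mono }

/-- The map `A → A'` underlying a morphism of nets. -/
def onA {X Y : Net.{u}} (f : X ⟶ Y) : X.A → Y.A := Hom.f₁ f

/-- The map `B → B'` underlying a morphism of nets. -/
def onB {X Y : Net.{u}} (f : X ⟶ Y) : X.B → Y.B := Hom.f₂ f

theorem onA_α {X Y : Net.{u}} (f : X ⟶ Y) (i : X.A) : onA f (X.α i) = Y.α (onA f i) :=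
  Hom.map_α f i

theorem onB_β {X Y : Net.{u}} (f : X ⟶ Y) (b : X.B) : Y.β (onB f b) = (X.β b).map (onB f) :=
  Hom.map_β f b

theorem idx_onB {X Y : Net.{u}} (f : X ⟶ Y) (b : X.B) : Y.idx (onB f b) = onA f (X.idx b) :=
  Hom.map_idx f b

theorem onB_mono {X Y : Net.{u}} (f : X ⟶ Y) : Monotone (onB f) := Hom.mono f

/-- The height `max_{i ∈ A} |B_i|` (zero if `A` is empty). -/
noncomputable def height (X : Net.{u}) : ℕ := ⨆ i : X.A, Nat.card {b : X.B // X.idx b = i}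

/-- Elements of `A` linked by `α`, or by `β` applied to an element of their blocks. -/
def Linked (X : Net.{u}) (i j : X.A) : Prop :=
  j = X.α i ∨ ∃ b c, X.β b = some c ∧ X.idx b = i ∧ X.idx c = j

/-- A net is connected if it is nonempty and any two elements of `A` are joined by a chain of
links. -/
def Connected (X : Net.{u}) : Prop :=
  Nonempty X.A ∧ ∀ i j : X.A, Relation.EqvGen X.Linked i j

/-- String nets: a linear arrangement `• α • β • α • ⋯ • α •` of `2n ≥ 2` elements, where `A = B`.
The `i`-th edge of type `α` joins the elements `(i, false)` and `(i, true)`. -/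
def IsString (X : Net.{u}) : Prop :=
  ∃ (n : ℕ) (_ : 1 ≤ n) (a : Fin n × Bool ≃ X.A) (b : Fin n × Bool ≃ X.B),
    (∀ p, X.idx (b p) = a p) ∧
    (∀ i s, X.α (a (i, s)) = a (i, !s)) ∧
    (∀ i j : Fin n, (j : ℕ) = i + 1 → X.β (b (i, true)) = some (b (j, false))) ∧
    (∀ i : Fin n, (i : ℕ) = 0 → X.β (b (i, false)) = none) ∧
    (∀ i : Fin n, (i : ℕ) + 1 = n → X.β (b (i, true)) = none)

/-- Band nets, also called cycles: a cyclic arrangement of `2n ≥ 2` elements, where `A = B`, joined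
alternately by `α` and `β`. -/
def IsBand (X : Net.{u}) : Prop :=
  ∃ (n : ℕ) (_ : 1 ≤ n) (a : ZMod n × Bool ≃ X.A) (b : ZMod n × Bool ≃ X.B),
    (∀ p, X.idx (b p) = a p) ∧
    (∀ i s, X.α (a (i, s)) = a (i, !s)) ∧
    (∀ i, X.β (b (i, true)) = some (b (i + 1, false)))

/-- A covering is an `n : 1` morphism between cycles with `n ≥ 2`. -/
def IsCovering {X Y : Net.{u}} (f : X ⟶ Y) : Prop :=
  X.IsBand ∧ Y.IsBand ∧ ∃ n : ℕ, 2 ≤ n ∧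
    (∀ j : Y.A, Nat.card {i : X.A // onA f i = j} = n) ∧
    (∀ c : Y.B, Nat.card {b : X.B // onB f b = c} = n)

def FactorsThroughCovering {X Y : Net.{u}} (f : X ⟶ Y) : Prop :=
  ∃ (Z : Net.{u}) (c : X ⟶ Z) (h : Z ⟶ Y), IsCovering c ∧ c ≫ h = f

/-- `f₂` is injective on each block `B_i`. -/
def BlockInjective {X Y : Net.{u}} (f : X ⟶ Y) : Prop :=
  ∀ b c : X.B, X.idx b = X.idx c → onB f b = onB f c → b = c

/-- Every morphism out of a net of height at most one is injective on blocks. -/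
theorem blockInjective_of_height_le_one {X Y : Net.{u}} (h : X.height ≤ 1) (f : X ⟶ Y) :
    BlockInjective f := by
  intro b c hbc _
  have h1 : Nat.card {d : X.B // X.idx d = X.idx c} ≤ 1 :=
    (le_ciSup (f := fun i : X.A => Nat.card {b : X.B // X.idx b = i})
      (Set.finite_range _).bddAbove (X.idx c)).trans h
  have := (Finite.card_le_one_iff_subsingleton.1 h1).elim ⟨b, hbc⟩ ⟨c, rfl⟩
  exact congrArg Subtype.val this

/-- The equivalence relation on `A` whose classes are the orbits of `α`. -/
def orbitSetoid (X : Net.{u}) : Setoid X.A where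
  r i j := i = j ∨ i = X.α j
  iseqv :=
    { refl := fun _ => Or.inl rfl
      symm := by
        rintro i j (h | h)
        · exact Or.inl h.symm
        · exact Or.inr (by rw [h, X.α_invol])
      trans := by
        rintro i j k (rfl | rfl) (rfl | rfl)
        · exact Or.inl rfl
        · exact Or.inr rfl
        · exact Or.inr rfl
        · exact Or.inl (X.α_invol _) }

/-- The orbit set `A/α`. -/
def Orbit (X : Net.{u}) : Type u := Quotient X.orbitSetoid

/-- The class in `A/α` of an element of `A`. -/
def orb (X : Net.{u}) (i : X.A) : X.Orbit := Quotient.mk X.orbitSetoid i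

theorem orb_eq_iff (X : Net.{u}) {i j : X.A} : X.orb i = X.orb j ↔ i = j ∨ i = X.α j :=
  Quotient.eq (r := X.orbitSetoid)

theorem orb_surj (X : Net.{u}) (o : X.Orbit) : ∃ i, X.orb i = o :=
  Quotient.exists_rep o

theorem orb_α (X : Net.{u}) (i : X.A) : X.orb (X.α i) = X.orb i :=
  X.orb_eq_iff.2 (Or.inr rfl)

/-- The map `A/α → A'/α'` induced by a morphism of nets. -/
def onOrbit {X Y : Net.{u}} (f : X ⟶ Y) : X.Orbit → Y.Orbit :=
  Quotient.lift (fun i => Y.orb (onA f i)) (by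
    rintro i j (rfl | rfl)
    · rfl
    · rw [onA_α, orb_α])

theorem onOrbit_orb {X Y : Net.{u}} (f : X ⟶ Y) (i : X.A) :
    onOrbit f (X.orb i) = Y.orb (onA f i) := rfl

theorem idx_eq_of_le {X : Net.{u}} {b c : X.B} (h : b ≤ c) : X.idx b = X.idx c :=
  (X.comparable_iff b c).1 (Or.inl h)

section Filtration

variable {K : Type v} [Field K] {X : Net.{u}} {V : Type w} [AddCommGroup V] [Module K V]

/-- The subspace `F_{<b}` (zero if `b` is the least element of its block). -/
def below (F : X.B → Submodule K V) (b : X.B) : Submodule K V :=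
  ⨆ (c : X.B) (_ : c < b), F c

/-- The associated graded piece `gr_b = F_b / F_{<b}`. -/
abbrev Gr (F : X.B → Submodule K V) (b : X.B) : Type w :=
  F b ⧸ (below F b).submoduleOf (F b)

end Filtration

/-- The map `F b / F_{<b} → G c / G_{<c}` induced by a linear map `p` with `p(F_b) ⊆ G_c` and
`p(F_{<b}) ⊆ G_{<c}`. -/
def grMap {K : Type v} [Field K] {X Y : Net.{u}} {V W : Type w} [AddCommGroup V] [Module K V]
    [AddCommGroup W] [Module K W] (F : X.B → Submodule K V) (G : Y.B → Submodule K W)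
    (p : V →ₗ[K] W) (b : X.B) (c : Y.B) (h : F b ≤ (G c).comap p)
    (h' : below F b ≤ (below G c).comap p) : Gr F b →ₗ[K] Gr G c :=
  Submodule.mapQ _ _ (p.restrict h) (fun x hx => h' hx)

/-- A finite-dimensional representation of a net over the field `K`: a vector space `V` with a
direct sum decomposition indexed by `A/α`, an increasing exhaustive filtration of `V_i` indexed by
`B_i` for each `i ∈ A` (so that `V_i = 0` if `B_i` is empty), and isomorphisms
`φ : gr_b → gr_{β b}` for `b ∈ Dom β` with `φ_{β b} = φ_b⁻¹`. -/
structure Rep (K : Type v) [Field K] (X : Net.{u}) where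
  V : Type w
  [acg : AddCommGroup V]
  [mod : Module K V]
  [fin : FiniteDimensional K V]
  comp : X.Orbit → Submodule K V
  comp_indep : iSupIndep comp
  comp_iSup : ⨆ o, comp o = ⊤
  F : X.B → Submodule K V
  F_mono : Monotone F
  F_exhaustive : ∀ i, ⨆ (b : X.B) (_ : X.idx b = i), F b = comp (X.orb i)
  φ : ∀ b c, X.β b = some c → (Gr F b ≃ₗ[K] Gr F c)
  φ_symm : ∀ b c (h : X.β b = some c), φ c b (X.β_invol b c h) = (φ b c h).symm

namespace Rep

attribute [instance] Rep.acg Rep.mod Rep.fin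

variable {K : Type v} [Field K] {X Y : Net.{u}}

theorem below_le_comap {V W : Rep.{u, v, w} K X} {p : V.V →ₗ[K] W.V}
    (h : ∀ b, V.F b ≤ (W.F b).comap p) (b : X.B) :
    below V.F b ≤ (below W.F b).comap p :=
  iSup₂_le fun c hc => (h c).trans
    (Submodule.comap_mono (le_iSup₂ (f := fun (c : X.B) (_ : c < b) => W.F c) c hc))

/-- The space of morphisms of representations: linear maps `f : V → W` with `f(F_b) ⊆ G_b` whose
induced maps on graded pieces commute with the structure isomorphisms. -/
def homSpace (V W : Rep.{u, v, w} K X) : Submodule K (V.V →ₗ[K] W.V) where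
  carrier := {p | ∃ h : ∀ b, V.F b ≤ (W.F b).comap p,
    ∀ b c (hbc : X.β b = some c) (x : Gr V.F b),
      W.φ b c hbc (grMap V.F W.F p b b (h b) (below_le_comap h b) x) =
        grMap V.F W.F p c c (h c) (below_le_comap h c) (V.φ b c hbc x)}
  zero_mem' := by
    refine ⟨fun b _ _ => by simp, fun b c hbc x => ?_⟩
    have hz : ∀ (b : X.B) (h) (h'), grMap V.F W.F (0 : V.V →ₗ[K] W.V) b b h h' = 0 := by
      intro b h h'
      refine LinearMap.ext fun y => ?_
      obtain ⟨y, rfl⟩ := Submodule.mkQ_surjective _ y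
      exact (Submodule.Quotient.mk_eq_zero _).2 (Submodule.zero_mem _)
    simp [hz]
  add_mem' := by
    rintro p q ⟨hp, hp'⟩ ⟨hq, hq'⟩
    refine ⟨fun b x hx => Submodule.add_mem _ (hp b hx) (hq b hx), fun b c hbc x => ?_⟩
    have hz : ∀ (b : X.B) (h) (h') (y), grMap V.F W.F (p + q) b b h h' y =
        grMap V.F W.F p b b (hp b) (below_le_comap hp b) y +
        grMap V.F W.F q b b (hq b) (below_le_comap hq b) y := by
      intro b h h' y
      obtain ⟨y, rfl⟩ := Submodule.mkQ_surjective _ y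
      rfl
    rw [hz, hz, map_add, hp', hq']
  smul_mem' := by
    rintro r p ⟨hp, hp'⟩
    refine ⟨fun b x hx => Submodule.smul_mem _ r (hp b hx), fun b c hbc x => ?_⟩
    have hz : ∀ (b : X.B) (h) (h') (y), grMap V.F W.F (r • p) b b h h' y =
        r • grMap V.F W.F p b b (hp b) (below_le_comap hp b) y := by
      intro b h h' y
      obtain ⟨y, rfl⟩ := Submodule.mkQ_surjective _ y
      rfl
    rw [hz, hz, map_smul, hp']

instance : Category (Rep.{u, v, w} K X) where
  Hom V W := homSpace V W
  id V := ⟨LinearMap.id, fun _ _ hx => hx, fun b c hbc x => by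
    have hz : ∀ (b : X.B) (h) (h') (y), grMap V.F V.F LinearMap.id b b h h' y = y := by
      intro b h h' y
      obtain ⟨y, rfl⟩ := Submodule.mkQ_surjective _ y
      rfl
    rw [hz, hz]⟩
  comp {U V W} p q := ⟨q.1 ∘ₗ p.1, by
    obtain ⟨p, hp, hp'⟩ := p
    obtain ⟨q, hq, hq'⟩ := q
    refine ⟨fun b x hx => hq b (hp b hx), fun b c hbc x => ?_⟩
    have hz : ∀ (b : X.B) (h) (h') (y), grMap U.F W.F (q ∘ₗ p) b b h h' y =
        grMap V.F W.F q b b (hq b) (below_le_comap hq b)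
          (grMap U.F V.F p b b (hp b) (below_le_comap hp b) y) := by
      intro b h h' y
      obtain ⟨y, rfl⟩ := Submodule.mkQ_surjective _ y
      rfl
    change W.φ b c hbc (grMap U.F W.F (q ∘ₗ p) b b _ _ x) =
      grMap U.F W.F (q ∘ₗ p) c c _ _ (U.φ b c hbc x)
    rw [hz, hz, hq', hp']⟩

/-- The linear map underlying a morphism of representations. -/
def toLin {V W : Rep.{u, v, w} K X} (p : V ⟶ W) : V.V →ₗ[K] W.V := Subtype.val p

instance : Preadditive (Rep.{u, v, w} K X) where
  homGroup V W := inferInstanceAs (AddCommGroup (homSpace V W))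
  add_comp _ _ _ p q r := Subtype.ext (LinearMap.comp_add p.1 q.1 r.1)
  comp_add _ _ _ p q r := Subtype.ext (LinearMap.add_comp p.1 r.1 q.1)

instance : Linear K (Rep.{u, v, w} K X) where
  homModule V W := inferInstanceAs (Module K (homSpace V W))
  smul_comp _ _ _ r p q := Subtype.ext (LinearMap.comp_smul q.1 r p.1)
  comp_smul _ _ _ p r q := Subtype.ext (LinearMap.smul_comp r q.1 p.1)

/-- A representation is indecomposable if it is nonzero and is not isomorphic to a direct sum
(biproduct) of two nonzero representations. -/
def IsIndecomposable (V : Rep.{u, v, w} K X) : Prop :=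
  ¬ IsZero V ∧ ∀ (P Q : Rep.{u, v, w} K X) (b : BinaryBicone P Q),
    Nonempty b.IsBilimit → Nonempty (b.pt ≅ V) → IsZero P ∨ IsZero Q

/-! Construction of the pushforward. -/

theorem F_le_comp (V : Rep.{u, v, w} K X) (b : X.B) : V.F b ≤ V.comp (X.orb (X.idx b)) := by
  rw [← V.F_exhaustive]
  exact le_iSup₂ (f := fun (c : X.B) (_ : X.idx c = X.idx b) => V.F c) b rfl

theorem comp_isCompl (V : Rep.{u, v, w} K X) (o : X.Orbit) :
    IsCompl (V.comp o) (⨆ (j) (_ : j ≠ o), V.comp j) := by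
  refine ⟨V.comp_indep o, codisjoint_iff_le_sup.2 ?_⟩
  rw [← V.comp_iSup]
  refine iSup_le fun j => ?_
  by_cases h : j = o
  · exact h ▸ le_sup_left
  · exact le_sup_of_le_right (le_iSup₂ (f := fun (j : X.Orbit) (_ : j ≠ o) => V.comp j) j h)

/-- The projection of `V` to its summand `V_o`. -/
noncomputable def proj (V : Rep.{u, v, w} K X) (o : X.Orbit) : V.V →ₗ[K] V.V :=
  (V.comp o).projection _ (V.comp_isCompl o)

theorem proj_same (V : Rep.{u, v, w} K X) {o : X.Orbit} {x : V.V} (hx : x ∈ V.comp o) :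
    V.proj o x = x :=
  Submodule.projection_apply_of_mem_left (V.comp_isCompl o) hx

theorem proj_other (V : Rep.{u, v, w} K X) {o o' : X.Orbit} (h : o' ≠ o) {x : V.V}
    (hx : x ∈ V.comp o') : V.proj o x = 0 := by
  have := le_iSup₂ (f := fun (j : X.Orbit) (_ : j ≠ o) => V.comp j) o' h hx
  exact Submodule.projection_apply_of_mem_right (V.comp_isCompl o) this

/-- The filtrations of the pushforward: `G_l` is the sum, over all `i ∈ A` such that `l` lies in
the block of `f₁ i`, of the largest `F_k`, `k ∈ B_i`, with `f₂ k ≤ l`. -/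
def pushF (f : X ⟶ Y) (V : Rep.{u, v, w} K X) (l : Y.B) : Submodule K V.V :=
  ⨆ (r : X.B) (_ : onB f r ≤ l), V.F r

theorem le_pushF (f : X ⟶ Y) (V : Rep.{u, v, w} K X) {r : X.B} {l : Y.B} (h : onB f r ≤ l) :
    V.F r ≤ pushF f V l :=
  le_iSup₂ (f := fun (r : X.B) (_ : onB f r ≤ l) => V.F r) r h

theorem below_pushF (f : X ⟶ Y) (V : Rep.{u, v, w} K X) (l : Y.B) :
    below (pushF f V) l = ⨆ (r : X.B) (_ : onB f r < l), V.F r := by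
  refine le_antisymm (iSup₂_le fun m hm => iSup₂_le fun r hr => ?_) (iSup₂_le fun r hr => ?_)
  · exact le_iSup₂ (f := fun (r : X.B) (_ : onB f r < l) => V.F r) r (hr.trans_lt hm)
  · exact (le_pushF f V le_rfl).trans
      (le_iSup₂ (f := fun (m : Y.B) (_ : m < l) => pushF f V m) (onB f r) hr)

/-- Two elements of `X.B` whose images are in the same block and whose orbits agree are in the
same block. -/
theorem idx_eq (f : X ⟶ Y) {r s : X.B} (h : Y.idx (onB f r) = Y.idx (onB f s))
    (ho : X.orb (X.idx r) = X.orb (X.idx s)) : X.idx r = X.idx s := by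
  rcases X.orb_eq_iff.1 ho with h' | h'
  · exact h'
  · rw [idx_onB, idx_onB, h', onA_α] at h
    exact absurd h (Y.α_ne _)

theorem le_of_onB_le (f : X ⟶ Y) (hf : BlockInjective f) {r s : X.B} (h : onB f r ≤ onB f s)
    (ho : X.orb (X.idx r) = X.orb (X.idx s)) : r ≤ s := by
  have hi := idx_eq f (idx_eq_of_le h) ho
  rcases (X.comparable_iff r s).2 hi with h' | h'
  · exact h'
  · exact (hf r s hi (le_antisymm h (onB_mono f h'))).le

theorem lt_of_onB_lt (f : X ⟶ Y) (hf : BlockInjective f) {r s : X.B} (h : onB f r < onB f s)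
    (ho : X.orb (X.idx r) = X.orb (X.idx s)) : r < s :=
  lt_of_le_of_ne (le_of_onB_le f hf h.le ho) (by rintro rfl; exact lt_irrefl _ h)

theorem onB_lt (f : X ⟶ Y) (hf : BlockInjective f) {r s : X.B} (h : r < s) :
    onB f r < onB f s :=
  lt_of_le_of_ne (onB_mono f h.le) fun he => h.ne (hf r s (idx_eq_of_le h.le) he)

/-- The inclusion `gr_r V → gr_l W` into the graded piece of the pushforward, where `l = f₂ r`. -/
def grIncl (f : X ⟶ Y) (hf : BlockInjective f) (V : Rep.{u, v, w} K X) (r : X.B) (l : Y.B)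
    (h : onB f r = l) : Gr V.F r →ₗ[K] Gr (pushF f V) l :=
  grMap V.F (pushF f V) LinearMap.id r l (le_pushF f V h.le) (by
    rw [below_pushF]
    exact iSup₂_le fun s hs => le_iSup₂ (f := fun (r : X.B) (_ : onB f r < l) => V.F r) s
      (h ▸ onB_lt f hf hs))

/-- The projection `gr_l W → gr_r V` from the graded piece of the pushforward, where
`l = f₂ r`. -/
noncomputable def grProj (f : X ⟶ Y) (hf : BlockInjective f) (V : Rep.{u, v, w} K X) (r : X.B)
    (l : Y.B) (h : onB f r = l) : Gr (pushF f V) l →ₗ[K] Gr V.F r :=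
  grMap (pushF f V) V.F (V.proj (X.orb (X.idx r))) l r
    (by
      refine iSup₂_le fun s hs x hx => ?_
      rw [Submodule.mem_comap]
      by_cases ho : X.orb (X.idx s) = X.orb (X.idx r)
      · rw [V.proj_same (ho ▸ V.F_le_comp s hx)]
        exact V.F_mono (le_of_onB_le f hf (h ▸ hs) ho) hx
      · rw [V.proj_other ho (V.F_le_comp s hx)]
        exact Submodule.zero_mem _)
    (by
      rw [below_pushF]
      refine iSup₂_le fun s hs x hx => ?_
      rw [Submodule.mem_comap]
      by_cases ho : X.orb (X.idx s) = X.orb (X.idx r)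
      · rw [V.proj_same (ho ▸ V.F_le_comp s hx)]
        exact le_iSup₂ (f := fun (c : X.B) (_ : c < r) => V.F c) s
          (lt_of_onB_lt f hf (h ▸ hs) ho) hx
      · rw [V.proj_other ho (V.F_le_comp s hx)]
        exact Submodule.zero_mem _)

theorem grProj_grIncl_same (f : X ⟶ Y) (hf : BlockInjective f) (V : Rep.{u, v, w} K X)
    {r : X.B} {l : Y.B} (h : onB f r = l) (x : Gr V.F r) :
    grProj f hf V r l h (grIncl f hf V r l h x) = x := by
  obtain ⟨x, rfl⟩ := Submodule.mkQ_surjective _ x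
  exact congrArg (Submodule.mkQ _) (Subtype.ext (V.proj_same (V.F_le_comp r x.2)))

theorem grProj_grIncl_other (f : X ⟶ Y) (hf : BlockInjective f) (V : Rep.{u, v, w} K X)
    {r s : X.B} {l : Y.B} (h : onB f r = l) (hs : onB f s = l) (hrs : r ≠ s) (x : Gr V.F s) :
    grProj f hf V r l h (grIncl f hf V s l hs x) = 0 := by
  obtain ⟨x, rfl⟩ := Submodule.mkQ_surjective _ x
  have ho : X.orb (X.idx s) ≠ X.orb (X.idx r) := fun ho =>
    hrs (hf r s (idx_eq f (by rw [h, hs]) ho.symm) (by rw [h, hs]))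
  refine (Submodule.Quotient.mk_eq_zero _).2 ?_
  change V.proj (X.orb (X.idx r)) x.1 ∈ below V.F r
  rw [V.proj_other ho (V.F_le_comp s x.2)]
  exact Submodule.zero_mem _

/-- The graded piece `gr_l W` is spanned by the images of the `gr_r V` with `f₂ r = l`. -/
theorem gr_hom_ext (f : X ⟶ Y) (hf : BlockInjective f) (V : Rep.{u, v, w} K X) {l : Y.B}
    {M : Type*} [AddCommGroup M] [Module K M] (p q : Gr (pushF f V) l →ₗ[K] M)
    (h : ∀ (r : X.B) (hr : onB f r = l) (x : Gr V.F r),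
      p (grIncl f hf V r l hr x) = q (grIncl f hf V r l hr x)) : p = q := by
  refine Submodule.linearMap_qext _ (LinearMap.ext fun y => ?_)
  have key : pushF f V l ≤ ((LinearMap.ker ((p - q) ∘ₗ Submodule.mkQ _)).map
      (pushF f V l).subtype) := by
    refine iSup₂_le fun r hr x hx => ?_
    refine ⟨⟨x, le_pushF f V hr hx⟩, ?_, rfl⟩
    change (p - q) (Submodule.mkQ _ ⟨x, le_pushF f V hr hx⟩) = 0
    rcases hr.eq_or_lt with hr' | hr'
    · exact sub_eq_zero.2 (h r hr' (Submodule.mkQ _ ⟨x, hx⟩))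
    · have h0 : Submodule.mkQ ((below (pushF f V) l).submoduleOf (pushF f V l))
          ⟨x, le_pushF f V hr hx⟩ = 0 := by
        refine (Submodule.Quotient.mk_eq_zero _).2 ?_
        change x ∈ below (pushF f V) l
        rw [below_pushF]
        exact le_iSup₂ (f := fun (r : X.B) (_ : onB f r < l) => V.F r) r hr' hx
      rw [h0, map_zero]
  obtain ⟨z, hz, hzy⟩ := key y.2
  have : z = y := Subtype.ext hzy
  exact sub_eq_zero.1 (this ▸ hz)

/-- Pairs `(r, β r)` with `r ∈ Dom β` and `f₂ r = l`. -/
abbrev Over (f : X ⟶ Y) (l : Y.B) : Type u :=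
  {p : X.B × X.B // X.β p.1 = some p.2 ∧ onB f p.1 = l}

theorem onB_of_β (f : X ⟶ Y) {l m : Y.B} (hlm : Y.β l = some m) {r s : X.B}
    (hrs : X.β r = some s) (hr : onB f r = l) : onB f s = m := by
  have := onB_β f r
  rw [hr, hlm, hrs] at this
  exact (Option.some.inj this).symm

theorem exists_β (f : X ⟶ Y) {l m : Y.B} (hlm : Y.β l = some m) {r : X.B}
    (hr : onB f r = l) : ∃ s, X.β r = some s := by
  have := onB_β f r
  rw [hr, hlm] at this
  obtain ⟨s, hs, -⟩ := Option.map_eq_some_iff.1 this.symm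
  exact ⟨s, hs⟩

open Classical in
/-- The map `ψ_l : gr_l W → gr_{β l} W`, the direct sum of the `φ_r` with `f₂ r = l`. -/
noncomputable def pushMap (f : X ⟶ Y) (hf : BlockInjective f) (V : Rep.{u, v, w} K X)
    (l m : Y.B) (hlm : Y.β l = some m) : Gr (pushF f V) l →ₗ[K] Gr (pushF f V) m :=
  letI := Fintype.ofFinite (Over f l)
  ∑ p : Over f l, grIncl f hf V p.1.2 m (onB_of_β f hlm p.2.1 p.2.2) ∘ₗ
    (V.φ p.1.1 p.1.2 p.2.1).toLinearMap ∘ₗ grProj f hf V p.1.1 l p.2.2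

theorem pushMap_grIncl (f : X ⟶ Y) (hf : BlockInjective f) (V : Rep.{u, v, w} K X)
    {l m : Y.B} (hlm : Y.β l = some m) {r s : X.B} (hrs : X.β r = some s) (hr : onB f r = l)
    (x : Gr V.F r) :
    pushMap f hf V l m hlm (grIncl f hf V r l hr x) =
      grIncl f hf V s m (onB_of_β f hlm hrs hr) (V.φ r s hrs x) := by
  classical
  let := Fintype.ofFinite (Over f l)
  unfold pushMap
  rw [LinearMap.sum_apply, Finset.sum_eq_single (⟨(r, s), hrs, hr⟩ : Over f l)]
  · simp only [LinearMap.comp_apply, grProj_grIncl_same, LinearEquiv.coe_coe]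
  · rintro ⟨⟨r', s'⟩, h1, h2⟩ - hne
    have hne' : r' ≠ r := by
      rintro rfl
      exact hne (Subtype.ext (Prod.ext rfl (Option.some.inj (h1.symm.trans hrs))))
    simp only [LinearMap.comp_apply, grProj_grIncl_other f hf V h2 hr hne', map_zero]
  · exact fun h => absurd (Finset.mem_univ _) h

theorem pushMap_comp (f : X ⟶ Y) (hf : BlockInjective f) (V : Rep.{u, v, w} K X)
    {l m : Y.B} (hlm : Y.β l = some m) (hml : Y.β m = some l) :
    pushMap f hf V m l hml ∘ₗ pushMap f hf V l m hlm = LinearMap.id := by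
  refine gr_hom_ext f hf V _ _ fun r hr x => ?_
  obtain ⟨s, hs⟩ := exists_β f hlm hr
  rw [LinearMap.comp_apply, pushMap_grIncl f hf V hlm hs hr,
    pushMap_grIncl f hf V hml (X.β_invol _ _ hs) (onB_of_β f hlm hs hr), V.φ_symm _ _ hs, LinearEquiv.symm_apply_apply,
    LinearMap.id_apply]

/-- The pushforward `f_* V` along a morphism `f` that is injective on blocks.  The underlying
vector space is that of `V`. -/
noncomputable abbrev pushforward (f : X ⟶ Y) (hf : BlockInjective f) (V : Rep.{u, v, w} K X) :
    Rep.{u, v, w} K Y where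
  V := V.V
  comp j := ⨆ (o : X.Orbit) (_ : onOrbit f o = j), V.comp o
  comp_indep := by
    intro j
    refine (V.comp_indep.disjoint_biSup_biSup (s := {o | onOrbit f o = j})
      (t := {o | onOrbit f o ≠ j}) ?_).mono_right ?_
    · exact Set.disjoint_left.2 fun o h h' => h' h
    · refine iSup₂_le fun k hk => iSup₂_le fun o ho => ?_
      exact le_iSup₂ (f := fun (o : X.Orbit) (_ : o ∈ {o | onOrbit f o ≠ j}) => V.comp o) o
        (by simpa [ho] using hk)
  comp_iSup := by
    rw [eq_top_iff, ← V.comp_iSup]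
    refine iSup_le fun o => le_iSup_of_le (onOrbit f o) ?_
    exact le_iSup₂ (f := fun (o' : X.Orbit) (_ : onOrbit f o' = onOrbit f o) => V.comp o') o rfl
  F := pushF f V
  F_mono l m h := iSup₂_le fun _ hr => le_pushF f V (hr.trans h)
  F_exhaustive a := by
    refine le_antisymm (iSup₂_le fun l hl => iSup₂_le fun r hr => ?_) (iSup₂_le fun o ho => ?_)
    · refine (V.F_le_comp r).trans (le_iSup₂ (f := fun (o : X.Orbit)
        (_ : onOrbit f o = Y.orb a) => V.comp o) (X.orb (X.idx r)) ?_)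
      rw [onOrbit_orb, ← idx_onB, idx_eq_of_le hr, hl]
    · obtain ⟨i, hi, hia⟩ : ∃ i, X.orb i = o ∧ onA f i = a := by
        obtain ⟨i, rfl⟩ := X.orb_surj o
        rcases Y.orb_eq_iff.1 ho with h | h
        · exact ⟨i, rfl, h⟩
        · exact ⟨X.α i, X.orb_α i, by rw [onA_α, h, Y.α_invol]⟩
      rw [← hi, ← V.F_exhaustive]
      refine iSup₂_le fun r hr => (le_pushF f V le_rfl).trans ?_
      exact le_iSup₂ (f := fun (l : Y.B) (_ : Y.idx l = a) => pushF f V l) (onB f r)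
        (by rw [idx_onB, hr, hia])
  φ l m hlm := LinearEquiv.ofLinearMap (pushMap f hf V l m hlm)
    (pushMap f hf V m l (Y.β_invol _ _ hlm)) (pushMap_comp f hf V _ _) (pushMap_comp f hf V _ _)
  φ_symm l m hlm := LinearEquiv.ext fun _ => rfl

end Rep

/-- The data `(X, f, V)` of a connected net `X` of height 1, a morphism `f : X → Y` not factoring
through a covering and an indecomposable representation `V` of `X` present the representation `W`
of `Y` if `f_* V ≅ W`. -/
structure Presents {K : Type v} [Field K] {X Y : Net.{u}} (f : X ⟶ Y) (V : Rep.{u, v, w} K X)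
    (W : Rep.{u, v, w} K Y) : Prop where
  height_eq : X.height = 1
  connected : X.Connected
  not_factors : ¬ FactorsThroughCovering f
  indecomposable : V.IsIndecomposable
  iso : Nonempty (Rep.pushforward f (blockInjective_of_height_le_one height_eq.le f) V ≅ W)

end Net

/-! The argument refines filtrations. For `i ∈ A`, the filtration of `V_i` indexed by `B_i` is
refined repeatedly: if `c = β(b)`, subspaces already constructed for the other filtration of the
summand containing `F_c` are pulled back through `φ_b` and land between `F_{<b}` and `F_b`. For each
`i` the result is still a chain (`Refined.total`), so every summand `V_i = V_{α i}` carries two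
chains. For `U` in the first and `W` in the second, put `M = U ∩ W` and `N = (U⁻ ∩ W) + (U ∩ W⁻)`,
with `⁻` denoting the predecessor. The pairs with `M ≠ N` are the pieces. Exchanging the chains is
an involution on pieces, and the `φ_b` induce a partial involution (`Piece.exists_adj`,
`Adj.unique`). So the pieces form a net with one-element blocks.

Complements `C` of `N` in `M` decompose `V` (`inf_le_iSup`, `eq_zero_of_sum_eq_zero`), and `V` is
the pushforward of the family `C` as soon as the complements can be chosen so that the `φ_b` match
them up. The defect of an arbitrary choice takes values in `N`. `exists_correction` pushes such a
defect along the net until it disappears in some `F_{<b}`; this stops because a refined subspace is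
built in finitely many steps. This gives `exists_pushforward_iso`.

For an indecomposable `V`, a presentation with fewest elements of `A` is connected, since otherwise
a component already suffices, and does not factor through a covering, since otherwise the target of
the covering would be smaller. A connected net with one-element blocks is an orbit of two
involutions, hence a path or a cycle.

For uniqueness, let `p`, `q` be inverse isomorphisms between two pushforwards. Elements `z₁`, `z₂`
are matched if they have the same image in `A` and the composite `V₁(z₁) → V₂(z₂) → V₁(z₁)` of
components of `p` and `q` is nonzero. Matching is stable under both involutions, so elements matched
with a common partner are bisimilar over the target net. A nontrivial bisimulation would produce a
covering (`Bisimulation.eq_of_rel`). Hence matching is the graph of an isomorphism `g` of nets, and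
the part of `p` along this graph is an isomorphism `g_* V₁ ≅ V₂`. -/

namespace Net

/-! ### Structure isomorphisms as linear relations -/

/-- Linear choice from a total linear relation. -/
theorem exists_linear_choice {K V W : Type*} [Field K] [AddCommGroup V] [Module K V]
    [AddCommGroup W] [Module K W] (C : Submodule K V) (G : Submodule K (V × W))
    (h : ∀ x ∈ C, ∃ y, (x, y) ∈ G) : ∃ m : V →ₗ[K] W, ∀ x ∈ C, (x, m x) ∈ G := by
  let G' : Submodule K (C × W) := G.comap (C.subtype.prodMap LinearMap.id)
  let p : G' →ₗ[K] C := LinearMap.fst K C W ∘ₗ G'.subtype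
  have hp : LinearMap.range p = ⊤ := by
    refine LinearMap.range_eq_top.2 fun x => ?_
    obtain ⟨y, hy⟩ := h x.1 x.2
    exact ⟨⟨(x, y), hy⟩, rfl⟩
  obtain ⟨s, hs⟩ := p.exists_rightInverse_of_surjective hp
  obtain ⟨m, hm⟩ := LinearMap.exists_extend (LinearMap.snd K C W ∘ₗ G'.subtype ∘ₗ s)
  refine ⟨m, fun x hx => ?_⟩
  have h1 : m x = (s ⟨x, hx⟩).1.2 := LinearMap.congr_fun hm ⟨x, hx⟩
  have h2 : (s ⟨x, hx⟩).1.1 = ⟨x, hx⟩ := LinearMap.congr_fun hs ⟨x, hx⟩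
  have h3 : (((s ⟨x, hx⟩).1.1 : V), (s ⟨x, hx⟩).1.2) ∈ G := (s ⟨x, hx⟩).2
  rwa [h2, ← h1] at h3

theorem below_mono {K : Type v} [Field K] {X : Net.{u}} {V : Type w} [AddCommGroup V]
    [Module K V] {F : X.B → Submodule K V} {b c : X.B} (h : c < b) : F c ≤ below F b :=
  le_iSup₂ (f := fun (c : X.B) (_ : c < b) => F c) c h

/-- The class in `gr_b` of an element of `F_b`. -/
def grMk {K : Type v} [Field K] {X : Net.{u}} {V : Type w} [AddCommGroup V] [Module K V]
    (F : X.B → Submodule K V) (b : X.B) (x : V) (hx : x ∈ F b) : Gr F b :=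
  Submodule.mkQ _ ⟨x, hx⟩

section

variable {K : Type v} [Field K] {X : Net.{u}} {V : Type w} [AddCommGroup V] [Module K V]
  {F : X.B → Submodule K V}

theorem grMk_surj {b : X.B} (y : Gr F b) : ∃ x hx, grMk F b x hx = y := by
  obtain ⟨x, rfl⟩ := Submodule.mkQ_surjective _ y
  exact ⟨x.1, x.2, rfl⟩

theorem grMk_eq_iff {b : X.B} {x y : V} {hx : x ∈ F b} {hy : y ∈ F b} :
    grMk F b x hx = grMk F b y hy ↔ x - y ∈ below F b :=
  Submodule.Quotient.eq _

theorem grMk_eq_zero {b : X.B} {x : V} {hx : x ∈ F b} :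
    grMk F b x hx = 0 ↔ x ∈ below F b :=
  Submodule.Quotient.mk_eq_zero _

end

namespace Rep

variable {K : Type v} [Field K] {X Y : Net.{u}}

/-- The linear relation on `V` relating `x ∈ F_b` to `y ∈ F_c`, `c = β b`, if `φ_b` maps the class
of `x` to the class of `y`. -/
def rel (V : Rep.{u, v, w} K X) (b c : X.B) (h : X.β b = some c) : Submodule K (V.V × V.V) where
  carrier := {p | ∃ (h₁ : p.1 ∈ V.F b) (h₂ : p.2 ∈ V.F c),
    V.φ b c h (grMk V.F b p.1 h₁) = grMk V.F c p.2 h₂}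
  zero_mem' := ⟨Submodule.zero_mem _, Submodule.zero_mem _, map_zero (V.φ b c h)⟩
  add_mem' := by
    rintro p q ⟨h₁, h₂, h₃⟩ ⟨h₁', h₂', h₃'⟩
    refine ⟨Submodule.add_mem _ h₁ h₁', Submodule.add_mem _ h₂ h₂', ?_⟩
    change V.φ b c h (grMk V.F b p.1 h₁ + grMk V.F b q.1 h₁') =
      grMk V.F c p.2 h₂ + grMk V.F c q.2 h₂'
    rw [map_add, h₃, h₃']
  smul_mem' := by
    rintro r p ⟨h₁, h₂, h₃⟩
    refine ⟨Submodule.smul_mem _ r h₁, Submodule.smul_mem _ r h₂, ?_⟩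
    change V.φ b c h (r • grMk V.F b p.1 h₁) = r • grMk V.F c p.2 h₂
    rw [map_smul, h₃]

section

variable (V : Rep.{u, v, w} K X) {b c : X.B} {h : X.β b = some c} {x y : V.V}

theorem mem_rel_iff (hx : x ∈ V.F b) (hy : y ∈ V.F c) :
    (x, y) ∈ V.rel b c h ↔ V.φ b c h (grMk V.F b x hx) = grMk V.F c y hy :=
  ⟨fun ⟨_, _, h⟩ => h, fun h => ⟨hx, hy, h⟩⟩

variable {V}

theorem rel_left (hxy : (x, y) ∈ V.rel b c h) : x ∈ V.F b := hxy.1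

theorem rel_right (hxy : (x, y) ∈ V.rel b c h) : y ∈ V.F c := hxy.2.1

theorem rel_symm (hxy : (x, y) ∈ V.rel b c h) : (y, x) ∈ V.rel c b (X.β_invol b c h) := by
  obtain ⟨hx, hy, e⟩ := hxy
  refine ⟨hy, hx, ?_⟩
  rw [V.φ_symm, LinearEquiv.symm_apply_eq]
  exact e.symm

theorem exists_rel (h : X.β b = some c) (hx : x ∈ V.F b) : ∃ y, (x, y) ∈ V.rel b c h := by
  obtain ⟨y, hy, e⟩ := grMk_surj (V.φ b c h (grMk V.F b x hx))
  exact ⟨y, hx, hy, e.symm⟩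

theorem F_below (V : Rep.{u, v, w} K X) (b : X.B) : below V.F b ≤ V.F b :=
  iSup₂_le fun _ h => V.F_mono h.le

theorem rel_below (hxy : (x, y) ∈ V.rel b c h) (hx : x ∈ below V.F b) : y ∈ below V.F c := by
  obtain ⟨h₁, h₂, e⟩ := hxy
  have : grMk V.F b x h₁ = 0 := grMk_eq_zero.2 hx
  exact grMk_eq_zero.1 (by rw [← e]; exact (congrArg _ this).trans (map_zero _))

theorem below_rel (hxy : (x, y) ∈ V.rel b c h) (hy : y ∈ below V.F c) : x ∈ below V.F b :=
  rel_below (rel_symm hxy) hy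

theorem rel_of_below (h : X.β b = some c) (hx : x ∈ below V.F b) (hy : y ∈ below V.F c) :
    (x, y) ∈ V.rel b c h := by
  have h₁ : grMk V.F b x (V.F_below b hx) = 0 := grMk_eq_zero.2 hx
  have h₂ : grMk V.F c y (V.F_below c hy) = 0 := grMk_eq_zero.2 hy
  refine ⟨V.F_below b hx, V.F_below c hy, ?_⟩
  change V.φ b c h (grMk V.F b x (V.F_below b hx)) = grMk V.F c y (V.F_below c hy)
  rw [h₁, h₂, map_zero]

theorem rel_sub_right {y' : V.V} (hxy : (x, y) ∈ V.rel b c h) (hxy' : (x, y') ∈ V.rel b c h) :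
    y - y' ∈ below V.F c := by
  have := Submodule.sub_mem _ hxy hxy'
  rw [Prod.mk_sub_mk, sub_self] at this
  exact rel_below this (Submodule.zero_mem _)

theorem rel_sub_left {x' : V.V} (hxy : (x, y) ∈ V.rel b c h) (hxy' : (x', y) ∈ V.rel b c h) :
    x - x' ∈ below V.F b :=
  rel_sub_right (rel_symm hxy) (rel_symm hxy')

end

/-- A linear map that respects filtrations and the relations `rel` is a morphism. -/
theorem mem_homSpace {V W : Rep.{u, v, w} K X} {p : V.V →ₗ[K] W.V}
    (h : ∀ b, V.F b ≤ (W.F b).comap p)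
    (h' : ∀ b c (hbc : X.β b = some c) (x y : V.V), (x, y) ∈ V.rel b c hbc →
      (p x, p y) ∈ W.rel b c hbc) : p ∈ homSpace V W := by
  refine ⟨h, fun b c hbc x => ?_⟩
  obtain ⟨x, hx, rfl⟩ := grMk_surj x
  obtain ⟨y, hy, e⟩ := grMk_surj (V.φ b c hbc (grMk V.F b x hx))
  rw [← e]
  exact (mem_rel_iff W (h b hx) (h c hy)).1 (h' b c hbc x y ⟨hx, hy, e.symm⟩)

/-- The morphism of representations with a given underlying linear map. -/
def homMk {V W : Rep.{u, v, w} K X} (p : V.V →ₗ[K] W.V)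
    (h : ∀ b, V.F b ≤ (W.F b).comap p)
    (h' : ∀ b c (hbc : X.β b = some c) (x y : V.V), (x, y) ∈ V.rel b c hbc →
      (p x, p y) ∈ W.rel b c hbc) : V ⟶ W :=
  (⟨p, mem_homSpace h h'⟩ : homSpace V W)

theorem hom_ext {V W : Rep.{u, v, w} K X} {p q : V ⟶ W} (h : toLin p = toLin q) : p = q :=
  Subtype.ext h

theorem map_F {V W : Rep.{u, v, w} K X} (p : V ⟶ W) {b : X.B} {x : V.V} (hx : x ∈ V.F b) :
    toLin p x ∈ W.F b :=
  p.2.1 b hx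

theorem map_rel {V W : Rep.{u, v, w} K X} (p : V ⟶ W) {b c : X.B} {h : X.β b = some c}
    {x y : V.V} (hxy : (x, y) ∈ V.rel b c h) : (toLin p x, toLin p y) ∈ W.rel b c h := by
  obtain ⟨hx, hy, e⟩ := hxy
  obtain ⟨hp, hp'⟩ := p.2
  refine ⟨hp b hx, hp c hy, ?_⟩
  have := hp' b c h (grMk V.F b x hx)
  have e' : V.φ b c h (grMk V.F b x hx) = grMk V.F c y hy := e
  rw [e'] at this
  exact this

theorem map_comp {V W : Rep.{u, v, w} K X} (p : V ⟶ W) {o : X.Orbit} {x : V.V}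
    (hx : x ∈ V.comp o) : toLin p x ∈ W.comp o := by
  obtain ⟨i, rfl⟩ := X.orb_surj o
  have : V.comp (X.orb i) ≤ (W.comp (X.orb i)).comap (toLin p) := by
    rw [← V.F_exhaustive]
    refine iSup₂_le fun b hb x hx => ?_
    have := W.F_le_comp b (map_F p hx)
    rwa [hb] at this
  exact this hx

/-- A bijective morphism that is surjective on all filtration steps is an isomorphism. -/
theorem isIso_of_bijective {V W : Rep.{u, v, w} K X} (p : V ⟶ W)
    (hp : Function.Bijective (toLin p)) (hF : ∀ b, W.F b ≤ (V.F b).map (toLin p)) : IsIso p := by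
  let e := LinearEquiv.ofBijective (toLin p) hp
  have he : ∀ x, toLin p (e.symm x) = x := e.apply_symm_apply
  have he' : ∀ x, e.symm (toLin p x) = x := e.symm_apply_apply
  have hF' : ∀ b, W.F b ≤ (V.F b).comap e.symm.toLinearMap := fun b x hx => by
    obtain ⟨y, hy, rfl⟩ := hF b hx
    rw [Submodule.mem_comap]
    exact (he' y).symm ▸ hy
  have hb : ∀ b, below W.F b ≤ (below V.F b).comap e.symm.toLinearMap := below_le_comap hF'
  refine ⟨homMk e.symm.toLinearMap hF' fun b c h x y hxy => ?_, hom_ext ?_, hom_ext ?_⟩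
  · have hx := hF' b (rel_left hxy)
    -- Both `y` and `p z` are partners of `x`, so they differ by an element of `F_{<c}`; pulled back
    -- by the inverse, this difference does not affect the relation.
    obtain ⟨z, hz⟩ := exists_rel h hx
    have h1 := map_rel p hz
    have h2 : toLin p (e.symm.toLinearMap x) = x := he x
    rw [h2] at h1
    have h3 := hb c (rel_sub_right hxy h1)
    have h4 : e.symm.toLinearMap (y - toLin p z) = e.symm.toLinearMap y - z := by
      rw [map_sub]; congr 1; exact he' z
    rw [Submodule.mem_comap, h4] at h3
    have h5 := Submodule.add_mem _ hz
      (rel_of_below h (Submodule.zero_mem (below V.F b)) h3)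
    rwa [Prod.mk_add_mk, add_zero, add_sub_cancel] at h5
  · exact LinearMap.ext he'
  · exact LinearMap.ext he

theorem isZero_iff (V : Rep.{u, v, w} K X) : IsZero V ↔ ∀ x : V.V, x = 0 := by
  rw [IsZero.iff_id_eq_zero]
  exact ⟨fun h x => LinearMap.congr_fun (congrArg toLin h) x,
    fun h => hom_ext (LinearMap.ext h)⟩

section OfRel

variable {V : Type w} [AddCommGroup V] [Module K V]
  (comp : X.Orbit → Submodule K V) (comp_indep : iSupIndep comp) (comp_iSup : ⨆ o, comp o = ⊤)
  (F : X.B → Submodule K V) (F_mono : Monotone F)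
  (F_exhaustive : ∀ i, ⨆ (b : X.B) (_ : X.idx b = i), F b = comp (X.orb i))
  (G : ∀ b c, X.β b = some c → Submodule K (V × V))
  (G_left : ∀ b c h x y, (x, y) ∈ G b c h → x ∈ F b)
  (G_total : ∀ b c h, ∀ x ∈ F b, ∃ y, (x, y) ∈ G b c h)
  (G_symm : ∀ b c h x y, (x, y) ∈ G b c h → (y, x) ∈ G c b (X.β_invol b c h))
  (G_below : ∀ b c h x y, (x, y) ∈ G b c h → x ∈ below F b → y ∈ below F c)

/-- A linear map whose graph is contained in the relation `G b c h`. -/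
noncomputable def sectionOfRel (b c : X.B) (h : X.β b = some c) : V →ₗ[K] V :=
  (exists_linear_choice (F b) (G b c h) (G_total b c h)).choose

theorem sectionOfRel_spec (b c : X.B) (h : X.β b = some c) {x : V} (hx : x ∈ F b) :
    (x, sectionOfRel F G G_total b c h x) ∈ G b c h :=
  (exists_linear_choice (F b) (G b c h) (G_total b c h)).choose_spec x hx

include F_mono G_left G_symm G_below

/-- The map on graded pieces defined by a relation. -/
noncomputable def grOfRel (b c : X.B) (h : X.β b = some c) : Gr F b →ₗ[K] Gr F c :=
  grMap F F (sectionOfRel F G G_total b c h) b c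
    (fun _ hx => G_left _ _ _ _ _ (G_symm _ _ _ _ _ (sectionOfRel_spec F G G_total b c h hx)))
    (fun _ hx => G_below _ _ _ _ _ (sectionOfRel_spec F G G_total b c h
      ((iSup₂_le fun _ h => F_mono h.le : below F b ≤ F b) hx)) hx)

/-- Two partners of `x` differ by a partner of zero, which `G_below` places in `F_{<c}`. So the
class is independent of the chosen section. -/
theorem grOfRel_mk {b c : X.B} {h : X.β b = some c} {x y : V} (hxy : (x, y) ∈ G b c h)
    (hx : x ∈ F b) (hy : y ∈ F c) :
    grOfRel F F_mono G G_left G_total G_symm G_below b c h (grMk F b x hx) = grMk F c y hy := by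
  have h1 := Submodule.sub_mem _ (sectionOfRel_spec F G G_total b c h hx) hxy
  rw [Prod.mk_sub_mk, sub_self] at h1
  exact grMk_eq_iff.2 (G_below _ _ _ _ _ h1 (Submodule.zero_mem _))

theorem grOfRel_comp {b c : X.B} (h : X.β b = some c) (h' : X.β c = some b) :
    grOfRel F F_mono G G_left G_total G_symm G_below c b h' ∘ₗ
      grOfRel F F_mono G G_left G_total G_symm G_below b c h = LinearMap.id := by
  refine LinearMap.ext fun z => ?_
  obtain ⟨x, hx, rfl⟩ := grMk_surj z
  obtain ⟨y, hy⟩ := G_total b c h x hx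
  have hy' := G_symm _ _ _ _ _ hy
  rw [LinearMap.comp_apply, grOfRel_mk (hxy := hy) (hy := G_left _ _ _ _ _ hy'),
    grOfRel_mk (hxy := hy') (hy := hx)]
  rfl

variable [FiniteDimensional K V]

/-- The representation whose structure isomorphisms are given by linear relations. -/
noncomputable abbrev ofRel : Rep.{u, v, w} K X where
  V := V
  comp := comp
  comp_indep := comp_indep
  comp_iSup := comp_iSup
  F := F
  F_mono := F_mono
  F_exhaustive := F_exhaustive
  φ b c h := LinearEquiv.ofLinearMap
    (grOfRel F F_mono G G_left G_total G_symm G_below b c h)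
    (grOfRel F F_mono G G_left G_total G_symm G_below c b (X.β_invol b c h))
    (grOfRel_comp F F_mono G G_left G_total G_symm G_below _ _)
    (grOfRel_comp F F_mono G G_left G_total G_symm G_below _ _)
  φ_symm _ _ _ := LinearEquiv.ext fun _ => rfl

theorem rel_ofRel {b c : X.B} {h : X.β b = some c} {x y : V} (hxy : (x, y) ∈ G b c h) :
    (x, y) ∈ (ofRel comp comp_indep comp_iSup F F_mono F_exhaustive G G_left G_total G_symm
      G_below).rel b c h :=
  ⟨G_left _ _ _ _ _ hxy, G_left _ _ _ _ _ (G_symm _ _ _ _ _ hxy),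
    grOfRel_mk F F_mono G G_left G_total G_symm G_below hxy _ _⟩

/-- The relation of `ofRel` is saturated by the lower filtration steps and may be strictly larger
than `G`; a `G`-partner is recovered only modulo `F_{<c}`. -/
theorem exists_of_rel_ofRel {b c : X.B} {h : X.β b = some c} {x y : V}
    (hxy : (x, y) ∈ (ofRel comp comp_indep comp_iSup F F_mono F_exhaustive G G_left G_total
      G_symm G_below).rel b c h) : ∃ y', (x, y') ∈ G b c h ∧ y - y' ∈ below F c := by
  obtain ⟨y', hy'⟩ := G_total b c h x (rel_left hxy)
  exact ⟨y', hy', rel_sub_right hxy (rel_ofRel comp comp_indep comp_iSup F F_mono F_exhaustive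
    G G_left G_total G_symm G_below hy')⟩

end OfRel

end Rep

end Net

/-! ### Functoriality of the pushforward -/

namespace Net

namespace Rep

variable {K : Type v} [Field K] {X Y : Net.{u}}

theorem β_onB (f : X ⟶ Y) {r s : X.B} (h : X.β r = some s) :
    Y.β (onB f r) = some (onB f s) := by
  rw [onB_β, h]; rfl

section Push

variable (f : X ⟶ Y) (hf : BlockInjective f) (V : Rep.{u, v, w} K X)

theorem rel_pushforward {r s : X.B} {h : X.β r = some s} {h' : Y.β (onB f r) = some (onB f s)}
    {x y : V.V} (hxy : (x, y) ∈ V.rel r s h) :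
    (x, y) ∈ (V.pushforward f hf).rel (onB f r) (onB f s) h' := by
  obtain ⟨hx, hy, e⟩ := hxy
  refine ⟨le_pushF f V le_rfl hx, le_pushF f V le_rfl hy, ?_⟩
  have := pushMap_grIncl f hf V h' h rfl (grMk V.F r x hx)
  exact this.trans (congrArg _ e)

-- By block injectivity, the only `s` in the orbit of `r` that contribute to the step at `onB f r`
-- satisfy `s ≤ r`. The projection kills the other orbits.
include hf in
theorem proj_mem_F {r : X.B} {x : V.V} (hx : x ∈ pushF f V (onB f r)) :
    V.proj (X.orb (X.idx r)) x ∈ V.F r := by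
  have : pushF f V (onB f r) ≤ (V.F r).comap (V.proj (X.orb (X.idx r))) := by
    refine iSup₂_le fun s hs x hx => ?_
    rw [Submodule.mem_comap]
    by_cases ho : X.orb (X.idx s) = X.orb (X.idx r)
    · rw [V.proj_same (ho ▸ V.F_le_comp s hx)]
      exact V.F_mono (le_of_onB_le f hf hs ho) hx
    · rw [V.proj_other ho (V.F_le_comp s hx)]
      exact Submodule.zero_mem _
  exact this hx

/-- It suffices to test on the images of the `gr_t` with `f t = f r`, which span. Only `t = r`
survives on either side, because `β` is injective. -/
theorem proj_rel_pushforward {r s : X.B} {h : X.β r = some s}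
    {h' : Y.β (onB f r) = some (onB f s)} {x y : V.V}
    (hxy : (x, y) ∈ (V.pushforward f hf).rel (onB f r) (onB f s) h') :
    (V.proj (X.orb (X.idx r)) x, V.proj (X.orb (X.idx s)) y) ∈ V.rel r s h := by
  have key : grProj f hf V s (onB f s) rfl ∘ₗ pushMap f hf V _ _ h' =
      (V.φ r s h).toLinearMap ∘ₗ grProj f hf V r (onB f r) rfl := by
    refine gr_hom_ext f hf V _ _ fun t ht z => ?_
    obtain ⟨t', ht'⟩ := exists_β f h' ht
    simp only [LinearMap.comp_apply]
    rw [pushMap_grIncl f hf V h' ht' ht]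
    by_cases htr : r = t
    · subst htr
      obtain rfl : s = t' := Option.some.inj (h.symm.trans ht')
      rw [grProj_grIncl_same, grProj_grIncl_same]; rfl
    · have hst : s ≠ t' := by
        rintro rfl
        exact htr (Option.some.inj ((X.β_invol _ _ h).symm.trans (X.β_invol _ _ ht')))
      rw [grProj_grIncl_other (hrs := htr), grProj_grIncl_other (hrs := hst), map_zero]
  obtain ⟨hx, hy, e⟩ := hxy
  refine ⟨proj_mem_F f hf V hx, proj_mem_F f hf V hy, ?_⟩
  have := LinearMap.congr_fun key (grMk (pushF f V) (onB f r) x hx)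
  exact (this.symm.trans (congrArg (grProj f hf V s (onB f s) rfl) e))

variable {V}

/-- A linear map on `V` defines a morphism `f_* V ⟶ W` if it maps `F_r` to `G_{f r}` and respects
the relations. -/
noncomputable def homOfPushforward {W : Rep.{u, v, w} K Y} (p : V.V →ₗ[K] W.V)
    (h : ∀ r, V.F r ≤ (W.F (onB f r)).comap p)
    (h' : ∀ r s (hrs : X.β r = some s) (x y : V.V), (x, y) ∈ V.rel r s hrs →
      (p x, p y) ∈ W.rel (onB f r) (onB f s) (β_onB f hrs)) : V.pushforward f hf ⟶ W :=
  have h1 : ∀ l, pushF f V l ≤ (W.F l).comap p := fun _ => iSup₂_le fun r hr _ hx =>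
    W.F_mono hr (h r hx)
  homMk p h1 (by
    intro l m hlm x y hxy
    have h2 : below (pushF f V) l ≤ (below W.F l).comap p :=
      below_le_comap (V := V.pushforward f hf) h1 l
    have h3 : below (pushF f V) m ≤ (below W.F m).comap p :=
      below_le_comap (V := V.pushforward f hf) h1 m
    -- Every `x` in the filtration step has at least one partner `y'` on which `p` is compatible; an
    -- arbitrary partner differs from `y'` by a lower term, and `p` preserves lower terms.
    have key : pushF f V l ≤ (((V.pushforward f hf).rel l m hlm ⊓
        (W.rel l m hlm).comap (p.prodMap p)).map (LinearMap.fst K _ _)) := by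
      refine iSup₂_le fun r hr x hx => ?_
      rcases hr.eq_or_lt with rfl | hr
      · obtain ⟨s, hs⟩ := exists_β f hlm rfl
        obtain rfl := onB_of_β f hlm hs rfl
        obtain ⟨y, hy⟩ := exists_rel hs hx
        exact ⟨(x, y), ⟨rel_pushforward f hf V hy, h' r s hs x y hy⟩, rfl⟩
      · refine ⟨(x, 0), ⟨rel_of_below hlm ?_ (Submodule.zero_mem _), ?_⟩, rfl⟩
        · exact below_mono hr (le_pushF f V le_rfl hx)
        · change (p x, p 0) ∈ W.rel l m hlm
          rw [map_zero]
          exact rel_of_below hlm (below_mono hr (h r hx)) (Submodule.zero_mem _)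
    obtain ⟨⟨x', y'⟩, ⟨hy', hpy'⟩, e⟩ := key (rel_left hxy)
    obtain rfl : x' = x := e
    have h4 := rel_sub_right hxy hy'
    have h5 : p (y - y') ∈ below W.F m := h3 h4
    have h6 := Submodule.add_mem _ (show (p x', p y') ∈ W.rel l m hlm from hpy')
      (rel_of_below hlm (Submodule.zero_mem _) h5)
    rw [Prod.mk_add_mk] at h6
    rwa [add_zero, ← map_add, add_sub_cancel] at h6)

/-- The pushforward of a morphism. -/
noncomputable def pushHom {V W : Rep.{u, v, w} K X} (p : V ⟶ W) : V.pushforward f hf ⟶ W.pushforward f hf :=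
  homOfPushforward f hf (toLin p : V.V →ₗ[K] (W.pushforward f hf).V)
    (fun _ _ hx => le_pushF f W le_rfl (map_F p hx))
    (fun _ _ _ _ _ hxy => rel_pushforward f hf W (map_rel p hxy))

/-- The pushforward of an isomorphism. -/
noncomputable def pushIso {V W : Rep.{u, v, w} K X} (e : V ≅ W) : V.pushforward f hf ≅ W.pushforward f hf where
  hom := pushHom f hf e.hom
  inv := pushHom f hf e.inv
  hom_inv_id := hom_ext (by have := congrArg toLin e.hom_inv_id; exact this)
  inv_hom_id := hom_ext (by have := congrArg toLin e.inv_hom_id; exact this)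

/-- The pushforward of a bicone. -/
noncomputable def pushBicone {P Q : Rep.{u, v, w} K X} (b : BinaryBicone P Q) :
    BinaryBicone (P.pushforward f hf) (Q.pushforward f hf) where
  pt := b.pt.pushforward f hf
  fst := pushHom f hf b.fst
  snd := pushHom f hf b.snd
  inl := pushHom f hf b.inl
  inr := pushHom f hf b.inr
  inl_fst := hom_ext (by have := congrArg toLin b.inl_fst; exact this)
  inl_snd := hom_ext (by have := congrArg toLin b.inl_snd; exact this)
  inr_fst := hom_ext (by have := congrArg toLin b.inr_fst; exact this)
  inr_snd := hom_ext (by have := congrArg toLin b.inr_snd; exact this)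

theorem isBilimit_of_total {P Q : Rep.{u, v, w} K X} (b : BinaryBicone P Q)
    (h : b.fst ≫ b.inl + b.snd ≫ b.inr = 𝟙 b.pt) : Nonempty b.IsBilimit :=
  ⟨isBinaryBilimitOfTotal b h⟩

theorem pushBicone_isBilimit {P Q : Rep.{u, v, w} K X} (b : BinaryBicone P Q)
    (hb : b.IsBilimit) : Nonempty (pushBicone f hf b).IsBilimit :=
  isBilimit_of_total _ (hom_ext (by have := congrArg toLin (IsBilimit.binary_total hb); exact this))

/-- Pushforward changes neither the underlying spaces nor the underlying maps, so it carries direct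
sums to direct sums and detects zero. -/
theorem isIndecomposable_of_pushforward (hV : (V.pushforward f hf).IsIndecomposable) :
    V.IsIndecomposable := by
  refine ⟨fun h => hV.1 ((isZero_iff _).2 ((isZero_iff V).1 h)), fun P Q b hb hV' => ?_⟩
  obtain ⟨hb⟩ := hb
  obtain ⟨e⟩ := hV'
  rcases hV.2 _ _ (pushBicone f hf b) (pushBicone_isBilimit f hf b hb) ⟨pushIso f hf e⟩ with h | h
  · exact Or.inl ((isZero_iff P).2 ((isZero_iff (P.pushforward f hf)).1 h))
  · exact Or.inr ((isZero_iff Q).2 ((isZero_iff (Q.pushforward f hf)).1 h))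

theorem IsIndecomposable.of_iso {V W : Rep.{u, v, w} K X} (e : V ≅ W)
    (hV : V.IsIndecomposable) : W.IsIndecomposable :=
  ⟨fun h => hV.1 (h.of_iso e), fun P Q b hb ⟨hW⟩ => hV.2 P Q b hb ⟨hW ≪≫ e.symm⟩⟩

/-- Pushforward is compatible with composition. -/
theorem pushforward_comp {Z : Net.{u}} (g : Y ⟶ Z) (hg : BlockInjective g)
    (hfg : BlockInjective (f ≫ g)) :
    Nonempty (V.pushforward (f ≫ g) hfg ≅ (V.pushforward f hf).pushforward g hg) := by
  let p : V.pushforward (f ≫ g) hfg ⟶ (V.pushforward f hf).pushforward g hg :=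
    homOfPushforward (f ≫ g) hfg (LinearMap.id : V.V →ₗ[K] V.V)
      (fun r x hx => le_pushF g (V.pushforward f hf) (r := onB f r) le_rfl (le_pushF f V le_rfl hx))
      (fun r s hrs x y hxy => rel_pushforward g hg (V.pushforward f hf) (h := β_onB f hrs)
        (rel_pushforward f hf V hxy))
  have : IsIso p := isIso_of_bijective p Function.bijective_id fun b => by
    have h : (⨆ (r : Y.B) (_ : onB g r ≤ b), pushF f V r) ≤ pushF (f ≫ g) V b :=
      iSup₂_le fun r hr => iSup₂_le fun s hs => le_pushF (f ≫ g) V ((onB_mono g hs).trans hr)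
    exact fun x hx => ⟨x, h hx, rfl⟩
  exact ⟨asIso p⟩

end Push

/-! ### Splitting of idempotents -/

section Split

variable (V : Rep.{u, v, w} K X) (e : V ⟶ V)

/-- The corestriction of an endomorphism to its range. -/
def toRange : V.V →ₗ[K] LinearMap.range (toLin e) := (toLin e).rangeRestrict

variable (he : e ≫ e = e)
include he

theorem toLin_idem (x : V.V) : toLin e (toLin e x) = toLin e x :=
  LinearMap.congr_fun (congrArg toLin he) x

theorem toRange_coe (x : LinearMap.range (toLin e)) : toRange V e x.1 = x := by
  obtain ⟨_, y, rfl⟩ := x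
  exact Subtype.ext (toLin_idem V e he y)

theorem mem_map_toRange {S : Submodule K V.V} (hS : S ≤ S.comap (toLin e))
    (x : LinearMap.range (toLin e)) : x ∈ S.map (toRange V e) ↔ x.1 ∈ S := by
  constructor
  · rintro ⟨y, hy, rfl⟩
    exact hS hy
  · exact fun hx => ⟨x.1, hx, toRange_coe V e he x⟩

omit he in
theorem F_le_comap (b : X.B) : V.F b ≤ (V.F b).comap (toLin e) := fun _ hx => map_F e hx

omit he in
theorem below_map_toRange (b : X.B) :
    below (fun b => (V.F b).map (toRange V e)) b = (below V.F b).map (toRange V e) := by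
  simp only [below, Submodule.map_iSup]

/-- The image of an idempotent endomorphism. -/
noncomputable def image : Rep.{u, v, w} K X :=
  ofRel (V := LinearMap.range (toLin e)) (fun o => (V.comp o).map (toRange V e))
    (by
      rw [iSupIndep_iff_finsetSum_eq_zero_imp_eq_zero]
      intro s x hx hsum i hi
      have := (iSupIndep_iff_finsetSum_eq_zero_imp_eq_zero _).1 V.comp_indep s (fun i => (x i).1)
        (fun i hi => (mem_map_toRange V e he (fun _ h => map_comp e h) _).1 (hx i hi))
        (by rw [← Submodule.coe_sum, hsum]; rfl) i hi
      exact Subtype.ext this)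
    (by
      rw [← Submodule.map_iSup, V.comp_iSup, Submodule.map_top]
      exact LinearMap.range_rangeRestrict _)
    (fun b => (V.F b).map (toRange V e))
    (fun _ _ h => Submodule.map_mono (V.F_mono h))
    (fun i => by rw [← V.F_exhaustive]; simp only [Submodule.map_iSup])
    (fun b c h => (V.rel b c h).comap ((LinearMap.range (toLin e)).subtype.prodMap
      (LinearMap.range (toLin e)).subtype))
    (fun b c h x y hxy => (mem_map_toRange V e he (F_le_comap V e b) _).2 (rel_left hxy))
    (fun b c h x hx => by
      obtain ⟨y, hy⟩ := exists_rel h ((mem_map_toRange V e he (F_le_comap V e b) _).1 hx)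
      -- A partner of `x` may lie outside the image; its image under `e` is still a partner, since
      -- `e x = x`.
      refine ⟨toRange V e y, ?_⟩
      have := map_rel e hy
      obtain ⟨_, z, rfl⟩ := x
      rwa [toLin_idem V e he] at this)
    (fun b c h x y hxy => rel_symm hxy)
    (fun b c h x y hxy hx => by
      rw [below_map_toRange V e,
        mem_map_toRange V e he (below_le_comap (F_le_comap V e) _)] at hx ⊢
      exact rel_below hxy hx)

/-- The projection to the image of an idempotent endomorphism. -/
noncomputable def imageπ : V ⟶ image V e he :=
  homMk (toRange V e) (fun _ x hx => ⟨x, hx, rfl⟩)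
    (fun _ _ _ _ _ hxy => rel_ofRel _ _ _ _ _ _ _ _ _ _ _ (map_rel e hxy))

/-- The inclusion of the image of an idempotent endomorphism. -/
noncomputable def imageι : image V e he ⟶ V :=
  homMk (LinearMap.range (toLin e)).subtype
    (fun b x hx => (mem_map_toRange V e he (F_le_comap V e b) x).1 hx)
    (fun b c h x y hxy => by
      obtain ⟨y', hy', hb⟩ := exists_of_rel_ofRel _ _ _ _ _ _ _ _ _ _ _ hxy
      rw [below_map_toRange V e,
        mem_map_toRange V e he (below_le_comap (F_le_comap V e) _)] at hb
      have h1 : (x.1, y'.1) ∈ V.rel b c h := hy'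
      have h2 : (0, y.1 - y'.1) ∈ V.rel b c h := rel_of_below h (Submodule.zero_mem _) hb
      have := Submodule.add_mem _ h1 h2
      rwa [Prod.mk_add_mk, add_zero, add_sub_cancel] at this)

end Split

/-- The images of `e` and `1 - e` are complementary summands of `V`, so one of them vanishes. -/
theorem IsIndecomposable.eq_zero_or_eq_id {V : Rep.{u, v, w} K X} (hV : V.IsIndecomposable)
    (e : V ⟶ V) (he : e ≫ e = e) : e = 0 ∨ e = 𝟙 V := by
  have he' : (𝟙 V - e) ≫ (𝟙 V - e) = 𝟙 V - e := by
    simp [he]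
  have hi : ∀ (e : V ⟶ V) (he : e ≫ e = e), imageι V e he ≫ imageπ V e he = 𝟙 _ := fun e he =>
    hom_ext (LinearMap.ext fun x => toRange_coe V e he x)
  have hπ : ∀ (e : V ⟶ V) (he : e ≫ e = e), imageπ V e he ≫ imageι V e he = e := fun e he =>
    hom_ext rfl
  have h0 : ∀ (e e' : V ⟶ V) (he : e ≫ e = e) (he' : e' ≫ e' = e'), e ≫ e' = 0 →
      imageι V e he ≫ imageπ V e' he' = 0 := fun e e' he he' h => by
    refine hom_ext (LinearMap.ext fun x => Subtype.ext ?_)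
    obtain ⟨_, y, rfl⟩ := x
    exact LinearMap.congr_fun (congrArg toLin h) y
  let b : BinaryBicone (image V e he) (image V (𝟙 V - e) he') :=
    { pt := V
      fst := imageπ V e he
      snd := imageπ V _ he'
      inl := imageι V e he
      inr := imageι V _ he'
      inl_fst := hi _ _
      inl_snd := h0 _ _ _ _ (by simp [he])
      inr_fst := h0 _ _ _ _ (by simp [he])
      inr_snd := hi _ _ }
  have hb : b.fst ≫ b.inl + b.snd ≫ b.inr = 𝟙 b.pt := by
    change imageπ V e he ≫ imageι V e he + imageπ V _ he' ≫ imageι V _ he' = 𝟙 V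
    rw [hπ, hπ, add_sub_cancel]
  rcases hV.2 _ _ b (isBilimit_of_total b hb) ⟨Iso.refl V⟩ with h | h
  · left
    rw [← hπ e he, h.eq_of_tgt (imageπ V e he) 0, zero_comp]
  · right
    rw [eq_comm, ← sub_eq_zero, ← hπ _ he', h.eq_of_tgt (imageπ V _ he') 0, zero_comp]

end Rep

end Net

/-! ### Refined chains, corners and pieces -/

namespace Net

namespace Rep

variable {K : Type v} [Field K] {X : Net.{u}}

section Refined

variable (V : Rep.{u, v, w} K X)

/-- The preimage of a subspace under the relation `rel b c h`. -/
def pre (b c : X.B) (h : X.β b = some c) (U : Submodule K V.V) : Submodule K V.V :=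
  (V.rel b c h ⊓ U.comap (LinearMap.snd K _ _)).map (LinearMap.fst K _ _)

variable {V}

theorem mem_pre {b c : X.B} {h : X.β b = some c} {U : Submodule K V.V} {x : V.V} :
    x ∈ V.pre b c h U ↔ ∃ y ∈ U, (x, y) ∈ V.rel b c h := by
  constructor
  · rintro ⟨⟨x, y⟩, ⟨h1, h2⟩, rfl⟩
    exact ⟨y, h2, h1⟩
  · rintro ⟨y, h2, h1⟩
    exact ⟨(x, y), ⟨h1, h2⟩, rfl⟩

theorem pre_mono {b c : X.B} {h : X.β b = some c} {U U' : Submodule K V.V} (hU : U ≤ U') :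
    V.pre b c h U ≤ V.pre b c h U' := fun x hx => by
  obtain ⟨y, hy, hxy⟩ := mem_pre.1 hx
  exact mem_pre.2 ⟨y, hU hy, hxy⟩

theorem pre_le {b c : X.B} {h : X.β b = some c} {U : Submodule K V.V} :
    V.pre b c h U ≤ V.F b := fun x hx => by
  obtain ⟨y, hy, hxy⟩ := mem_pre.1 hx
  exact rel_left hxy

theorem below_le_pre {b c : X.B} {h : X.β b = some c} {U : Submodule K V.V} :
    below V.F b ≤ V.pre b c h U := fun _ hx =>
  mem_pre.2 ⟨0, Submodule.zero_mem _, rel_of_below h hx (Submodule.zero_mem _)⟩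

theorem pre_bot {b c : X.B} {h : X.β b = some c} : V.pre b c h ⊥ ≤ below V.F b := fun x hx => by
  obtain ⟨y, hy, hxy⟩ := mem_pre.1 hx
  obtain rfl := (Submodule.mem_bot K).1 hy
  exact below_rel hxy (Submodule.zero_mem _)

variable (V)

/-- The subspaces generated from the filtrations by transport along the structure isomorphisms. -/
inductive Refined : X.A → Submodule K V.V → Prop
  | bot (i : X.A) : Refined i ⊥
  | filt (i : X.A) (b : X.B) (hb : X.idx b = i) : Refined i (V.F b)
  | step (i : X.A) (b c : X.B) (h : X.β b = some c) (U : Submodule K V.V) (hb : X.idx b = i)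
      (hU : Refined (X.α (X.idx c)) U) : Refined i (V.pre b c h U)

variable {V}

theorem le_below_or_le {b c : X.B} (h : X.idx b = X.idx c) : b = c ∨ b < c ∨ c < b := by
  rcases (X.comparable_iff b c).2 h with h | h
  · rcases h.eq_or_lt with h | h
    · exact Or.inl h
    · exact Or.inr (Or.inl h)
  · rcases h.eq_or_lt with h | h
    · exact Or.inl h.symm
    · exact Or.inr (Or.inr h)

theorem Refined.le_comp {i : X.A} {U : Submodule K V.V} (hU : V.Refined i U) :
    U ≤ V.comp (X.orb i) := by
  cases hU with
  | bot => exact bot_le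
  | filt _ b hb => exact hb ▸ V.F_le_comp b
  | step _ b c h U hb hU => exact hb ▸ pre_le.trans (V.F_le_comp b)

/-- Everything produced by transport at `b` lies between `F_{<b}` and `F_b`, so subspaces attached
to different elements of the block are ordered as those elements are. For the same `b`, both are
preimages of subspaces comparable by induction. -/
theorem Refined.total {i : X.A} {U U' : Submodule K V.V} (hU : V.Refined i U)
    (hU' : V.Refined i U') : U ≤ U' ∨ U' ≤ U := by
  induction hU generalizing U' with
  | bot => exact Or.inl bot_le
  | filt i b hb =>
    cases hU' with
    | bot => exact Or.inr bot_le
    | filt _ b' hb' =>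
      exact ((X.comparable_iff b b').2 (hb.trans hb'.symm)).imp (fun h => V.F_mono h)
        (fun h => V.F_mono h)
    | step _ b' c' h' U' hb' hU' =>
      rcases le_below_or_le (hb.trans hb'.symm) with rfl | h | h
      · exact Or.inr pre_le
      · exact Or.inl ((below_mono h).trans below_le_pre)
      · exact Or.inr (pre_le.trans (V.F_mono h.le))
  | step i b c h U hb hU ih =>
    cases hU' with
    | bot => exact Or.inr bot_le
    | filt _ b' hb' =>
      rcases le_below_or_le (hb.trans hb'.symm) with rfl | h | h
      · exact Or.inl pre_le
      · exact Or.inl (pre_le.trans (V.F_mono h.le))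
      · exact Or.inr ((below_mono h).trans below_le_pre)
    | step _ b' c' h' U' hb' hU' =>
      rcases le_below_or_le (hb.trans hb'.symm) with rfl | h | h
      · obtain rfl := Option.some.inj (h.symm.trans h')
        exact (ih hU').imp pre_mono pre_mono
      · exact Or.inl ((pre_le.trans (below_mono h)).trans below_le_pre)
      · exact Or.inr ((pre_le.trans (below_mono h)).trans below_le_pre)

theorem Refined.le_of_not_lt {i : X.A} {U U' : Submodule K V.V} (hU : V.Refined i U)
    (hU' : V.Refined i U') (h : ¬ U' < U) : U ≤ U' := by
  rcases hU.total hU' with h' | h'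
  · exact h'
  · exact (h'.eq_or_lt.resolve_right h).ge

theorem Refined.lt_of_not_le {i : X.A} {U U' : Submodule K V.V} (hU : V.Refined i U)
    (hU' : V.Refined i U') (h : ¬ U' ≤ U) : U < U' :=
  lt_of_le_not_ge ((hU.total hU').resolve_right h) h

/-- The only members created inside the gap from `F_{<b}` to `F_b` are transports through `φ_b`.
This inversion is what allows a chain to be followed across an edge. -/
theorem Refined.trichotomy {b : X.B} {T : Submodule K V.V} (hT : V.Refined (X.idx b) T) :
    T ≤ Net.below V.F b ∨ V.F b ≤ T ∨
      ∃ c h T', V.Refined (X.α (X.idx c)) T' ∧ T = V.pre b c h T' := by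
  cases hT with
  | bot => exact Or.inl bot_le
  | filt _ b' hb' =>
    rcases le_below_or_le hb' with rfl | h | h
    · exact Or.inr (Or.inl le_rfl)
    · exact Or.inl (below_mono h)
    · exact Or.inr (Or.inl (V.F_mono h.le))
  | step _ b' c' h' U' hb' hU' =>
    rcases le_below_or_le hb' with rfl | h | h
    · exact Or.inr (Or.inr ⟨_, _, _, hU', rfl⟩)
    · exact Or.inl (pre_le.trans (below_mono h))
    · exact Or.inr (Or.inl ((below_mono h).trans below_le_pre))

/-- In a chain of subspaces of a finite-dimensional space a maximal element is the supremum.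
Predecessors are therefore members of the chain themselves. -/
theorem sSup_mem_of_refined {i : X.A} {S : Set (Submodule K V.V)} (hS : ∀ T ∈ S, V.Refined i T)
    (hne : S.Nonempty) : sSup S ∈ S := by
  obtain ⟨m, hm, hmax⟩ := wellFounded_gt.has_min S hne
  have : sSup S = m := le_antisymm
    (sSup_le fun T hT => (hS T hT).le_of_not_lt (hS m hm) (hmax T hT)) (le_sSup hm)
  rwa [this]

theorem refined_sSup {i : X.A} {S : Set (Submodule K V.V)} (hS : ∀ T ∈ S, V.Refined i T) :
    V.Refined i (sSup S) := by
  rcases S.eq_empty_or_nonempty with rfl | h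
  · rw [sSup_empty]; exact .bot i
  · exact hS _ (sSup_mem_of_refined hS h)

theorem below_eq_sSup (b : X.B) : below V.F b = sSup {T | ∃ c, c < b ∧ V.F c = T} := by
  refine le_antisymm (iSup₂_le fun c hc => le_sSup ⟨c, hc, rfl⟩) (sSup_le ?_)
  rintro _ ⟨c, hc, rfl⟩
  exact below_mono hc

theorem comp_eq_sSup (i : X.A) :
    V.comp (X.orb i) = sSup {T | ∃ c, X.idx c = i ∧ V.F c = T} := by
  rw [← V.F_exhaustive]
  refine le_antisymm (iSup₂_le fun c hc => le_sSup ⟨c, hc, rfl⟩) (sSup_le ?_)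
  rintro _ ⟨c, hc, rfl⟩
  exact le_iSup₂ (f := fun (b : X.B) (_ : X.idx b = i) => V.F b) c hc

theorem refined_comp (i : X.A) : V.Refined i (V.comp (X.orb i)) := by
  rw [comp_eq_sSup]
  refine refined_sSup ?_
  rintro _ ⟨c, hc, rfl⟩
  exact .filt i c hc

variable (V) in
/-- The predecessor of `U` in the chain of refined subspaces. -/
def pred (i : X.A) (U : Submodule K V.V) : Submodule K V.V :=
  sSup {T | V.Refined i T ∧ T < U}

theorem refined_pred (i : X.A) (U : Submodule K V.V) : V.Refined i (V.pred i U) :=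
  refined_sSup fun _ h => h.1

theorem le_pred {i : X.A} {U T : Submodule K V.V} (hT : V.Refined i T) (h : T < U) :
    T ≤ V.pred i U := le_sSup ⟨hT, h⟩

theorem pred_le {i : X.A} {U : Submodule K V.V} : V.pred i U ≤ U :=
  sSup_le fun _ h => h.2.le

theorem pred_lt {i : X.A} {U : Submodule K V.V} (h : U ≠ ⊥) : V.pred i U < U :=
  (sSup_mem_of_refined (S := {T | V.Refined i T ∧ T < U}) (fun _ h => h.1)
    ⟨⊥, .bot i, bot_lt_iff_ne_bot.2 h⟩).2

/-- Take the least `b` with `U ≤ F_b`. A nonzero `F_{<b}` is itself some `F_c` with `c < b`, so `U ≤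
F_{<b}` would contradict minimality. -/
theorem exists_first {i : X.A} {U : Submodule K V.V} (hU : V.Refined i U) (h : U ≠ ⊥) :
    ∃ b, X.idx b = i ∧ U ≤ V.F b ∧ ¬ U ≤ below V.F b := by
  have h1 : ∃ b, X.idx b = i ∧ U ≤ V.F b := by
    have hle := hU.le_comp
    rw [comp_eq_sSup] at hle
    rcases Set.eq_empty_or_nonempty {T | ∃ c, X.idx c = i ∧ V.F c = T} with h' | h'
    · rw [h', sSup_empty] at hle
      exact absurd (le_bot_iff.1 hle) h
    · obtain ⟨c, hc, e⟩ := sSup_mem_of_refined (i := i)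
        (by rintro _ ⟨c, hc, rfl⟩; exact .filt i c hc) h'
      exact ⟨c, hc, e ▸ hle⟩
  obtain ⟨b, ⟨hb, hUb⟩, hmin⟩ := wellFounded_lt.has_min {b | X.idx b = i ∧ U ≤ V.F b} h1
  refine ⟨b, hb, hUb, fun hle => ?_⟩
  rw [below_eq_sSup] at hle
  rcases Set.eq_empty_or_nonempty {T | ∃ c, c < b ∧ V.F c = T} with h' | h'
  · rw [h', sSup_empty] at hle
    exact absurd (le_bot_iff.1 hle) h
  · obtain ⟨c, hc, e⟩ := sSup_mem_of_refined (i := i)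
      (by rintro _ ⟨c, hc, rfl⟩; exact .filt i c ((idx_eq_of_le hc.le).trans hb)) h'
    exact hmin c ⟨(idx_eq_of_le hc.le).trans hb, e ▸ hle⟩ hc

theorem first_unique {b c : X.B} {U : Submodule K V.V} (hbc : X.idx b = X.idx c)
    (hb : U ≤ V.F b) (hb' : ¬ U ≤ below V.F b) (hc : U ≤ V.F c) (hc' : ¬ U ≤ below V.F c) :
    b = c := by
  rcases le_below_or_le hbc with h | h | h
  · exact h
  · exact absurd (hb.trans (below_mono h)) hc'
  · exact absurd (hc.trans (below_mono h)) hb'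

end Refined

section Corner

variable (V : Rep.{u, v, w} K X)

/-- A pair of refined subspaces for the two filtrations of a summand `V_i`. -/
@[ext]
structure Corner where
  i : X.A
  U : Submodule K V.V
  W : Submodule K V.V
  hU : V.Refined i U
  hW : V.Refined (X.α i) W

variable {V}

namespace Corner

/-- The corner with the two filtrations exchanged. -/
def α (z : V.Corner) : V.Corner :=
  ⟨X.α z.i, z.W, z.U, z.hW, (X.α_invol z.i).symm ▸ z.hU⟩

theorem α_α (z : V.Corner) : z.α.α = z := Corner.ext (X.α_invol z.i) rfl rfl

/-- The subspace attached to a corner. -/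
def M (z : V.Corner) : Submodule K V.V := z.U ⊓ z.W

/-- The part of `M` that is smaller for the first filtration. -/
def L (z : V.Corner) : Submodule K V.V := V.pred z.i z.U ⊓ z.W

/-- The part of `M` that is smaller for one of the filtrations. -/
def N (z : V.Corner) : Submodule K V.V := z.L ⊔ z.α.L

theorem M_α (z : V.Corner) : z.α.M = z.M := inf_comm _ _

theorem N_α (z : V.Corner) : z.α.N = z.N := by
  rw [N, α_α, sup_comm]; rfl

theorem L_le_M (z : V.Corner) : z.L ≤ z.M := inf_le_inf_right _ pred_le

theorem L_le_N (z : V.Corner) : z.L ≤ z.N := le_sup_left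

theorem L_α_le_N (z : V.Corner) : z.α.L ≤ z.N := le_sup_right

theorem N_le_M (z : V.Corner) : z.N ≤ z.M :=
  sup_le z.L_le_M (z.M_α ▸ z.α.L_le_M)

end Corner

variable (V) in
/-- Corners whose graded piece is nonzero. -/
@[ext]
structure Piece where
  val : V.Corner
  nondegenerate : ¬ val.M ≤ val.N

namespace Piece

/-- The involution on pieces exchanging the filtrations. -/
def α (z : V.Piece) : V.Piece := ⟨z.1.α, by rw [z.1.M_α, z.1.N_α]; exact z.2⟩

theorem α_α (z : V.Piece) : z.α.α = z := Piece.ext z.1.α_α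

theorem U_ne_bot (z : V.Piece) : z.1.U ≠ ⊥ := fun h => z.2 <| by
  rw [Corner.M, h, bot_inf_eq]; exact bot_le

theorem W_ne_bot (z : V.Piece) : z.1.W ≠ ⊥ := z.α.U_ne_bot

/-- The element of `B` at which the first filtration of the piece jumps. -/
noncomputable def first (z : V.Piece) : X.B := (exists_first z.1.hU z.U_ne_bot).choose

theorem idx_first (z : V.Piece) : X.idx z.first = z.1.i :=
  (exists_first z.1.hU z.U_ne_bot).choose_spec.1

theorem U_le (z : V.Piece) : z.1.U ≤ V.F z.first :=
  (exists_first z.1.hU z.U_ne_bot).choose_spec.2.1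

theorem not_U_le (z : V.Piece) : ¬ z.1.U ≤ below V.F z.first :=
  (exists_first z.1.hU z.U_ne_bot).choose_spec.2.2

theorem refined_below (b : X.B) : V.Refined (X.idx b) (below V.F b) := by
  rw [below_eq_sSup]
  refine refined_sSup ?_
  rintro _ ⟨c, hc, rfl⟩
  exact .filt _ c (idx_eq_of_le hc.le)

/-- `F_{<b}` belongs to the refined chain. Consequently the indeterminacy of partners under `φ` is
absorbed into `L`. -/
theorem below_le_pred (z : V.Piece) : below V.F z.first ≤ V.pred z.1.i z.1.U := by
  have hr : V.Refined z.1.i (below V.F z.first) := z.idx_first ▸ refined_below z.first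
  refine le_pred hr (lt_of_le_not_ge ?_ z.not_U_le)
  exact (hr.total z.1.hU).resolve_right z.not_U_le

end Piece

/-- The refined subspaces `U` at `b` and `U'` at `c = β b` correspond to each other, and so do
their predecessors. -/
structure Matches (b c : X.B) (h : X.β b = some c) (U U' : Submodule K V.V) : Prop where
  eq : V.pre b c h U' = U
  eq_pred : V.pre b c h (V.pred (X.α (X.idx c)) U') = V.pred (X.idx b) U

/-- If `U'' < U'`, then `U''` is at most the predecessor of `U'`, so its preimage lies in the
predecessor of `U` and cannot be `U`. -/
theorem Matches.unique {b c : X.B} {h : X.β b = some c} {U U' U'' : Submodule K V.V}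
    (h' : V.Matches b c h U U') (h'' : V.Matches b c h U U'') (hU : U ≠ ⊥)
    (hr' : V.Refined (X.α (X.idx c)) U') (hr'' : V.Refined (X.α (X.idx c)) U'') : U' = U'' := by
  have key : ∀ U' U'', V.Matches b c h U U' → V.Matches b c h U U'' →
      V.Refined (X.α (X.idx c)) U' → V.Refined (X.α (X.idx c)) U'' → U' ≤ U'' := by
    intro U' U'' h' h'' hr' hr''
    refine hr'.le_of_not_lt hr'' fun hlt => ?_
    have := pre_mono (b := b) (h := h) (le_pred hr'' hlt)
    rw [h''.eq, h'.eq_pred] at this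
    exact absurd (pred_lt hU) this.not_gt
  exact le_antisymm (key _ _ h' h'' hr' hr'') (key _ _ h'' h' hr'' hr')

theorem exists_matches {b c : X.B} (h : X.β b = some c) {U : Submodule K V.V}
    (hU : V.Refined (X.idx b) U) (hb : U ≤ V.F b) (hb' : ¬ U ≤ below V.F b) :
    ∃ U', V.Refined (X.α (X.idx c)) U' ∧ V.Matches b c h U U' := by
  have h1 : ∃ T, V.Refined (X.α (X.idx c)) T ∧ V.pre b c h T = U := by
    rcases hU.trichotomy with h' | h' | ⟨c', h', T, hT, e⟩
    · exact absurd h' hb'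
    · refine ⟨_, refined_comp _, le_antisymm (pre_le.trans h') (hb.trans fun x hx => ?_)⟩
      obtain ⟨y, hy⟩ := exists_rel h hx
      refine mem_pre.2 ⟨y, ?_, hy⟩
      rw [X.orb_α]
      exact V.F_le_comp c (rel_right hy)
    · obtain rfl := Option.some.inj (h.symm.trans h')
      exact ⟨T, hT, e.symm⟩
  -- The smallest subspace with preimage `U` is chosen, so that its predecessor has a strictly
  -- smaller preimage.
  obtain ⟨U', ⟨hU', e⟩, hmin⟩ := wellFounded_lt.has_min
    {T | V.Refined (X.α (X.idx c)) T ∧ V.pre b c h T = U} h1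
  have hne : U' ≠ ⊥ := by
    rintro rfl
    exact hb' (e ▸ pre_bot)
  refine ⟨U', hU', e, le_antisymm (le_pred (.step _ b c h _ rfl (refined_pred _ _)) ?_)
    (sSup_le ?_)⟩
  · exact lt_of_le_of_ne (e ▸ pre_mono pred_le)
      fun h' => hmin _ ⟨refined_pred _ _, h'⟩ (pred_lt hne)
  · rintro T ⟨hT, hlt⟩
    rcases hT.trichotomy with h' | h' | ⟨c', h', T', hT', e'⟩
    · exact h'.trans below_le_pre
    · exact absurd (hlt.trans_le (hb.trans h')) (lt_irrefl _)
    · obtain rfl := Option.some.inj (h.symm.trans h')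
      rw [e']
      refine pre_mono (le_pred hT' (hT'.lt_of_not_le hU' fun hle => ?_))
      have := pre_mono (b := b) (h := h) hle
      rw [e, ← e'] at this
      exact absurd hlt this.not_gt

/-- The jump hypothesis says that `W` is the least member of its chain with the given preimage,
which is what makes predecessors correspond. -/
theorem matches_pre {b c : X.B} (h : X.β b = some c) {W : Submodule K V.V}
    (hW : V.Refined (X.α (X.idx b)) W)
    (hlt : ¬ V.pre c b (X.β_invol _ _ h) W ≤
      V.pre c b (X.β_invol _ _ h) (V.pred (X.α (X.idx b)) W)) :
    V.Matches c b (X.β_invol _ _ h) (V.pre c b (X.β_invol _ _ h) W) W := by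
  refine ⟨rfl, le_antisymm (le_pred (.step _ _ _ _ _ rfl (refined_pred _ _))
    (lt_of_le_not_ge (pre_mono pred_le) hlt)) (sSup_le ?_)⟩
  rintro T ⟨hT, hlt'⟩
  rcases hT.trichotomy with h' | h' | ⟨b', h', T', hT', rfl⟩
  · exact h'.trans below_le_pre
  · exact absurd (hlt'.trans_le (pre_le.trans h')) (lt_irrefl _)
  · obtain rfl := Option.some.inj ((X.β_invol _ _ h).symm.trans h')
    exact pre_mono (le_pred hT' (hT'.lt_of_not_le hW fun hle => absurd hlt' (pre_mono hle).not_gt))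

/-- The relation is read in both directions: the partner lies in `U` by definition of the preimage,
and in the transport of `W` because `x ∈ W`. -/
theorem exists_rel_inf {b c : X.B} {h : X.β b = some c} {x : V.V} {U W : Submodule K V.V}
    (hx : x ∈ V.pre b c h U ⊓ W) :
    ∃ y ∈ V.pre c b (X.β_invol _ _ h) W ⊓ U, (x, y) ∈ V.rel b c h := by
  obtain ⟨y, hy, hxy⟩ := mem_pre.1 hx.1
  exact ⟨y, ⟨mem_pre.2 ⟨x, hx.2, rel_symm hxy⟩, hy⟩, hxy⟩

end Corner

end Rep

end Net

/-! ### Adjacent pieces and compatible complements -/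

namespace Net

namespace Rep

variable {K : Type v} [Field K] {X : Net.{u}} {V : Rep.{u, v, w} K X}

/-- Two corners correspond to each other under the structure isomorphism `φ_b`. -/
structure Corner.Adj (b c : X.B) (h : X.β b = some c) (z z' : V.Corner) : Prop where
  hb : X.idx b = z.i
  hc : X.idx c = z'.i
  m : V.Matches b c h z.U z'.W
  m' : V.Matches c b (X.β_invol b c h) z'.U z.W
  below_le : below V.F b ≤ V.pred z.i z.U
  below_le' : below V.F c ≤ V.pred z'.i z'.U

namespace Corner.Adj

variable {b c : X.B} {h : X.β b = some c} {z z' : V.Corner} (a : Corner.Adj b c h z z')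
include a

theorem symm : Corner.Adj c b (X.β_invol b c h) z' z :=
  ⟨a.hc, a.hb, a.m', a.m, a.below_le', a.below_le⟩

theorem exists_M {x : V.V} (hx : x ∈ z.M) : ∃ y ∈ z'.M, (x, y) ∈ V.rel b c h := by
  have h1 := a.m.eq
  have h2 := a.m'.eq
  rw [Corner.M, ← h1] at hx
  obtain ⟨y, hy, hxy⟩ := exists_rel_inf hx
  rw [h2] at hy
  exact ⟨y, hy, hxy⟩

/-- Crossing an edge exchanges the two filtrations: smaller for the first one at `z` means smaller
for the second one at `z'`. -/
theorem exists_L {x : V.V} (hx : x ∈ z.L) : ∃ y ∈ z'.α.L, (x, y) ∈ V.rel b c h := by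
  have h1 := a.m.eq_pred
  have h2 := a.m'.eq
  rw [Corner.L, ← a.hb, ← h1] at hx
  obtain ⟨y, hy, hxy⟩ := exists_rel_inf hx
  rw [h2, a.hc] at hy
  exact ⟨y, hy.symm, hxy⟩

theorem exists_L_α {x : V.V} (hx : x ∈ z.α.L) : ∃ y ∈ z'.L, (x, y) ∈ V.rel b c h := by
  have h1 := a.m.eq
  have h2 := a.m'.eq_pred
  have hx' : x ∈ z.U ⊓ V.pred (X.α z.i) z.W := hx.symm
  rw [← h1] at hx'
  obtain ⟨y, hy, hxy⟩ := exists_rel_inf hx'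
  rw [← a.hb, h2, a.hc] at hy
  exact ⟨y, hy, hxy⟩

theorem exists_N {x : V.V} (hx : x ∈ z.N) : ∃ y ∈ z'.N, (x, y) ∈ V.rel b c h := by
  obtain ⟨x₁, h₁, x₂, h₂, rfl⟩ := Submodule.mem_sup.1 hx
  obtain ⟨y₁, hy₁, e₁⟩ := a.exists_L h₁
  obtain ⟨y₂, hy₂, e₂⟩ := a.exists_L_α h₂
  exact ⟨y₁ + y₂, Submodule.add_mem _ (z'.L_α_le_N hy₁) (z'.L_le_N hy₂),
    Submodule.add_mem _ e₁ e₂⟩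

/-- Partners are determined modulo `F_{<c}`, whose intersection with `M` lies in `L ⊆ N`. So the
relation descends to a map between the quotients `M / N`. -/
theorem mem_N {x y : V.V} (hx : x ∈ z.N) (hxy : (x, y) ∈ V.rel b c h) (hy : y ∈ z'.M) :
    y ∈ z'.N := by
  obtain ⟨y', hy', hxy'⟩ := a.exists_N hx
  have h1 := rel_sub_right hxy hxy'
  have h2 : y - y' ∈ z'.L :=
    ⟨a.below_le' h1, (Submodule.sub_mem _ hy (z'.N_le_M hy')).2⟩
  rw [← sub_add_cancel y y']
  exact Submodule.add_mem _ (z'.L_le_N h2) hy'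

end Corner.Adj

namespace Piece

/-- Two pieces correspond to each other under a structure isomorphism. -/
structure Adj (z z' : V.Piece) : Prop where
  β : X.β z.first = some z'.first
  adj : Corner.Adj z.first z'.first β z.1 z'.1

theorem Adj.symm {z z' : V.Piece} (a : Adj z z') : Adj z' z := ⟨X.β_invol _ _ a.β, a.adj.symm⟩

theorem Adj.ne {z z' : V.Piece} (a : Adj z z') : z ≠ z' := by
  rintro rfl
  exact X.β_ne _ a.β

/-- The first subspace of the neighbour is the transport of `W`; the second is determined by
`Matches.unique`. -/
theorem Adj.unique {z z₁ z₂ : V.Piece} (a₁ : Adj z z₁) (a₂ : Adj z z₂) : z₁ = z₂ := by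
  obtain ⟨h₁, a₁⟩ := a₁
  obtain ⟨h₂, a₂⟩ := a₂
  have e : z₁.first = z₂.first := Option.some.inj (h₁.symm.trans h₂)
  generalize z₁.first = c₁ at h₁ a₁ e
  generalize z₂.first = c₂ at h₂ a₂ e
  subst e
  refine Piece.ext (Corner.ext (a₁.hc.symm.trans a₂.hc) (a₁.m'.eq.symm.trans a₂.m'.eq)
    (a₁.m.unique a₂.m z.U_ne_bot ?_ ?_))
  · rw [a₁.hc]; exact z₁.1.hW
  · rw [a₂.hc]; exact z₂.1.hW

/-- The neighbour has the transport of `W` as first subspace and the match `U'` of `U` as second. A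
vector `x ∈ M \ N` and its partner `y` show both that the transport of `W` jumps and that the new
corner is nondegenerate. -/
theorem exists_adj (z : V.Piece) {c : X.B} (h : X.β z.first = some c) :
    ∃ z' : V.Piece, Adj z z' ∧ z'.first = c := by
  have hW : V.Refined (X.α (X.idx z.first)) z.1.W := by rw [idx_first]; exact z.1.hW
  obtain ⟨U', hU', m⟩ := exists_matches h (U := z.1.U) (by rw [idx_first]; exact z.1.hU)
    z.U_le z.not_U_le
  obtain ⟨x, hx, hxN⟩ := SetLike.not_le_iff_exists.1 z.2
  obtain ⟨y, hy, hxy⟩ : ∃ y ∈ V.pre c z.first (X.β_invol _ _ h) z.1.W ⊓ U',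
      (x, y) ∈ V.rel z.first c h := by
    rw [Corner.M, ← m.eq] at hx
    exact exists_rel_inf hx
  -- If `y` had a partner `x'` in the predecessor of `W`, then `x = (x - x') + x'` would split into
  -- a part in `L`, coming from `F_{<b}`, and a part in `α.L`, forcing `x ∈ N`.
  have hlt : ¬ V.pre c z.first (X.β_invol _ _ h) z.1.W ≤
      V.pre c z.first (X.β_invol _ _ h) (V.pred (X.α (X.idx z.first)) z.1.W) := fun hle => by
    obtain ⟨x', hx', hyx'⟩ := mem_pre.1 (hle hy.1)
    have h1 := rel_sub_left hxy (rel_symm hyx')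
    have h2 : x - x' ∈ z.1.L := ⟨z.below_le_pred h1, Submodule.sub_mem _ hx.2 (pred_le hx')⟩
    have h3 : x' ∈ z.1.α.L := by
      refine ⟨by rw [z.idx_first] at hx'; exact hx', ?_⟩
      have := Submodule.sub_mem _ hx.1 (pred_le h2.1)
      rwa [sub_sub_cancel] at this
    refine hxN ?_
    rw [← sub_add_cancel x x']
    exact Submodule.add_mem _ (z.1.L_le_N h2) (z.1.L_α_le_N h3)
  have m' := matches_pre h hW hlt
  let z' : V.Corner := ⟨X.idx c, _, U', .step _ c z.first (X.β_invol _ _ h) z.1.W rfl hW, hU'⟩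
  have a : Corner.Adj z.first c h z.1 z' :=
    ⟨z.idx_first, rfl, m, m', z.below_le_pred, m'.eq_pred ▸ below_le_pre⟩
  have hz' : ¬ z'.M ≤ z'.N := fun hle =>
    hxN (a.symm.mem_N (hle hy) (rel_symm hxy) hx)
  let p : V.Piece := ⟨z', hz'⟩
  have hp : p.first = c := first_unique (p.idx_first.trans rfl) p.U_le p.not_U_le pre_le
    fun h' => hlt (h'.trans below_le_pre)
  -- The type of the adjacency depends on the element of `B`; quantifying over `d` allows the
  -- equality `p.first = c` to be substituted.
  have key : ∀ d (_ : d = c) (h' : X.β z.first = some d), Corner.Adj z.first d h' z.1 z' := by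
    rintro _ rfl _; exact a
  have h' : X.β z.first = some p.first := by rw [hp, h]
  exact ⟨p, ⟨h', key _ hp h'⟩, hp⟩

theorem eq_of_refined {i : X.A} {U U' : Submodule K V.V} (hU : V.Refined i U)
    (hU' : V.Refined i U') (h : Module.finrank K U = Module.finrank K U') : U = U' := by
  rcases hU.total hU' with h' | h'
  · exact Submodule.eq_of_le_of_finrank_eq h' h
  · exact (Submodule.eq_of_le_of_finrank_eq h' h.symm).symm

/-- Members of a chain are determined by their dimensions. -/
instance : Finite V.Piece := by
  let d := Module.finrank K V.V
  have hd : ∀ U : Submodule K V.V, Module.finrank K U < d + 1 := fun U =>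
    Nat.lt_succ_of_le (Submodule.finrank_le U)
  refine Finite.of_injective (β := X.A × Fin (d + 1) × Fin (d + 1))
    (fun z => (z.1.i, ⟨_, hd z.1.U⟩, ⟨_, hd z.1.W⟩)) fun z z' h => ?_
  simp only [Prod.mk.injEq, Fin.mk.injEq] at h
  obtain ⟨h1, h2, h3⟩ := h
  exact Piece.ext (Corner.ext h1 (eq_of_refined z.1.hU (h1 ▸ z'.1.hU) h2)
    (eq_of_refined z.1.hW (h1 ▸ z'.1.hW) h3))

theorem exists_complement {M N : Submodule K V.V} (h : N ≤ M) :
    ∃ C : Submodule K V.V, C ⊔ N = M ∧ C ⊓ N = ⊥ := by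
  obtain ⟨C, hC⟩ := exists_isCompl N
  refine ⟨C ⊓ M, ?_, ?_⟩
  · rw [inf_comm, inf_sup_assoc_of_le C h, hC.symm.sup_eq_top, inf_top_eq]
  · rw [inf_right_comm, hC.symm.inf_eq_bot, bot_inf_eq]

/-- A complement of `N` in `M`. -/
noncomputable def C (z : V.Piece) : Submodule K V.V := (exists_complement z.1.N_le_M).choose

theorem C_sup (z : V.Piece) : z.C ⊔ z.1.N = z.1.M :=
  (exists_complement z.1.N_le_M).choose_spec.1

theorem C_inf (z : V.Piece) : z.C ⊓ z.1.N = ⊥ :=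
  (exists_complement z.1.N_le_M).choose_spec.2

theorem C_α (z : V.Piece) : z.α.C = z.C := by
  have : ∀ (M M' N N' : Submodule K V.V) (h : N ≤ M) (h' : N' ≤ M'), M = M' → N = N' →
      (exists_complement h).choose = (exists_complement h').choose := by
    rintro M _ N _ h h' rfl rfl; rfl
  exact this _ _ _ _ z.α.1.N_le_M z.1.N_le_M z.1.M_α z.1.N_α

theorem C_le_M (z : V.Piece) : z.C ≤ z.1.M := z.C_sup ▸ le_sup_left

/-- A family of linear maps inducing the identification of the spaces `M / N` of adjacent
pieces. -/
def IsTransport (T : V.Piece → V.Piece → V.V →ₗ[K] V.V) : Prop :=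
  ∀ z z' (a : Adj z z'), ∀ x ∈ z.C, T z z' x ∈ z'.C ∧
    ∃ n ∈ z'.1.N, (x, T z z' x + n) ∈ V.rel z.first z'.first a.β

theorem exists_isTransport : ∃ T : V.Piece → V.Piece → V.V →ₗ[K] V.V, IsTransport T := by
  have : ∀ z z' : V.Piece, ∃ T : V.V →ₗ[K] V.V, ∀ (a : Adj z z'), ∀ x ∈ z.C, T x ∈ z'.C ∧
      ∃ n ∈ z'.1.N, (x, T x + n) ∈ V.rel z.first z'.first a.β := by
    intro z z'
    by_cases a : Adj z z'
    · obtain ⟨m, hm⟩ := exists_linear_choice z.C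
        (V.rel z.first z'.first a.β ⊓ z'.1.M.comap (LinearMap.snd K _ _)) fun x hx => by
          obtain ⟨y, hy, hxy⟩ := a.adj.exists_M (z.C_le_M hx)
          exact ⟨y, hxy, hy⟩
      -- `p` projects `M = C ⊕ N` onto `C`; replacing a partner by its projection costs an error in
      -- `N`.
      obtain ⟨p, hp⟩ := exists_linear_choice z'.1.M
        (z'.C.comap (LinearMap.snd K _ _) ⊓
          z'.1.N.comap (LinearMap.fst K _ _ - LinearMap.snd K _ _)) fun x hx => by
          obtain ⟨y, hy, n, hn, rfl⟩ := Submodule.mem_sup.1 (z'.C_sup.symm ▸ hx)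
          refine ⟨y, hy, ?_⟩
          change y + n - y ∈ z'.1.N
          rwa [add_sub_cancel_left]
      refine ⟨p ∘ₗ m, fun _ x hx => ⟨(hp _ (hm x hx).2).1, _, (hp _ (hm x hx).2).2, ?_⟩⟩
      change (x, p (m x) + (m x - p (m x))) ∈ V.rel z.first z'.first a.β
      rw [add_sub_cancel]
      exact (hm x hx).1
    · exact ⟨0, fun a' => absurd a' a⟩
  choose T hT using this
  exact ⟨T, hT⟩

/-- Going across and back changes `x` by an element of `N`, and `C` meets `N` trivially. -/
theorem IsTransport.inv {T : V.Piece → V.Piece → V.V →ₗ[K] V.V} (hT : IsTransport T)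
    {z z' : V.Piece} (a : Adj z z') {x : V.V} (hx : x ∈ z.C) : T z' z (T z z' x) = x := by
  obtain ⟨h1, n, hn, h2⟩ := hT z z' a x hx
  obtain ⟨h3, n', hn', h4⟩ := hT z' z a.symm _ h1
  have h5 := Submodule.sub_mem _ h2 (rel_symm h4)
  rw [Prod.mk_sub_mk, add_sub_cancel_left] at h5
  have h6 : x - (T z' z (T z z' x) + n') ∈ z.1.M := Submodule.sub_mem _ (z.C_le_M hx)
    (Submodule.add_mem _ (z.C_le_M h3) (z.1.N_le_M hn'))
  have h7 := Submodule.add_mem _ (a.adj.symm.mem_N hn (rel_symm h5) h6) hn'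
  rw [sub_add_eq_sub_sub, sub_add_cancel] at h7
  have h8 : x - T z' z (T z z' x) ∈ z.C ⊓ z.1.N := ⟨Submodule.sub_mem _ hx h3, h7⟩
  rw [C_inf, Submodule.mem_bot, sub_eq_zero] at h8
  exact h8.symm

/-- A family of linear maps respecting the relations between adjacent pieces. -/
def Compatible (T : V.Piece → V.Piece → V.V →ₗ[K] V.V) (c : V.Piece → V.V →ₗ[K] V.V) : Prop :=
  ∀ z z' (a : Adj z z'), ∀ x ∈ z.C,
    (c z x, c z' (T z z' x)) ∈ V.rel z.first z'.first a.β

open Classical in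
/-- The family of linear maps supported at one piece. -/
noncomputable def single (z : V.Piece) (n : V.V →ₗ[K] V.V) (w : V.Piece) : V.V →ₗ[K] V.V :=
  if w = z then n else 0

theorem single_same (z : V.Piece) (n : V.V →ₗ[K] V.V) : single z n z = n := if_pos rfl

theorem single_ne {z w : V.Piece} (h : w ≠ z) (n : V.V →ₗ[K] V.V) : single z n w = 0 := if_neg h

theorem single_α (z w : V.Piece) (n : V.V →ₗ[K] V.V) : single z n w.α = single z.α n w := by
  have : w.α = z ↔ w = z.α := ⟨fun h => by rw [← h, α_α], fun h => by rw [h, α_α]⟩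
  by_cases h : w = z.α
  · rw [h, single_same, α_α, single_same]
  · rw [single_ne h, single_ne (mt this.1 h)]

theorem single_mem {z w : V.Piece} {n : V.V →ₗ[K] V.V} {S : V.Piece → Submodule K V.V}
    (h : ∀ x ∈ z.C, n x ∈ S z) : ∀ x ∈ w.C, single z n w x ∈ S w := fun x hx => by
  by_cases hw : w = z
  · subst hw
    rw [single_same]
    exact h x hx
  · rw [single_ne hw]
    exact Submodule.zero_mem _

/-- Every map to the part of `M` that is smaller for the first filtration is the boundary of a
compatible family. -/
theorem exists_correction {T : V.Piece → V.Piece → V.V →ₗ[K] V.V} (hT : IsTransport T)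
    {i : X.A} {Y : Submodule K V.V} (hY : V.Refined i Y) : ∀ (z : V.Piece), z.1.i = i →
    Y < z.1.U → ∀ n : V.V →ₗ[K] V.V, (∀ x ∈ z.C, n x ∈ Y ⊓ z.1.W) →
    ∃ c : V.Piece → V.V →ₗ[K] V.V, (∀ w, ∀ x ∈ w.C, c w x ∈ w.1.N) ∧ Compatible T c ∧
      ∀ w x, c w x - c w.α x = single z n w x - single z.α n w x := by
  -- Vectors in lower filtration steps are always related, so a perturbation with values in `F_{<b}`
  -- is compatible even when supported at `z` alone.
  have base : ∀ (z : V.Piece) (Y : Submodule K V.V), Y ≤ below V.F z.first →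
      ∀ n : V.V →ₗ[K] V.V, (∀ x ∈ z.C, n x ∈ Y ⊓ z.1.W) →
      ∃ c : V.Piece → V.V →ₗ[K] V.V, (∀ w, ∀ x ∈ w.C, c w x ∈ w.1.N) ∧ Compatible T c ∧
        ∀ w x, c w x - c w.α x = single z n w x - single z.α n w x := by
    intro z Y hY n hn
    refine ⟨single z n, fun w => single_mem (S := fun w => w.1.N) fun x hx => ?_,
      fun w w' a x hx => ?_, fun w x => by rw [single_α]⟩
    · exact z.1.L_le_N ⟨z.below_le_pred (hY (hn x hx).1), (hn x hx).2⟩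
    · have h1 : ∀ w, ∀ x ∈ w.C, single z n w x ∈ below V.F w.first := fun w =>
        single_mem (S := fun w => below V.F w.first) fun x hx => hY (hn x hx).1
      exact rel_of_below _ (h1 w x hx) (h1 w' _ (hT w w' a x hx).1)
  induction hY with
  | bot i => exact fun z _ _ n hn => base z ⊥ bot_le n hn
  | filt i b hb =>
    intro z hz hlt n hn
    have hidx : X.idx b = X.idx z.first := by rw [hb, z.idx_first, hz]
    -- From `F_b < U ≤ F_first` only `b < first` is possible.
    rcases le_below_or_le hidx with rfl | h | h
    · exact absurd (hlt.trans_le z.U_le) (lt_irrefl _)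
    · exact base z _ (below_mono h) n hn
    · exact absurd (hlt.trans_le (z.U_le.trans (V.F_mono h.le))) (lt_irrefl _)
  | step i b c h Y' hb hY' ih =>
    intro z hz hlt n hn
    have hidx : X.idx b = X.idx z.first := by rw [hb, z.idx_first, hz]
    rcases le_below_or_le hidx with rfl | h' | h'
    · obtain ⟨z', a, rfl⟩ := z.exists_adj h
      -- `n'` is the perturbation at the neighbour corresponding to `n` across the edge. Its values
      -- lie in `Y'`, whose construction is one step shorter than that of `Y`.
      obtain ⟨n', hn'⟩ := exists_linear_choice z'.C
        (((V.rel z.first z'.first h).comap ((n ∘ₗ T z' z).prodMap LinearMap.id)) ⊓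
          (z'.1.U ⊓ Y').comap (LinearMap.snd K _ _)) fun x hx => by
          have h1 := hn _ (hT z' z a.symm x hx).1
          obtain ⟨y, hy, hxy⟩ := exists_rel_inf h1
          rw [a.adj.m'.eq] at hy
          exact ⟨y, hxy, hy⟩
      have hn'1 : ∀ x ∈ z'.C, (n (T z' z x), n' x) ∈ V.rel z.first z'.first h :=
        fun x hx => (hn' x hx).1
      have hn'2 : ∀ x ∈ z'.C, n' x ∈ z'.1.U ⊓ Y' := fun x hx => (hn' x hx).2
      have hlt' : Y' < z'.1.W := by
        have e : X.α (X.idx z'.first) = X.α z'.1.i := by rw [z'.idx_first]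
        refine hY'.lt_of_not_le (e ▸ z'.1.hW) fun hle => ?_
        have := pre_mono (b := z.first) (h := h) hle
        rw [a.adj.m.eq] at this
        exact absurd hlt this.not_gt
      -- `Y'` belongs to the second chain at `z'`, hence to the first chain at `z'.α`, where the
      -- induction hypothesis applies.
      obtain ⟨c', hc'N, hc'T, hc'α⟩ := ih z'.α (by rw [z'.idx_first]; rfl) hlt' n'
        (fun x hx => (hn'2 x (z'.C_α ▸ hx)).symm)
      rw [α_α] at hc'α
      -- The pair `n`, `n'` is compatible along the edge, and the boundary of `c'` cancels the
      -- asymmetry of `n'` at `z'`; only that of `n` at `z` remains.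
      refine ⟨fun w => c' w + single z n w + single z' n' w, fun w x hx => ?_,
        fun w w' a' x hx => ?_, fun w x => ?_⟩
      · refine Submodule.add_mem _ (Submodule.add_mem _ (hc'N w x hx) ?_) ?_
        · refine single_mem (S := fun w => w.1.N) (fun x hx => z.1.L_le_N ?_) x hx
          exact ⟨le_pred (hz ▸ .step _ _ _ h _ hb hY') hlt (hn x hx).1, (hn x hx).2⟩
        · refine single_mem (S := fun w => w.1.N) (fun x hx => z'.1.L_α_le_N ?_) x hx
          refine ⟨le_pred ?_ hlt' (hn'2 x hx).2, (hn'2 x hx).1⟩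
          have e : X.α (X.idx z'.first) = X.α z'.1.i := by rw [z'.idx_first]
          exact (show V.Refined (X.α z'.1.i) Y' from e ▸ hY')
      · simp only [LinearMap.add_apply, add_assoc]
        rw [← Prod.mk_add_mk]
        refine Submodule.add_mem _ (hc'T w w' a' x hx) ?_
        by_cases hw : w = z
        · subst hw
          obtain rfl := a.unique a'
          rw [single_same, single_same, single_ne a.ne, single_ne a.ne.symm,
            LinearMap.zero_apply, LinearMap.zero_apply, add_zero, zero_add]
          have := hn'1 _ (hT _ _ a x hx).1
          rwa [hT.inv a hx] at this
        · by_cases hw' : w = z'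
          · subst hw'
            obtain rfl := a.symm.unique a'
            rw [single_same, single_same, single_ne a.ne, single_ne a.ne.symm,
              LinearMap.zero_apply, LinearMap.zero_apply, add_zero, zero_add]
            exact rel_symm (hn'1 x hx)
          · have h1 : w' ≠ z := fun e => hw' ((a'.symm.unique (e ▸ a)))
            have h2 : w' ≠ z' := fun e => hw ((a'.symm.unique (e ▸ a.symm)))
            rw [single_ne hw, single_ne hw', single_ne h1, single_ne h2]
            simp only [LinearMap.zero_apply, add_zero]
            exact Submodule.zero_mem _
      · simp only [LinearMap.add_apply, single_α]
        have := hc'α w x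
        rw [sub_eq_iff_eq_add] at this
        rw [this]
        abel
    · exact base z _ (pre_le.trans (below_mono h')) n hn
    · exact absurd (hlt.trans_le ((z.U_le.trans (below_mono h')).trans below_le_pre))
        (lt_irrefl _)

/-- Approximate embeddings of the complements, which agree for the two orientations of a piece. -/
structure IsLift (θ : V.Piece → V.V →ₗ[K] V.V) : Prop where
  symm : ∀ w, ∀ x ∈ w.C, θ w x = θ w.α x
  sub_mem : ∀ w, ∀ x ∈ w.C, θ w x - x ∈ w.1.N

theorem IsLift.mem_M {θ : V.Piece → V.V →ₗ[K] V.V} (h : IsLift θ) {w : V.Piece} {x : V.V}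
    (hx : x ∈ w.C) : θ w x ∈ w.1.M := by
  rw [← sub_add_cancel (θ w x) x]
  exact Submodule.add_mem _ (w.1.N_le_M (h.sub_mem w x hx)) (w.C_le_M hx)

/-- The defect of `θ` along the edge lies in `N = L + α.L` at `z'`. Its `L` part is moved across to
`z`, where it becomes small for the second filtration. Both parts are then small on the sides away
from the edge, where `exists_correction` disposes of them by families compatible with every edge, so
edges already repaired stay repaired. -/
theorem IsLift.improve {T : V.Piece → V.Piece → V.V →ₗ[K] V.V} (hT : IsTransport T)
    {θ : V.Piece → V.V →ₗ[K] V.V} (hθ : IsLift θ) {z z' : V.Piece} (a : Adj z z') :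
    ∃ θ' : V.Piece → V.V →ₗ[K] V.V, IsLift θ' ∧
      (∀ x ∈ z.C, (θ' z x, θ' z' (T z z' x)) ∈ V.rel z.first z'.first a.β) ∧
      ∀ w w' (a' : Adj w w'), w ≠ z → w ≠ z' →
        (∀ x ∈ w.C, (θ w x, θ w' (T w w' x)) ∈ V.rel w.first w'.first a'.β) →
        ∀ x ∈ w.C, (θ' w x, θ' w' (T w w' x)) ∈ V.rel w.first w'.first a'.β := by
  obtain ⟨p, hp⟩ := exists_linear_choice z.C (W := V.V × V.V)
    ({ carrier := {q | q.2.1 ∈ z.1.α.L ∧ q.2.2 ∈ z'.1.α.L ∧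
        (θ z q.1 - q.2.1, θ z' (T z z' q.1) + q.2.2) ∈ V.rel z.first z'.first a.β}
       zero_mem' := by
        refine ⟨Submodule.zero_mem _, Submodule.zero_mem _, ?_⟩
        simp only [Prod.fst_zero, Prod.snd_zero, map_zero, sub_zero, add_zero]
        exact Submodule.zero_mem (V.rel z.first z'.first a.β)
       add_mem' := by
        rintro q r ⟨h1, h2, h3⟩ ⟨h1', h2', h3'⟩
        refine ⟨Submodule.add_mem _ h1 h1', Submodule.add_mem _ h2 h2', ?_⟩
        have := Submodule.add_mem _ h3 h3'
        rw [Prod.mk_add_mk, sub_add_sub_comm, add_add_add_comm] at this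
        simpa using this
       smul_mem' := by
        rintro r q ⟨h1, h2, h3⟩
        refine ⟨Submodule.smul_mem _ _ h1, Submodule.smul_mem _ _ h2, ?_⟩
        have := Submodule.smul_mem _ r h3
        rw [Prod.smul_mk, smul_sub, smul_add] at this
        simpa using this } : Submodule K (V.V × V.V × V.V)) fun x hx => by
      obtain ⟨hTx, n, hn, hxn⟩ := hT z z' a x hx
      obtain ⟨n', hn', hxn'⟩ := a.adj.exists_N (hθ.sub_mem z x hx)
      have h1 := Submodule.add_mem _ hxn' hxn
      rw [Prod.mk_add_mk, sub_add_cancel] at h1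
      have h2 : n' + (T z z' x + n) - θ z' (T z z' x) ∈ z'.1.N := by
        have := Submodule.sub_mem _ (Submodule.add_mem _ hn' hn) (hθ.sub_mem z' _ hTx)
        convert this using 1
        abel
      -- The defect is `y₁ + y₂`: `y₁` is replaced by a partner `x₁` subtracted at `z`, while `y₂`
      -- is added at `z'`.
      obtain ⟨y₁, hy₁, y₂, hy₂, e⟩ := Submodule.mem_sup.1 h2
      obtain ⟨x₁, hx₁, hxy₁⟩ := a.adj.symm.exists_L hy₁
      refine ⟨(x₁, y₂), hx₁, hy₂, ?_⟩
      have := Submodule.sub_mem _ h1 (rel_symm hxy₁)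
      rw [Prod.mk_sub_mk] at this
      convert this using 2
      rw [eq_sub_iff_add_eq, add_assoc, add_comm y₂, e, add_sub_cancel]
  let m : V.V →ₗ[K] V.V := LinearMap.fst K _ _ ∘ₗ p
  let n : V.V →ₗ[K] V.V := LinearMap.snd K _ _ ∘ₗ p ∘ₗ T z' z
  have hm : ∀ x ∈ z.C, m x ∈ z.1.α.L := fun x hx => (hp x hx).1
  have hn : ∀ x ∈ z'.C, n x ∈ z'.1.α.L := fun x hx => (hp _ (hT z' z a.symm x hx).1).2.1
  have hmn : ∀ x ∈ z.C, (θ z x - m x, θ z' (T z z' x) + n (T z z' x)) ∈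
      V.rel z.first z'.first a.β := fun x hx => by
    have := (hp x hx).2.2
    change (θ z x - m x, θ z' (T z z' x) + (p (T z' z (T z z' x))).2) ∈ _
    rw [hT.inv a hx]
    exact this
  obtain ⟨c₁, h₁N, h₁T, h₁α⟩ := exists_correction hT (refined_pred (V := V) (X.α z.1.i) z.1.W) z.α
    rfl (pred_lt z.W_ne_bot) m (fun x hx => hm x (z.C_α ▸ hx))
  obtain ⟨c₂, h₂N, h₂T, h₂α⟩ := exists_correction hT (refined_pred (V := V) (X.α z'.1.i) z'.1.W)
    z'.α rfl (pred_lt z'.W_ne_bot) n (fun x hx => hn x (z'.C_α ▸ hx))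
  rw [α_α] at h₁α h₂α
  have hsub : ∀ w w' (a' : Adj w w') (x : V.V), x ∈ w.C →
      (c₂ w x - c₁ w x, c₂ w' (T w w' x) - c₁ w' (T w w' x)) ∈ V.rel w.first w'.first a'.β :=
    fun w w' a' x hx => Submodule.sub_mem _ (h₂T w w' a' x hx) (h₁T w w' a' x hx)
  -- Changing `θ` at `z` and `z'` only would destroy the symmetry under `α`; the boundaries of `c₁`
  -- and `c₂` restore it.
  refine ⟨fun w => (θ w - single z m w + single z' n w) + (c₂ w - c₁ w),
    ⟨fun w x hx => ?_, fun w x hx => ?_⟩, fun x hx => ?_, fun w w' a' hwz hwz' hg x hx => ?_⟩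
  · have e₁ := h₁α w x
    have e₂ := h₂α w x
    rw [sub_eq_iff_eq_add] at e₁ e₂
    simp only [LinearMap.add_apply, LinearMap.sub_apply, single_α, e₁, e₂, hθ.symm w x hx]
    abel
  · have h1 : single z m w x ∈ w.1.N :=
      single_mem (S := fun w => w.1.N) (fun x hx => z.1.L_α_le_N (hm x hx)) x hx
    have h2 : single z' n w x ∈ w.1.N :=
      single_mem (S := fun w => w.1.N) (fun x hx => z'.1.L_α_le_N (hn x hx)) x hx
    have := Submodule.add_mem _ (Submodule.add_mem _ (Submodule.sub_mem _ (hθ.sub_mem w x hx) h1) h2)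
      (Submodule.sub_mem _ (h₂N w x hx) (h₁N w x hx))
    simp only [LinearMap.add_apply, LinearMap.sub_apply]
    convert this using 1
    abel
  · have := Submodule.add_mem _ (hmn x hx) (hsub z z' a x hx)
    rw [Prod.mk_add_mk] at this
    simp only [LinearMap.add_apply, LinearMap.sub_apply]
    rwa [single_same, single_ne a.ne, single_ne a.ne.symm, single_same, LinearMap.zero_apply,
      LinearMap.zero_apply, add_zero, sub_zero]
  · have h1 : w' ≠ z := fun e => hwz' ((a'.symm.unique (e ▸ a)))
    have h2 : w' ≠ z' := fun e => hwz ((a'.symm.unique (e ▸ a.symm)))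
    have := Submodule.add_mem _ (hg x hx) (hsub w w' a' x hx)
    rw [Prod.mk_add_mk] at this
    simp only [LinearMap.add_apply, LinearMap.sub_apply]
    rwa [single_ne hwz, single_ne hwz', single_ne h1, single_ne h2, LinearMap.zero_apply,
      LinearMap.zero_apply, add_zero, sub_zero, add_zero, sub_zero]

/-- Starting from the identity, edges are repaired one at a time by `IsLift.improve`; there are
finitely many. -/
theorem exists_compatible_lift {T : V.Piece → V.Piece → V.V →ₗ[K] V.V} (hT : IsTransport T) :
    ∃ θ : V.Piece → V.V →ₗ[K] V.V, IsLift θ ∧ Compatible T θ := by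
  classical
  let := Fintype.ofFinite V.Piece
  suffices h : ∀ S : Finset V.Piece, ∃ θ : V.Piece → V.V →ₗ[K] V.V, IsLift θ ∧
      ∀ z ∈ S, ∀ z' (a : Adj z z'), ∀ x ∈ z.C,
        (θ z x, θ z' (T z z' x)) ∈ V.rel z.first z'.first a.β by
    obtain ⟨θ, h1, h2⟩ := h Finset.univ
    exact ⟨θ, h1, fun z => h2 z (Finset.mem_univ z)⟩
  intro S
  induction S using Finset.induction_on with
  | empty =>
    refine ⟨fun _ => LinearMap.id, ⟨fun _ _ _ => rfl, fun w x _ => ?_⟩, by simp⟩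
    rw [LinearMap.id_apply, sub_self]
    exact Submodule.zero_mem _
  | insert z S hz ih =>
    obtain ⟨θ, hθ, hS⟩ := ih
    by_cases hadj : ∃ z', Adj z z'
    · obtain ⟨z', a⟩ := hadj
      obtain ⟨θ', hθ', hg, hkeep⟩ := hθ.improve hT a
      refine ⟨θ', hθ', fun w hw w' a' => ?_⟩
      by_cases hwz : w = z
      · subst hwz
        obtain rfl := a.unique a'
        exact hg
      -- This is the repaired edge seen from its other end.
      by_cases hwz' : w = z'
      · subst hwz'
        obtain rfl := a.symm.unique a'
        intro x hx
        have := hg _ (hT _ _ a' x hx).1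
        rw [hT.inv a' hx] at this
        exact rel_symm this
      · exact hkeep w w' a' hwz hwz' (hS w ((Finset.mem_insert.1 hw).resolve_left hwz) w' a')
    · refine ⟨θ, hθ, fun w hw w' a' => ?_⟩
      rcases Finset.mem_insert.1 hw with rfl | hw
      · exact absurd ⟨w', a'⟩ hadj
      · exact hS w hw w' a'

/-- Complements compatible with the structure isomorphisms. -/
theorem exists_compatible_complements (V : Rep.{u, v, w} K X) :
    ∃ C : V.Piece → Submodule K V.V, (∀ z, C z ⊔ z.1.N = z.1.M) ∧ (∀ z, C z ⊓ z.1.N = ⊥) ∧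
      (∀ z, C z.α = C z) ∧ ∀ z z' (a : Adj z z'), ∀ x ∈ C z, ∃ y ∈ C z',
        (x, y) ∈ V.rel z.first z'.first a.β := by
  obtain ⟨T, hT⟩ := exists_isTransport (V := V)
  obtain ⟨θ, hθ, hc⟩ := exists_compatible_lift hT
  -- The image of a complement under `θ` is again a complement, because `θ` differs from the
  -- identity by values in `N`.
  refine ⟨fun z => z.C.map (θ z), fun z => ?_, fun z => ?_, fun z => ?_, ?_⟩
  · refine le_antisymm (sup_le ?_ z.1.N_le_M) fun x hx => ?_
    · rintro _ ⟨x, hx, rfl⟩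
      exact hθ.mem_M hx
    · obtain ⟨y, hy, n, hn, rfl⟩ := Submodule.mem_sup.1 (z.C_sup.symm ▸ hx)
      refine Submodule.mem_sup.2 ⟨θ z y, ⟨y, hy, rfl⟩, n - (θ z y - y),
        Submodule.sub_mem _ hn (hθ.sub_mem z y hy), by abel⟩
  · refine le_bot_iff.1 ?_
    rintro _ ⟨⟨x, hx, rfl⟩, hxN⟩
    have h1 := Submodule.sub_mem _ hxN (hθ.sub_mem z x hx)
    rw [sub_sub_cancel] at h1
    have h2 : x ∈ z.C ⊓ z.1.N := ⟨hx, h1⟩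
    rw [C_inf, Submodule.mem_bot] at h2
    rw [h2, map_zero]
    exact Submodule.zero_mem _
  · change z.α.C.map (θ z.α) = z.C.map (θ z)
    rw [C_α]
    ext y
    constructor
    · rintro ⟨x, hx, rfl⟩
      exact ⟨x, hx, hθ.symm z x hx⟩
    · rintro ⟨x, hx, rfl⟩
      exact ⟨x, hx, (hθ.symm z x hx).symm⟩
  · rintro z z' a _ ⟨x, hx, rfl⟩
    exact ⟨_, ⟨_, (hT z z' a x hx).1, rfl⟩, hc z z' a x hx⟩

end Piece

end Rep

end Net

/-! ### The net of pieces and its representation -/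

namespace Net

/-- The net with `A = B` and discrete blocks given by an involution and a partial involution. -/
def thin (ι : Type u) [Finite ι] (α : ι → ι) (α_invol : ∀ i, α (α i) = i) (α_ne : ∀ i, α i ≠ i)
    (β : ι → Option ι) (β_invol : ∀ b c, β b = some c → β c = some b)
    (β_ne : ∀ b, β b ≠ some b) : Net.{u} where
  A := ι
  B := ι
  ordB :=
    { le := Eq
      le_refl := fun _ => rfl
      le_trans := fun _ _ _ => Eq.trans
      le_antisymm := fun _ _ h _ => h }
  α := α
  α_invol := α_invol
  α_ne := α_ne
  idx := id
  comparable_iff := fun _ _ => ⟨fun h => h.elim id Eq.symm, Or.inl⟩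
  β := β
  β_invol := β_invol
  β_ne := β_ne

theorem below_eq_bot {K : Type v} [Field K] {X : Net.{u}} (hX : Function.Injective X.idx)
    {V : Type w} [AddCommGroup V] [Module K V] (F : X.B → Submodule K V) (b : X.B) :
    below F b = ⊥ :=
  le_bot_iff.1 (iSup₂_le fun _ h => absurd (hX (idx_eq_of_le h.le)) h.ne)

theorem eq_zero_of_mem_below {K : Type v} [Field K] {X : Net.{u}} (hX : Function.Injective X.idx)
    {V : Type w} [AddCommGroup V] [Module K V] {F : X.B → Submodule K V} {b : X.B} {x : V}
    (hx : x ∈ below F b) : x = 0 := by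
  rwa [below_eq_bot hX, Submodule.mem_bot] at hx

theorem blockInjective_of_injective {X Y : Net.{u}} (hX : Function.Injective X.idx) (f : X ⟶ Y) :
    BlockInjective f := fun _ _ h _ => hX h

namespace Rep

variable {K : Type v} [Field K] {X : Net.{u}} {V : Rep.{u, v, w} K X}

namespace Piece

/-- `M = C + N`, and `N` is a sum of two intersections with smaller `dim U + dim W`. The bound on
`z.1.U` is kept so that each `F_l`, and not just `V`, is spanned by pieces. -/
theorem inf_le_iSup {C : V.Piece → Submodule K V.V} (hC : ∀ z, C z ⊔ z.1.N = z.1.M) {i : X.A}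
    {U W : Submodule K V.V} (hU : V.Refined i U) (hW : V.Refined (X.α i) W) :
    U ⊓ W ≤ ⨆ (z : V.Piece) (_ : z.1.i = i ∧ z.1.U ≤ U), C z := by
  obtain ⟨n, hn⟩ : ∃ n, Module.finrank K U + Module.finrank K W = n := ⟨_, rfl⟩
  induction n using Nat.strong_induction_on generalizing U W with
  | _ n ih =>
    by_cases hU0 : U = ⊥
    · rw [hU0, bot_inf_eq]; exact bot_le
    by_cases hW0 : W = ⊥
    · rw [hW0, inf_bot_eq]; exact bot_le
    let z : V.Corner := ⟨i, U, W, hU, hW⟩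
    have hN : z.N ≤ ⨆ (z : V.Piece) (_ : z.1.i = i ∧ z.1.U ≤ U), C z := by
      refine sup_le ?_ ?_
      · have hlt := Submodule.finrank_lt_finrank_of_lt (pred_lt (i := i) hU0)
        exact (ih _ (by omega) (refined_pred i U) hW rfl).trans
          (biSup_mono fun z hz => ⟨hz.1, hz.2.trans pred_le⟩)
      · have hlt := Submodule.finrank_lt_finrank_of_lt (pred_lt (i := X.α i) hW0)
        exact (inf_comm _ _).le.trans
          (ih _ (hn ▸ Nat.add_lt_add_left hlt _) hU (refined_pred (X.α i) W) rfl)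
    by_cases hz : z.M ≤ z.N
    · exact hz.trans hN
    · have := hC ⟨z, hz⟩
      change z.M ≤ _
      rw [← this]
      exact sup_le (le_iSup₂ (f := fun (z : V.Piece) (_ : z.1.i = i ∧ z.1.U ≤ U) => C z)
        ⟨z, hz⟩ ⟨rfl, le_rfl⟩) hN

/-- Among the nonzero terms take one with `(dim U, dim W)` lexicographically maximal. Every other
term lies in `U⁻ + (U ∩ W⁻)`, which forces this one into `N`, hence into `C ∩ N = 0`. -/
theorem eq_zero_of_sum_eq_zero {C : V.Piece → Submodule K V.V} (hC : ∀ z, C z ⊔ z.1.N = z.1.M)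
    (hC' : ∀ z, C z ⊓ z.1.N = ⊥) {i : X.A} (s : Finset V.Piece) (hs : ∀ z ∈ s, z.1.i = i)
    (v : V.Piece → V.V) (hv : ∀ z ∈ s, v z ∈ C z) (hsum : ∑ z ∈ s, v z = 0) :
    ∀ z ∈ s, v z = 0 := by
  classical
  by_contra! hne
  obtain ⟨z₀, hz₀, hvz₀⟩ := hne
  obtain ⟨z, hz, hmax⟩ := Finset.exists_max_image (s.filter fun z => v z ≠ 0)
    (fun z => toLex (Module.finrank K z.1.U, Module.finrank K z.1.W))
    ⟨z₀, Finset.mem_filter.2 ⟨hz₀, hvz₀⟩⟩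
  obtain ⟨hzs, hvz⟩ := Finset.mem_filter.1 hz
  have hM : ∀ z, C z ≤ z.1.M := fun z => hC z ▸ le_sup_left
  have hlow : ∀ w ∈ s.erase z, v w ∈ V.pred z.1.i z.1.U ⊔ z.1.α.L := by
    intro w hw
    obtain ⟨hwz, hws⟩ := Finset.mem_erase.1 hw
    by_cases hvw : v w = 0
    · rw [hvw]; exact Submodule.zero_mem _
    have hle := hmax w (Finset.mem_filter.2 ⟨hws, hvw⟩)
    have hi : w.1.i = z.1.i := (hs w hws).trans (hs z hzs).symm
    have hwU : V.Refined z.1.i w.1.U := hi ▸ w.1.hU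
    have hwW : V.Refined (X.α z.1.i) w.1.W := hi ▸ w.1.hW
    have hvM := hM w (hv w hws)
    rw [Prod.Lex.toLex_le_toLex'] at hle
    obtain ⟨hle1, hle2⟩ := hle
    rcases eq_or_ne w.1.U z.1.U with e | hne
    · have hWne : w.1.W ≠ z.1.W := fun e' => hwz (Piece.ext (Corner.ext hi e e'))
      have hWlt : w.1.W < z.1.W := by
        refine lt_of_le_of_ne ((hwW.total z.1.hW).resolve_right fun h => hWne ?_) hWne
        exact (Submodule.eq_of_le_of_finrank_le h (hle2 (by rw [e]))).symm
      exact Submodule.mem_sup_right ⟨le_pred hwW hWlt hvM.2, e.le hvM.1⟩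
    · have hlt : w.1.U < z.1.U := by
        refine lt_of_le_of_ne ((hwU.total z.1.hU).resolve_right fun h => hne ?_) hne
        exact (Submodule.eq_of_le_of_finrank_le h hle1).symm
      exact Submodule.mem_sup_left (le_pred hwU hlt hvM.1)
  have h1 : v z = -∑ w ∈ s.erase z, v w := by
    rw [← Finset.add_sum_erase s v hzs] at hsum
    exact eq_neg_of_add_eq_zero_left hsum
  have h2 : v z ∈ V.pred z.1.i z.1.U ⊔ z.1.α.L := by
    rw [h1]
    exact Submodule.neg_mem _ (Submodule.sum_mem _ hlow)
  obtain ⟨p, hp, q, hq, e⟩ := Submodule.mem_sup.1 h2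
  -- `p` is in `U⁻`, and it is in `W` because both `v z` and `q` are.
  have hp' : p ∈ z.1.L := by
    refine ⟨hp, ?_⟩
    rw [← add_sub_cancel_right p q, e]
    exact Submodule.sub_mem _ (hM z (hv z hzs)).2 (pred_le (i := X.α z.1.i) hq.1)
  have h3 : v z ∈ C z ⊓ z.1.N := ⟨hv z hzs, e ▸
    Submodule.add_mem _ (z.1.L_le_N hp') (z.1.L_α_le_N hq)⟩
  rw [hC', Submodule.mem_bot] at h3
  exact hvz h3

section Net

variable (V)

/-- The index type of the pieces of a representation. -/
abbrev Index : Type u := Shrink.{u} V.Piece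

variable {V}

/-- The piece with a given index. -/
noncomputable def ofIndex (x : Index V) : V.Piece := (equivShrink.{u} V.Piece).symm x

/-- The index of a piece. -/
noncomputable def index (z : V.Piece) : Index V := equivShrink.{u} V.Piece z

theorem ofIndex_index (z : V.Piece) : ofIndex (index z) = z := (equivShrink.{u} V.Piece).symm_apply_apply z

theorem index_ofIndex (x : Index V) : index (ofIndex x) = x := (equivShrink.{u} V.Piece).apply_symm_apply x

open Classical in
/-- The partial involution on indices of pieces. -/
noncomputable def indexβ (x : Index V) : Option (Index V) :=
  if h : ∃ z', Adj (ofIndex x) z' then some (index h.choose) else none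

theorem indexβ_eq_some {x y : Index V} : indexβ x = some y ↔ Adj (ofIndex x) (ofIndex y) := by
  unfold indexβ
  constructor
  · intro h
    split_ifs at h with h'
    rw [← Option.some.inj h, ofIndex_index]
    exact h'.choose_spec
  · intro a
    have h : ∃ z', Adj (ofIndex x) z' := ⟨_, a⟩
    rw [dif_pos h, Option.some.injEq, h.choose_spec.unique a, index_ofIndex]

theorem α_ne (z : V.Piece) : z.α ≠ z := fun h =>
  X.α_ne z.1.i (congrArg (fun z : V.Piece => z.1.i) h)

variable (V) in
/-- The net of pieces of a representation. -/
noncomputable def net : Net.{u} :=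
  thin (Index V) (fun x => index (ofIndex x).α)
    (fun x => by rw [ofIndex_index, α_α, index_ofIndex])
    (fun x h => α_ne (ofIndex x) (by rw [← ofIndex_index (ofIndex x).α, h]))
    indexβ (fun _ _ h => indexβ_eq_some.2 (indexβ_eq_some.1 h).symm)
    (fun _ h => (indexβ_eq_some.1 h).ne rfl)

theorem net_injective : Function.Injective (net V).idx := fun _ _ h => h

theorem net_le {b c : (net V).B} : b ≤ c ↔ b = c := Iff.rfl

variable (V) in
/-- The morphism from the net of pieces. -/
noncomputable def netHom : net V ⟶ X where
  f₁ x := (ofIndex x).1.i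
  f₂ x := (ofIndex x).first
  map_α x := congrArg (fun z : V.Piece => z.1.i) (ofIndex_index (ofIndex x).α)
  map_β x := by
    cases h : X.β (ofIndex x).first with
    | none =>
      have : indexβ x = none := by
        cases h' : indexβ x with
        | none => rfl
        | some y =>
          have := (indexβ_eq_some.1 h').β
          rw [h] at this
          cases this
      exact (congrArg (Option.map _) this).symm
    | some c =>
      obtain ⟨z', a, hz'⟩ := (ofIndex x).exists_adj h
      have : indexβ x = some (index z') := indexβ_eq_some.2 ((ofIndex_index z').symm ▸ a)
      exact ((congrArg (Option.map _) this).trans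
        (congrArg some ((congrArg first (ofIndex_index z')).trans hz'))).symm
  map_idx x := (ofIndex x).idx_first
  mono _ _ h := (congrArg (fun x => (ofIndex x).first) (net_le.1 h)).le

section Rep

variable (C : V.Piece → Submodule K V.V) (hC : ∀ z, C z ⊔ z.1.N = z.1.M)
  (hC' : ∀ z, C z ⊓ z.1.N = ⊥) (hα : ∀ z, C z.α = C z)
  (hadj : ∀ z z' (a : Adj z z'), ∀ x ∈ C z, ∃ y ∈ C z', (x, y) ∈ V.rel z.first z'.first a.β)

/-- The summands of the representation of the net of pieces. -/
noncomputable def netComp : (net V).Orbit → Submodule K V.V :=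
  Quotient.lift (fun x => C (ofIndex x)) (by
    rintro x y (rfl | rfl)
    · rfl
    · change C (ofIndex (index (ofIndex y).α)) = _
      rw [ofIndex_index, hα])

theorem orb_index_α (z : V.Piece) : (net V).orb (index z.α) = (net V).orb (index z) := by
  refine Eq.trans (congrArg (net V).orb ?_) ((net V).orb_α (index z))
  exact (congrArg (fun z : V.Piece => index z.α) (ofIndex_index z)).symm

theorem netComp_orb_index (z : V.Piece) : netComp C hα ((net V).orb (index z)) = C z :=
  congrArg C (ofIndex_index z)

include hC in
theorem C_le_comp (z : V.Piece) : C z ≤ V.comp (X.orb z.1.i) :=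
  (le_sup_left.trans (hC z).le).trans (inf_le_left.trans z.1.hU.le_comp)

theorem exists_index (o : (net V).Orbit) {i : X.A} (h : onOrbit (netHom V) o = X.orb i) :
    ∃ z : V.Piece, (net V).orb (index z) = o ∧ z.1.i = i := by
  obtain ⟨x, rfl⟩ := (net V).orb_surj o
  have hx : (net V).orb (index (ofIndex x)) = (net V).orb x :=
    congrArg (net V).orb (index_ofIndex x)
  rcases X.orb_eq_iff.1 h with h | h
  · exact ⟨ofIndex x, hx, h⟩
  · refine ⟨(ofIndex x).α, (orb_index_α _).trans hx, ?_⟩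
    have h' : (ofIndex x).1.i = X.α i := h
    change X.α (ofIndex x).1.i = i
    rw [h', X.α_invol]

-- After projecting to one summand `V_i`, each remaining orbit is represented by its piece on the
-- side `i`, and `eq_zero_of_sum_eq_zero` applies.
include hC hC' in
theorem netComp_indep : iSupIndep (netComp C hα) := by
  classical
  rw [iSupIndep_iff_finsetSum_eq_zero_imp_eq_zero]
  intro s v hv hsum o₀ ho₀
  obtain ⟨i, hi⟩ := X.orb_surj (onOrbit (netHom V) o₀)
  let t := s.filter fun o => onOrbit (netHom V) o = X.orb i
  have hproj : ∀ o ∈ s, V.proj (X.orb i) (v o) =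
      if onOrbit (netHom V) o = X.orb i then v o else 0 := by
    intro o ho
    have hvo : v o ∈ V.comp (onOrbit (netHom V) o) := by
      have := hv o ho
      obtain ⟨x, rfl⟩ := (net V).orb_surj o
      exact C_le_comp C hC _ this
    split_ifs with h
    · exact V.proj_same (h ▸ hvo)
    · exact V.proj_other h hvo
  have hsum' : ∑ o ∈ t, v o = 0 := by
    rw [Finset.sum_filter, ← Finset.sum_congr rfl hproj, ← map_sum, hsum, map_zero]
  have hex : ∀ o : (net V).Orbit, ∃ z : V.Piece, onOrbit (netHom V) o = X.orb i →
      (net V).orb (index z) = o ∧ z.1.i = i := by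
    intro o
    by_cases h : onOrbit (netHom V) o = X.orb i
    · obtain ⟨z, hz⟩ := exists_index o h
      exact ⟨z, fun _ => hz⟩
    · obtain ⟨x, -⟩ := (net V).orb_surj o
      exact ⟨ofIndex x, fun h' => absurd h' h⟩
  choose ρ hρ using hex
  have ht : ∀ o ∈ t, (net V).orb (index (ρ o)) = o ∧ (ρ o).1.i = i := fun o ho =>
    hρ o (Finset.mem_filter.1 ho).2
  have hmem : o₀ ∈ t := Finset.mem_filter.2 ⟨ho₀, hi.symm⟩
  have hinj : Set.InjOn ρ t := fun o ho o' ho' h => by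
    rw [← (ht o ho).1, ← (ht o' ho').1, h]
  have := eq_zero_of_sum_eq_zero hC hC' (i := i) (t.image ρ)
    (fun z hz => by
      obtain ⟨o, ho, rfl⟩ := Finset.mem_image.1 hz
      exact (ht o ho).2)
    (fun z => v ((net V).orb (index z)))
    (fun z hz => by
      obtain ⟨o, ho, rfl⟩ := Finset.mem_image.1 hz
      have h1 := hv o (Finset.mem_filter.1 ho).1
      have h2 := netComp_orb_index C hα (ρ o)
      rw [(ht o ho).1] at h2 ⊢
      exact h2 ▸ h1)
    (by
      rw [Finset.sum_image hinj, ← hsum']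
      exact Finset.sum_congr rfl fun o ho => by rw [(ht o ho).1])
    (ρ o₀) (Finset.mem_image_of_mem _ hmem)
  rwa [(ht o₀ hmem).1] at this

-- `F_l` is its own intersection with `V_i`, the top of the opposite chain; a piece on that side
-- with `U ≤ F_l` has `first ≤ l`.
include hC in
theorem F_le_netF (l : X.B) : V.F l ≤ ⨆ (x : Index V) (_ : (ofIndex x).first ≤ l),
    C (ofIndex x) := by
  have hl := V.F_le_comp l
  rw [← X.orb_α] at hl
  refine (le_inf le_rfl hl).trans ((inf_le_iSup hC (.filt _ l rfl) (refined_comp _)).trans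
    (iSup₂_le fun z hz => ?_))
  have hz' : z.first ≤ l := by
    rcases le_below_or_le (z.idx_first.trans hz.1) with h | h | h
    · exact h.le
    · exact h.le
    · exact absurd (hz.2.trans (below_mono h)) z.not_U_le
  have := le_iSup₂ (f := fun (x : Index V) (_ : (ofIndex x).first ≤ l) => C (ofIndex x))
    (index z) (by rwa [ofIndex_index])
  rwa [ofIndex_index] at this

include hC in
theorem netComp_iSup : ⨆ o, netComp C hα o = ⊤ := by
  rw [eq_top_iff, ← V.comp_iSup]
  refine iSup_le fun o => ?_
  obtain ⟨i, rfl⟩ := X.orb_surj o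
  rw [← V.F_exhaustive]
  exact iSup₂_le fun l _ => (F_le_netF C hC l).trans
    (iSup₂_le fun x _ => le_iSup (netComp C hα) ((net V).orb x))

/-- The representation of the net of pieces. -/
noncomputable abbrev netRep : Rep.{u, v, w} K (net V) :=
  ofRel (netComp C hα) (netComp_indep C hC hC' hα) (netComp_iSup C hC hα)
    (fun x : Index V => C (ofIndex x))
    (fun _ _ h => (congrArg (fun x => C (ofIndex x)) (net_le.1 h)).le)
    (fun i => le_antisymm
      (iSup₂_le fun b hb => (congrArg (fun x => C (ofIndex x)) hb).le)
      (le_iSup₂ (f := fun (b : (net V).B) (_ : (net V).idx b = i) => C (ofIndex b)) i rfl))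
    (fun x y h => V.rel (ofIndex x).first (ofIndex y).first (indexβ_eq_some.1 h).β ⊓
      ((C (ofIndex x)).prod (C (ofIndex y))))
    (fun _ _ _ _ _ h => h.2.1)
    (fun x y h p hp => by
      obtain ⟨q, hq, hpq⟩ := hadj _ _ (indexβ_eq_some.1 h) p hp
      exact ⟨q, hpq, hp, hq⟩)
    (fun _ _ _ _ _ h => ⟨rel_symm h.1, h.2.2, h.2.1⟩)
    -- Lower steps are zero in this net, so the relation must be single-valued: a partner of zero
    -- inside `C` lies in a lower step of `V`, hence in `L`, hence in `C ∩ N = 0`.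
    (fun x y h p q hpq hp => by
      obtain rfl := eq_zero_of_mem_below net_injective hp
      have h1 := rel_below hpq.1 (Submodule.zero_mem _)
      have h2 : q ∈ (ofIndex y).1.L :=
        ⟨(ofIndex y).below_le_pred h1, (le_sup_left.trans (hC _).le hpq.2.2).2⟩
      have h3 : q ∈ C (ofIndex y) ⊓ (ofIndex y).1.N := ⟨hpq.2.2, (ofIndex y).1.L_le_N h2⟩
      rw [hC', Submodule.mem_bot] at h3
      rw [h3]
      exact Submodule.zero_mem _)

/-- The underlying map is the identity; surjectivity on filtration steps is `F_le_netF`. -/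
theorem pushforward_netRep : Nonempty ((netRep C hC hC' hα hadj).pushforward (netHom V)
    (blockInjective_of_injective net_injective _) ≅ V) := by
  let p : (netRep C hC hC' hα hadj).pushforward (netHom V)
      (blockInjective_of_injective net_injective _) ⟶ V :=
    homOfPushforward (netHom V) _ (V := netRep C hC hC' hα hadj) LinearMap.id
      (fun (r : Index V) => (le_sup_left.trans (hC _).le).trans
        (inf_le_left.trans (ofIndex r).U_le))
      (fun r s h x y hxy => by
        obtain ⟨y', hy', hb⟩ := exists_of_rel_ofRel _ _ _ _ _ _ _ _ _ _ _ hxy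
        obtain rfl := sub_eq_zero.1 (eq_zero_of_mem_below net_injective hb)
        exact hy'.1)
  have : IsIso p := isIso_of_bijective p Function.bijective_id fun b =>
    (F_le_netF C hC b).trans (Submodule.map_id _).ge
  exact ⟨asIso p⟩

end Rep

end Net

end Piece

/-- Every representation is a pushforward from a net all of whose blocks are singletons. -/
theorem exists_pushforward_iso (V : Rep.{u, v, w} K X) :
    ∃ (X' : Net.{u}) (h : Function.Bijective X'.idx) (f : X' ⟶ X) (V' : Rep.{u, v, w} K X'),
      Nonempty (V'.pushforward f (blockInjective_of_injective h.1 f) ≅ V) := by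
  obtain ⟨C, hC, hC', hα, hadj⟩ := Piece.exists_compatible_complements V
  exact ⟨Piece.net V, Function.bijective_id, Piece.netHom V, Piece.netRep C hC hC' hα hadj,
    Piece.pushforward_netRep C hC hC' hα hadj⟩

end Rep

end Net

/-! ### Orbits of two involutions: strings and bands -/

namespace Net

section Dihedral

variable {A : Type*} (α γ : Equiv.Perm A) (hα : ∀ x, α (α x) = x)
  (hγ : ∀ x, γ (γ x) = x)

/-- The period of the rotation `γ α` at `a`. -/
noncomputable def rotationPeriod (a : A) : ℕ := Function.minimalPeriod ((γ * α) • ·) a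

theorem rotationPeriod_pos [Finite A] (a : A) : 1 ≤ rotationPeriod α γ a :=
  Function.minimalPeriod_pos_of_mem_periodicPts
    ((MulAction.injective (γ * α)).mem_periodicPts a)

theorem rotation_eq_iff {a : A} {k l : ℤ} : ((γ * α) ^ k) a = ((γ * α) ^ l) a ↔
    (rotationPeriod α γ a : ℤ) ∣ k - l := by
  rw [rotationPeriod, ← MulAction.zpow_smul_eq_iff_minimalPeriod_dvd, sub_eq_neg_add, zpow_add,
    zpow_neg, mul_smul, inv_smul_eq_iff]
  rfl

include hα hγ

/-- The two involutions generate a dihedral action, in which conjugation by a reflection inverts the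
rotation. -/
theorem α_rotation (k : ℤ) (x : A) : α (((γ * α) ^ k) x) = ((γ * α) ^ (-k)) (α x) := by
  have h1 : α * (γ * α) * α⁻¹ = (γ * α)⁻¹ := by
    refine eq_inv_of_mul_eq_one_left (Equiv.ext fun x => ?_)
    have : α⁻¹ = α := inv_eq_of_mul_eq_one_left (Equiv.ext hα)
    simp [this, hα, hγ]
  have h2 : α * (γ * α) ^ k * α⁻¹ = (γ * α) ^ (-k) := by
    rw [← conj_zpow, h1, inv_zpow, zpow_neg]
  rw [← h2]
  simp

theorem γ_rotation (k : ℤ) (x : A) : γ (((γ * α) ^ k) x) = ((γ * α) ^ (-k)) (γ x) := by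
  have h1 : γ * (γ * α) * γ⁻¹ = (γ * α)⁻¹ := by
    refine eq_inv_of_mul_eq_one_left (Equiv.ext fun x => ?_)
    have : γ⁻¹ = γ := inv_eq_of_mul_eq_one_left (Equiv.ext hγ)
    simp [this, hα, hγ]
  have h2 : γ * (γ * α) ^ k * γ⁻¹ = (γ * α) ^ (-k) := by
    rw [← conj_zpow, h1, inv_zpow, zpow_neg]
  rw [← h2]
  simp

variable (hα' : ∀ x, α x ≠ x)
  (hconn : ∀ S : Set A, S.Nonempty → (∀ x ∈ S, α x ∈ S) → (∀ x ∈ S, γ x ∈ S) → ∀ x, x ∈ S)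

omit hα hγ in
theorem rotation_succ (k : ℤ) (x : A) :
    γ (α (((γ * α) ^ k) x)) = ((γ * α) ^ (k + 1)) x := by
  rw [add_comm, zpow_add, zpow_one]; rfl

-- For `m = 2t`, the point `ρ^t a` would be fixed by `α`, where `ρ = γα`; for `m = 2t + 1`, the
-- point `α ρ^t a` would be fixed by `γ`.
include hα' in
theorem α_ne_rotation (hγ' : ∀ x, γ x ≠ x) (a : A) (m : ℤ) : α a ≠ ((γ * α) ^ m) a := by
  intro h
  rcases Int.even_or_odd' m with ⟨t, rfl | rfl⟩
  · refine hα' (((γ * α) ^ t) a) ?_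
    rw [α_rotation α γ hα hγ, h, ← Equiv.Perm.mul_apply, ← zpow_add]
    congr 2; ring
  · refine hγ' (α (((γ * α) ^ t) a)) ?_
    rw [rotation_succ α γ, α_rotation α γ hα hγ, h, ← Equiv.Perm.mul_apply, ← zpow_add]
    congr 2; ring

include hα' hconn in
/-- A transitive pair of fixed-point-free involutions is a cycle. -/
theorem exists_cycle [Finite A] (hγ' : ∀ x, γ x ≠ x) (a : A) :
    ∃ (n : ℕ) (_ : 1 ≤ n) (b : ZMod n × Bool ≃ A), (∀ i s, α (b (i, s)) = b (i, !s)) ∧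
      ∀ i, γ (b (i, true)) = b (i + 1, false) := by
  let n := rotationPeriod α γ a
  have hn : 1 ≤ n := rotationPeriod_pos α γ a
  let f : ℤ → A := fun k => ((γ * α) ^ k) a
  have hf : ∀ k l, f k = f l ↔ ((k : ZMod n) = l) := fun k l => by
    rw [eq_comm, ZMod.intCast_eq_intCast_iff_dvd_sub]
    exact rotation_eq_iff α γ
  have hne : ∀ k l, f k ≠ α (f l) := fun k l h => by
    refine α_ne_rotation α γ hα hγ hα' hγ' a (l + k) ?_
    have h1 : ((γ * α) ^ k) a = ((γ * α) ^ (-l)) (α a) := h.trans (α_rotation α γ hα hγ l a)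
    rw [zpow_add, Equiv.Perm.mul_apply, h1, ← Equiv.Perm.mul_apply, ← zpow_add]
    simp
  have hsucc : ∀ k, γ (α (f k)) = f (k + 1) := fun k => rotation_succ α γ k a
  let g : ZMod n × Bool → A := fun p => bif p.2 then α (f p.1.cast) else f p.1.cast
  have hg0 : ∀ k : ℤ, g (k, false) = f k := fun k => (hf _ _).2 (ZMod.intCast_zmod_cast _)
  have hg1 : ∀ k : ℤ, g (k, true) = α (f k) := fun k => congrArg α (hg0 k)
  have hgα : ∀ i s, α (g (i, s)) = g (i, !s) := by
    rintro i (_ | _)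
    · rfl
    · exact hα _
  have hgγ : ∀ i, γ (g (i, true)) = g (i + 1, false) := fun i => by
    obtain ⟨k, rfl⟩ := ZMod.intCast_surjective i
    rw [hg1, hsucc, ← hg0]
    push_cast; rfl
  refine ⟨n, hn, Equiv.ofBijective g ⟨?_, ?_⟩, hgα, hgγ⟩
  · rintro ⟨i, s⟩ ⟨j, t⟩ h
    obtain ⟨k, rfl⟩ := ZMod.intCast_surjective i
    obtain ⟨l, rfl⟩ := ZMod.intCast_surjective j
    cases s <;> cases t
    · rw [hg0, hg0, hf] at h; rw [h]
    · rw [hg0, hg1] at h; exact absurd h (hne _ _)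
    · rw [hg0, hg1] at h; exact absurd h.symm (hne _ _)
    · rw [hg1, hg1, α.injective.eq_iff, hf] at h; rw [h]
  · refine hconn (Set.range g) ⟨_, (0, false), rfl⟩ ?_ ?_
    · rintro _ ⟨⟨i, s⟩, rfl⟩
      exact ⟨_, (hgα i s).symm⟩
    · rintro _ ⟨⟨i, s⟩, rfl⟩
      cases s
      · refine ⟨(i - 1, true), ?_⟩
        have := hgγ (i - 1)
        rw [sub_add_cancel] at this
        rw [← this, hγ]
      · exact ⟨_, (hgγ i).symm⟩

include hα' hconn in
/-- A transitive pair of involutions, the first of them fixed-point-free, with a fixed point of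
the second is a path. -/
theorem exists_path [Finite A] {e : A} (he : γ e = e) :
    ∃ (n : ℕ) (_ : 1 ≤ n) (b : Fin n × Bool ≃ A), (∀ i s, α (b (i, s)) = b (i, !s)) ∧
      (∀ i j : Fin n, (j : ℕ) = i + 1 → γ (b (i, true)) = b (j, false)) ∧
      (∀ i : Fin n, (i : ℕ) = 0 → γ (b (i, false)) = b (i, false)) ∧
      ∀ i : Fin n, (i : ℕ) + 1 = n → γ (b (i, true)) = b (i, true) := by
  let f : ℤ → A := fun k => ((γ * α) ^ k) e
  have hf : ∀ k l, f k = f l ↔ (rotationPeriod α γ e : ℤ) ∣ k - l := fun k l =>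
    rotation_eq_iff α γ
  have hN := rotationPeriod_pos α γ e
  have hαf : ∀ k, α (f k) = f (-k - 1) := fun k => by
    have h1 : α e = ((γ * α) ^ (-1 : ℤ)) e := by
      rw [zpow_neg_one, Equiv.Perm.eq_inv_iff_eq, Equiv.Perm.mul_apply, hα, he]
    change α (((γ * α) ^ k) e) = ((γ * α) ^ (-k - 1)) e
    rw [α_rotation α γ hα hγ, h1, ← Equiv.Perm.mul_apply, ← zpow_add]
    rfl
  have hγf : ∀ k, γ (f k) = f (-k) := fun k => by
    change γ (((γ * α) ^ k) e) = ((γ * α) ^ (-k)) e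
    rw [γ_rotation α γ hα hγ, he]
  -- An odd period `2t + 1` would make `f t` a fixed point of `α`.
  obtain ⟨n, hn⟩ : ∃ n : ℕ, rotationPeriod α γ e = 2 * n := by
    rcases Nat.even_or_odd' (rotationPeriod α γ e) with ⟨t, h | h⟩
    · exact ⟨t, h⟩
    · refine absurd ?_ (hα' (f t))
      rw [hαf, hf, h]
      exact ⟨-1, by push_cast; ring⟩
  rw [hn] at hf hN
  push_cast at hf
  have hn1 : 1 ≤ n := by omega
  -- Read from the end `e`, the path is `f 0, f (-1), f 1, f (-2), …, f (-n)`; the far end is fixed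
  -- by `γ` because `f n = f (-n)`.
  let g : Fin n × Bool → A := fun p => bif p.2 then f (-(p.1 : ℤ) - 1) else f (p.1 : ℤ)
  have hg0 : ∀ k, g (k, false) = f (k : ℤ) := fun _ => rfl
  have hg1 : ∀ k, g (k, true) = f (-(k : ℤ) - 1) := fun _ => rfl
  have hgα : ∀ i s, α (g (i, s)) = g (i, !s) := by
    rintro i (_ | _)
    · exact hαf _
    · refine (hαf _).trans (congrArg f ?_)
      ring
  have hγs : ∀ i j : Fin n, (j : ℕ) = i + 1 → γ (g (i, true)) = g (j, false) := fun i j h => by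
    rw [hg1, hγf, hg0, h]
    congr 1
    push_cast; ring
  have hγ0 : ∀ i : Fin n, (i : ℕ) = 0 → γ (g (i, false)) = g (i, false) := fun i h => by
    rw [hg0, hγf, h]; rfl
  have hγn : ∀ i : Fin n, (i : ℕ) + 1 = n → γ (g (i, true)) = g (i, true) := fun i h => by
    rw [hg1, hγf, hf]
    exact ⟨1, by rw [show (n : ℤ) = (i : ℤ) + 1 by exact_mod_cast h.symm]; ring⟩
  refine ⟨n, hn1, Equiv.ofBijective g ⟨?_, ?_⟩, hgα, hγs, hγ0, hγn⟩
  · rintro ⟨i, s⟩ ⟨j, t⟩ h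
    have hi := i.2
    have hj := j.2
    have small : ∀ m : ℤ, 2 * (n : ℤ) ∣ m → m.natAbs < 2 * n → m = 0 := fun m hm hlt =>
      by
      refine Int.eq_zero_of_abs_lt_dvd hm ?_
      rw [Int.abs_eq_natAbs]
      omega
    cases s <;> cases t
    · rw [hg0, hg0, hf] at h
      have := small _ h (by omega)
      simp only [Prod.mk.injEq, and_true]
      omega
    · rw [hg0, hg1, hf] at h
      have := small _ h (by omega)
      omega
    · rw [hg0, hg1, hf] at h
      have := small _ h (by omega)
      omega
    · rw [hg1, hg1, hf] at h
      have := small _ h (by omega)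
      simp only [Prod.mk.injEq, and_true]
      omega
  · refine hconn (Set.range g) ⟨_, (⟨0, hn1⟩, false), rfl⟩ ?_ ?_
    · rintro _ ⟨⟨i, s⟩, rfl⟩
      exact ⟨_, (hgα i s).symm⟩
    · rintro _ ⟨⟨i, s⟩, rfl⟩
      have hi := i.2
      cases s
      · by_cases h : (i : ℕ) = 0
        · exact ⟨_, (hγ0 i h).symm⟩
        · refine ⟨(⟨i - 1, by omega⟩, true), ?_⟩
          rw [← hγs ⟨i - 1, by omega⟩ i (by simp only; omega), hγ]
      · by_cases h : (i : ℕ) + 1 = n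
        · exact ⟨_, (hγn i h).symm⟩
        · exact ⟨_, (hγs i ⟨i + 1, by omega⟩ rfl).symm⟩

end Dihedral

section Thin

variable {X : Net.{u}} (hX : Function.Bijective X.idx)

/-- The bijection `A ≃ B` of a net whose blocks are singletons. -/
noncomputable def el : X.A ≃ X.B := (Equiv.ofBijective X.idx hX).symm

theorem idx_el (i : X.A) : X.idx (el hX i) = i := (Equiv.ofBijective X.idx hX).apply_symm_apply i

theorem el_idx (b : X.B) : el hX (X.idx b) = b := (Equiv.ofBijective X.idx hX).symm_apply_apply b

/-- The partial involution `β`, extended by the identity, as a permutation of `A`. -/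
noncomputable def γ : X.A → X.A := fun i => ((X.β (el hX i)).map X.idx).getD i

theorem γ_of_some {i : X.A} {c : X.B} (h : X.β (el hX i) = some c) : γ hX i = X.idx c := by
  rw [γ, h]; rfl

theorem γ_of_none {i : X.A} (h : X.β (el hX i) = none) : γ hX i = i := by
  rw [γ, h]; rfl

theorem γ_γ (i : X.A) : γ hX (γ hX i) = i := by
  cases h : X.β (el hX i) with
  | none => rw [γ_of_none hX h, γ_of_none hX h]
  | some c =>
    have := X.β_invol _ _ h
    rw [← el_idx hX c] at this
    rw [γ_of_some hX h, γ_of_some hX this, idx_el]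

theorem β_of_γ_eq {i : X.A} (h : γ hX i = i) : X.β (el hX i) = none := by
  cases h' : X.β (el hX i) with
  | none => rfl
  | some c =>
    rw [γ_of_some hX h'] at h
    rw [← h, el_idx] at h'
    exact absurd h' (X.β_ne c)

theorem β_of_γ_ne {i : X.A} (h : γ hX i ≠ i) : X.β (el hX i) = some (el hX (γ hX i)) := by
  cases h' : X.β (el hX i) with
  | none => exact absurd (γ_of_none hX h') h
  | some c => rw [γ_of_some hX h', el_idx]

/-- Both moves are involutive, so closure in one direction makes membership invariant along every
chain of links. -/
theorem mem_of_connected (hc : X.Connected) {S : Set X.A} (hne : S.Nonempty)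
    (hα : ∀ x ∈ S, X.α x ∈ S)
    (hβ : ∀ b c, X.β b = some c → X.idx b ∈ S → X.idx c ∈ S) (i : X.A) : i ∈ S := by
  obtain ⟨j, hj⟩ := hne
  have key : ∀ i j, Relation.EqvGen X.Linked i j → (i ∈ S ↔ j ∈ S) := by
    intro i j h
    induction h with
    | rel i j h =>
      rcases h with rfl | ⟨b, c, h, rfl, rfl⟩
      · exact ⟨hα i, fun h => X.α_invol i ▸ hα _ h⟩
      · exact ⟨hβ b c h, hβ c b (X.β_invol b c h)⟩
    | refl i => exact Iff.rfl
    | symm i j _ ih => exact ih.symm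
    | trans i j k _ _ ih ih' => exact ih.trans ih'
  exact (key j i (hc.2 j i)).1 hj

include hX in
/-- A connected net all of whose blocks are singletons is a string or a band. -/
theorem isString_or_isBand (hc : X.Connected) : X.IsString ∨ X.IsBand := by
  let pα : Equiv.Perm X.A := ⟨X.α, X.α, X.α_invol, X.α_invol⟩
  let pγ : Equiv.Perm X.A := ⟨γ hX, γ hX, γ_γ hX, γ_γ hX⟩
  have hconn : ∀ S : Set X.A, S.Nonempty → (∀ x ∈ S, pα x ∈ S) → (∀ x ∈ S, pγ x ∈ S) →
      ∀ x, x ∈ S := fun S hne h1 h2 =>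
    mem_of_connected hc hne h1 fun b c hbc hb => by
      have := h2 _ hb
      rwa [show pγ (X.idx b) = X.idx c from γ_of_some hX (by rwa [el_idx])] at this
  by_cases h : ∃ e, γ hX e = e
  · obtain ⟨e, he⟩ := h
    obtain ⟨n, hn, a, h1, h2, h3, h4⟩ :=
      exists_path pα pγ X.α_invol (γ_γ hX) X.α_ne hconn (e := e) he
    refine Or.inl ⟨n, hn, a, a.trans (el hX), fun p => idx_el hX _, h1, fun i j hij => ?_,
      fun i hi => β_of_γ_eq hX (h3 i hi), fun i hi => β_of_γ_eq hX (h4 i hi)⟩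
    have h2' : γ hX (a (i, true)) = a (j, false) := h2 i j hij
    have hne : γ hX (a (i, true)) ≠ a (i, true) := by
      rw [h2']
      intro h
      simpa using a.injective h
    exact (β_of_γ_ne hX hne).trans (by rw [h2']; rfl)
  · push Not at h
    obtain ⟨a₀⟩ := hc.1
    obtain ⟨n, hn, a, h1, h2⟩ := exists_cycle pα pγ X.α_invol (γ_γ hX) X.α_ne hconn h a₀
    refine Or.inr ⟨n, hn, a, a.trans (el hX), fun p => idx_el hX _, h1, fun i => ?_⟩
    have h2' : γ hX (a (i, true)) = a (i + 1, false) := h2 i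
    exact (β_of_γ_ne hX (h _)).trans (by rw [h2']; rfl)

theorem IsBand.bijective (h : X.IsBand) : Function.Bijective X.idx := by
  obtain ⟨n, hn, a, b, h1, -⟩ := h
  have : X.idx = a ∘ b.symm := funext fun x => by
    obtain ⟨p, rfl⟩ := b.surjective x
    simp [h1]
  rw [this]
  exact a.bijective.comp b.symm.bijective

theorem IsBand.card_ends (h : X.IsBand) : Nat.card {b : X.B // X.β b = none} = 0 := by
  obtain ⟨n, hn, a, b, h1, h2, h3⟩ := h
  have : IsEmpty {b : X.B // X.β b = none} := by
    refine ⟨fun ⟨x, hx⟩ => ?_⟩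
    obtain ⟨⟨i, s⟩, rfl⟩ := b.surjective x
    cases s
    · have := X.β_invol _ _ (h3 (i - 1))
      rw [sub_add_cancel, hx] at this
      cases this
    · rw [h3] at hx
      cases hx
  exact Nat.card_of_isEmpty

theorem IsString.card_ends (h : X.IsString) : Nat.card {b : X.B // X.β b = none} = 2 := by
  obtain ⟨n, hn, a, b, h1, h2, h3, h4, h5⟩ := h
  have : {x : X.B | X.β x = none} = {b (⟨0, hn⟩, false), b (⟨n - 1, by omega⟩, true)} := by
    ext x
    obtain ⟨⟨i, s⟩, rfl⟩ := b.surjective x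
    have hi := i.2
    simp only [Set.mem_ofPred_eq, Set.mem_insert_iff, Set.mem_singleton_iff, b.injective.eq_iff,
      Prod.mk.injEq]
    cases s
    · constructor
      · intro h
        by_contra hne
        have hi0 : (i : ℕ) ≠ 0 := fun h0 => hne (Or.inl ⟨Fin.ext h0, rfl⟩)
        have := X.β_invol _ _ (h3 ⟨i - 1, by omega⟩ i (by simp only; omega))
        rw [h] at this
        cases this
      · rintro (⟨rfl, -⟩ | ⟨-, h⟩)
        · exact h4 _ rfl
        · cases h
    · constructor
      · intro h
        by_contra hne
        have hi0 : (i : ℕ) + 1 ≠ n := fun h0 => hne (Or.inr ⟨Fin.ext (by simp only; omega), rfl⟩)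
        have := h3 i ⟨i + 1, by omega⟩ rfl
        rw [h] at this
        cases this
      · rintro (⟨-, h⟩ | ⟨rfl, -⟩)
        · cases h
        · exact h5 _ (by simp only; omega)
  change Nat.card {x : X.B | X.β x = none} = 2
  rw [this, Nat.card_coe_set_eq]
  exact Set.ncard_pair fun h => by simpa using b.injective h

end Thin

end Net

/-! ### Bisimulations and coverings -/

namespace Net

section Quotient

variable {X Y : Net.{u}} (hX : Function.Bijective X.idx) (f : X ⟶ Y)

theorem idx_onB_el (i : X.A) : Y.idx (onB f (el hX i)) = onA f i := by
  rw [idx_onB, idx_el]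

/-- An equivalence relation on a net with singleton blocks, contained in the kernel of a morphism
and respecting the involutions. -/
structure Bisimulation where
  s : Setoid X.A
  onB_eq : ∀ {i j}, s i j → onB f (el hX i) = onB f (el hX j)
  α_rel : ∀ {i j}, s i j → s (X.α i) (X.α j)
  γ_rel : ∀ {i j}, s i j → s (γ hX i) (γ hX j)

variable {hX f}

theorem β_eq_none_iff {i j : X.A} (h : onB f (el hX i) = onB f (el hX j)) :
    X.β (el hX i) = none ↔ X.β (el hX j) = none := by
  have := onB_β f (el hX i)
  rw [h, onB_β] at this
  rw [← Option.map_eq_none_iff (f := onB f), ← this, Option.map_eq_none_iff]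

namespace Bisimulation

variable (R : Bisimulation hX f)

theorem onA_eq {i j : X.A} (h : R.s i j) : onA f i = onA f j := by
  rw [← idx_onB_el hX, R.onB_eq h, idx_onB_el]

/-- The partial involution on the quotient. -/
noncomputable def quotβ : Quotient R.s → Option (Quotient R.s) :=
  Quotient.lift (fun i => (X.β (el hX i)).map fun c => Quotient.mk R.s (X.idx c)) (by
    intro i j h
    have hij := β_eq_none_iff (R.onB_eq h)
    cases hi : X.β (el hX i) with
    | none => rw [hij.1 hi]
    | some c =>
      cases hj : X.β (el hX j) with
      | none =>
        rw [hij.2 hj] at hi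
        cases hi
      | some d =>
        rw [Option.map_some, Option.map_some, ← γ_of_some hX hi, ← γ_of_some hX hj]
        exact congrArg some (Quotient.sound (R.γ_rel h)))

theorem quotβ_mk (i : X.A) : R.quotβ (Quotient.mk R.s i) =
    (X.β (el hX i)).map fun c => Quotient.mk R.s (X.idx c) := rfl

/-- The quotient of a net by a bisimulation. -/
noncomputable def quot : Net.{u} :=
  thin (Quotient R.s) (Quotient.map X.α fun _ _ => R.α_rel)
    (by
      rintro ⟨i⟩
      exact congrArg (Quotient.mk R.s) (X.α_invol i))
    (by
      rintro ⟨i⟩ h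
      have := R.onA_eq (Quotient.exact h)
      rw [onA_α] at this
      exact Y.α_ne _ this)
    R.quotβ
    (by
      rintro ⟨i⟩ q h
      obtain ⟨c, hc, rfl⟩ := Option.map_eq_some_iff.1 h
      rw [quotβ_mk, el_idx, X.β_invol _ _ hc, Option.map_some, idx_el]
      rfl)
    (by
      rintro ⟨i⟩ h
      obtain ⟨c, hc, hci⟩ := Option.map_eq_some_iff.1 h
      have h1 := R.onB_eq (Quotient.exact hci)
      have h2 := onB_β f (el hX i)
      rw [el_idx] at h1
      rw [hc, Option.map_some, h1] at h2
      exact Y.β_ne _ h2)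

/-- The projection to the quotient. -/
noncomputable def π : X ⟶ R.quot where
  f₁ i := Quotient.mk R.s i
  f₂ b := Quotient.mk R.s (X.idx b)
  map_α _ := rfl
  map_β b := by
    refine (R.quotβ_mk (X.idx b)).trans ?_
    rw [el_idx]
    rfl
  map_idx _ := rfl
  mono b c h := congrArg (Quotient.mk R.s) (idx_eq_of_le h)

/-- The morphism induced on the quotient. -/
noncomputable def desc : R.quot ⟶ Y where
  f₁ := Quotient.lift (onA f) fun _ _ h => R.onA_eq h
  f₂ := Quotient.lift (fun i => onB f (el hX i)) fun _ _ h => R.onB_eq h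
  map_α := by
    rintro ⟨i⟩
    exact onA_α f i
  map_β := by
    rintro ⟨i⟩
    refine (onB_β f (el hX i)).trans ?_
    refine Eq.trans ?_ (Option.map_map _ _ (X.β (el hX i))).symm
    congr 1
    exact funext fun c => (congrArg (onB f) (el_idx hX c)).symm
  map_idx := by
    rintro ⟨i⟩
    exact idx_onB_el hX f i
  mono _ _ h := (congrArg (Quotient.lift (fun i => onB f (el hX i)) fun _ _ h => R.onB_eq h) h).le

theorem π_desc : R.π ≫ R.desc = f :=
  Hom.ext rfl (funext fun b => congrArg (onB f) (el_idx hX b))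

theorem quot_bijective : Function.Bijective R.quot.idx := Function.bijective_id

theorem quot_connected (hc : X.Connected) : R.quot.Connected := by
  obtain ⟨⟨i₀⟩, hc⟩ := hc
  refine ⟨⟨Quotient.mk R.s i₀⟩, ?_⟩
  rintro ⟨i⟩ ⟨j⟩
  have := hc i j
  induction this with
  | rel i j h =>
    refine .rel _ _ ?_
    rcases h with rfl | ⟨b, c, h, rfl, rfl⟩
    · exact Or.inl rfl
    · refine Or.inr ⟨onB R.π b, onB R.π c, ?_, rfl, rfl⟩
      rw [onB_β, h]; rfl
  | refl i => exact .refl _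
  | symm i j _ ih => exact .symm _ _ ih
  | trans i j k _ _ ih ih' => exact .trans _ _ _ ih ih'

/-- `α` and `γ` descend to the quotient and carry fibres bijectively to fibres; connectedness then
makes the cardinality constant. -/
theorem card_fiber (hc : X.Connected) (i₀ : X.A) (q : R.quot.A) :
    Nat.card {j : X.A // onA R.π j = q} = Nat.card {j : X.A // onA R.π j = onA R.π i₀} := by
  obtain ⟨i, rfl⟩ : ∃ i, onA R.π i = q := Quotient.exists_rep q
  have key : ∀ (σ : X.A → X.A), (∀ i, σ (σ i) = i) → (∀ {i j}, R.s i j → R.s (σ i) (σ j)) →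
      ∀ i, Nat.card {j : X.A // onA R.π j = onA R.π (σ i)} =
        Nat.card {j : X.A // onA R.π j = onA R.π i} := by
    intro σ hσ hR i
    refine Nat.card_congr (Equiv.subtypeEquiv ⟨σ, σ, hσ, hσ⟩ fun j => ?_)
    constructor
    · intro h
      have : R.s (σ j) (σ (σ i)) := hR (Quotient.exact h)
      rw [hσ] at this
      exact Quotient.sound this
    · intro h
      have : R.s (σ (σ j)) (σ i) := hR (Quotient.exact h)
      rw [hσ] at this
      exact Quotient.sound this
  refine mem_of_connected (S := {i | Nat.card {j : X.A // onA R.π j = onA R.π i} =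
    Nat.card {j : X.A // onA R.π j = onA R.π i₀}}) hc ⟨i₀, rfl⟩ (fun i hi => ?_)
    (fun b c h hb => ?_) i
  · exact (key X.α X.α_invol R.α_rel i).trans hi
  · have : X.idx c = γ hX (X.idx b) := (γ_of_some hX (by rwa [el_idx])).symm
    rw [this]
    exact (key (γ hX) (γ_γ hX) R.γ_rel _).trans hb

theorem card_fiber_onB (q : R.quot.B) :
    Nat.card {b : X.B // onB R.π b = q} = Nat.card {j : X.A // onA R.π j = q} :=
  Nat.card_congr (Equiv.subtypeEquiv (Equiv.ofBijective _ hX) fun _ => Iff.rfl)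

/-- An element is an end exactly when its image is. The count serves to tell strings, with two ends,
from bands, with none. -/
theorem card_ends (hc : X.Connected) (i₀ : X.A) : Nat.card {b : X.B // X.β b = none} =
    Nat.card {q : R.quot.B // R.quot.β q = none} *
      Nat.card {j : X.A // onA R.π j = onA R.π i₀} := by
  classical
  let := Fintype.ofFinite {q : R.quot.B // R.quot.β q = none}
  have hβ : ∀ b, R.quot.β (onB R.π b) = none ↔ X.β b = none := fun b => by
    rw [onB_β, Option.map_eq_none_iff]
  let p : {b : X.B // X.β b = none} → {q : R.quot.B // R.quot.β q = none} :=
    fun b => ⟨onB R.π b.1, (hβ b.1).2 b.2⟩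
  rw [← Nat.card_congr (Equiv.sigmaFiberEquiv p), Nat.card_sigma]
  have : ∀ q, Nat.card {x // p x = q} = Nat.card {j : X.A // onA R.π j = onA R.π i₀} := by
    intro q
    rw [← R.card_fiber hc i₀ q.1, ← R.card_fiber_onB q.1]
    refine Nat.card_congr ⟨fun x => ⟨x.1.1, congrArg Subtype.val x.2⟩,
      fun x => ⟨⟨x.1, (hβ x.1).1 (by rw [x.2]; exact q.2)⟩, Subtype.ext x.2⟩, ?_, ?_⟩
    · exact fun _ => rfl
    · exact fun _ => rfl
  rw [Finset.sum_congr rfl fun q _ => this q, Finset.sum_const, smul_eq_mul, Finset.card_univ,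
    ← Nat.card_eq_fintype_card]

/-- A morphism that does not factor through a covering admits only the trivial bisimulation. -/
theorem eq_of_rel (hc : X.Connected) (hf : ¬ FactorsThroughCovering f) {i j : X.A}
    (h : R.s i j) : i = j := by
  by_contra hne
  refine hf ⟨R.quot, R.π, R.desc, ?_, R.π_desc⟩
  have hn : 2 ≤ Nat.card {k : X.A // onA R.π k = onA R.π i} := by
    have : Nontrivial {k : X.A // onA R.π k = onA R.π i} :=
      ⟨⟨⟨i, rfl⟩, ⟨j, (Quotient.sound h).symm⟩, fun h => hne (congrArg Subtype.val h)⟩⟩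
    exact Finite.one_lt_card
  have hends := R.card_ends hc i
  -- A string as quotient, with fibres of at least two elements, would give at least four ends
  -- upstairs.
  have hband : R.quot.IsBand := by
    refine (isString_or_isBand R.quot_bijective (R.quot_connected hc)).resolve_left fun hs => ?_
    rw [hs.card_ends] at hends
    rcases isString_or_isBand hX hc with h' | h'
    · rw [h'.card_ends] at hends; omega
    · rw [h'.card_ends] at hends; omega
  rw [hband.card_ends, zero_mul] at hends
  have hband' : X.IsBand := by
    refine (isString_or_isBand hX hc).resolve_left fun hs => ?_
    rw [hs.card_ends] at hends
    omega
  exact ⟨hband', hband, _, hn, R.card_fiber hc i,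
    fun q => (R.card_fiber_onB q).trans (R.card_fiber hc i q)⟩

end Bisimulation

/-- The equivalence relation generated by `S` inherits all three stability properties, so `S` itself
need not be an equivalence. -/
theorem eq_of_bisimilar (hX : Function.Bijective X.idx) (hc : X.Connected)
    (hf : ¬ FactorsThroughCovering f) (S : X.A → X.A → Prop)
    (hB : ∀ i j, S i j → onB f (el hX i) = onB f (el hX j))
    (hα : ∀ i j, S i j → S (X.α i) (X.α j)) (hγ : ∀ i j, S i j → S (γ hX i) (γ hX j))
    {i j : X.A} (h : S i j) : i = j := by
  let R : Bisimulation hX f :=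
    { s := Relation.EqvGen.setoid S
      onB_eq := by
        intro i j h
        induction h with
        | rel i j h => exact hB i j h
        | refl i => rfl
        | symm i j _ ih => exact ih.symm
        | trans i j k _ _ ih ih' => exact ih.trans ih'
      α_rel := by
        intro i j h
        induction h with
        | rel i j h => exact .rel _ _ (hα i j h)
        | refl i => exact .refl _
        | symm i j _ ih => exact .symm _ _ ih
        | trans i j k _ _ ih ih' => exact .trans _ _ _ ih ih'
      γ_rel := by
        intro i j h
        induction h with
        | rel i j h => exact .rel _ _ (hγ i j h)
        | refl i => exact .refl _
        | symm i j _ ih => exact .symm _ _ ih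
        | trans i j k _ _ ih ih' => exact .trans _ _ _ ih ih' }
  exact R.eq_of_rel hc hf (.rel _ _ h)

end Quotient

end Net

/-! ### Matched summands of isomorphic pushforwards -/

namespace Net

/-- A morphism between nets with singleton blocks that is bijective on elements is an
isomorphism. -/
theorem isIso_of_bijective {X Y : Net.{u}} (hX : Function.Bijective X.idx)
    (hY : Function.Bijective Y.idx) (f : X ⟶ Y) (hf : Function.Bijective (onA f)) : IsIso f := by
  have hB : Function.Bijective (onB f) := by
    have : Y.idx ∘ onB f = onA f ∘ X.idx := funext (idx_onB f)
    refine (Function.Bijective.of_comp_iff' hY _).1 ?_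
    rw [this]
    exact hf.comp hX
  let a := Equiv.ofBijective _ hf
  let b := Equiv.ofBijective _ hB
  have ha : ∀ i, onA f (a.symm i) = i := a.apply_symm_apply
  have hb : ∀ i, onB f (b.symm i) = i := b.apply_symm_apply
  let g : Y ⟶ X :=
    { f₁ := a.symm
      f₂ := b.symm
      map_α := fun i => hf.1 (by rw [onA_α, ha, ha])
      map_β := fun c => by
        refine Option.map_injective hB.1 ?_
        rw [← onB_β, hb, Option.map_map]
        have : onB f ∘ b.symm = id := funext hb
        rw [this, Option.map_id, id]
      map_idx := fun c => hf.1 (by rw [ha, ← idx_onB, hb])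
      mono := fun c d h => (congrArg b.symm (hY.1 (idx_eq_of_le h))).le }
  exact ⟨g, Hom.ext (funext a.symm_apply_apply) (funext b.symm_apply_apply),
    Hom.ext (funext ha) (funext hb)⟩

instance (X : Net.{u}) : Finite X.Orbit := Quotient.finite X.orbitSetoid

namespace Rep

variable {K : Type v} [Field K] {X Y : Net.{u}}

theorem proj_mem (V : Rep.{u, v, w} K X) (o : X.Orbit) (x : V.V) : V.proj o x ∈ V.comp o :=
  Submodule.projection_apply_mem _ x

theorem sum_proj (V : Rep.{u, v, w} K X) [Fintype X.Orbit] (x : V.V) : ∑ o, V.proj o x = x := by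
  have hx : x ∈ ⨆ o, V.comp o := V.comp_iSup ▸ Submodule.mem_top
  induction hx using Submodule.iSup_induction' with
  | mem o x hx =>
    rw [Finset.sum_eq_single o, V.proj_same hx]
    · exact fun o' _ h => V.proj_other h.symm hx
    · exact fun h => absurd (Finset.mem_univ o) h
  | zero => simp
  | add x y _ _ hx hy => simp only [map_add, Finset.sum_add_distrib, hx, hy]

theorem rel_congr {V : Rep.{u, v, w} K X} {b b' c c' : X.B} {h : X.β b = some c}
    {h' : X.β b' = some c'} (hb : b = b') (hc : c = c') {x y : V.V} (hxy : (x, y) ∈ V.rel b c h) :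
    (x, y) ∈ V.rel b' c' h' := by
  subst hb hc
  exact hxy

theorem F_el (hX : Function.Bijective X.idx) (V : Rep.{u, v, w} K X) (i : X.A) :
    V.F (el hX i) = V.comp (X.orb i) := by
  refine le_antisymm ((V.F_le_comp _).trans (by rw [idx_el])) ?_
  rw [← V.F_exhaustive]
  refine iSup₂_le fun b hb => ?_
  rw [← hb, el_idx]

theorem F_eq_comp (hX : Function.Bijective X.idx) (V : Rep.{u, v, w} K X) (b : X.B) :
    V.F b = V.comp (X.orb (X.idx b)) := by
  rw [← F_el hX V, el_idx]

section Matched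

variable {X₁ X₂ : Net.{u}} {f₁ : X₁ ⟶ Y} {f₂ : X₂ ⟶ Y} {hf₁ : BlockInjective f₁}
  {hf₂ : BlockInjective f₂} {V₁ : Rep.{u, v, w} K X₁} {V₂ : Rep.{u, v, w} K X₂}
  (p : V₁.pushforward f₁ hf₁ ⟶ V₂.pushforward f₂ hf₂)
  (q : V₂.pushforward f₂ hf₂ ⟶ V₁.pushforward f₁ hf₁)

/-- The linear map underlying a morphism between pushforwards. -/
noncomputable def lin : V₁.V →ₗ[K] V₂.V := toLin p

theorem proj_rel_map {r₁ s₁ : X₁.B} {r₂ s₂ : X₂.B} {h₁ : X₁.β r₁ = some s₁}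
    {h₂ : X₂.β r₂ = some s₂} (hr : onB f₁ r₁ = onB f₂ r₂) (hs : onB f₁ s₁ = onB f₂ s₂)
    {x y : V₁.V} (hxy : (x, y) ∈ V₁.rel r₁ s₁ h₁) :
    (V₂.proj (X₂.orb (X₂.idx r₂)) (lin p x), V₂.proj (X₂.orb (X₂.idx s₂)) (lin p y)) ∈
      V₂.rel r₂ s₂ h₂ :=
  proj_rel_pushforward f₂ hf₂ V₂ (h' := β_onB f₂ h₂)
    (rel_congr hr hs (map_rel p (rel_pushforward f₁ hf₁ V₁ (h' := β_onB f₁ h₁) hxy)))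

/-- The step at `l` of the pushforward of `V₂` has no component at `z₂` unless `f₂ z₂ ≤ l`, and `p`
preserves filtrations. -/
theorem onB_le_of_proj_ne_zero (h₁ : Function.Bijective X₁.idx) (h₂ : Function.Bijective X₂.idx)
    {z₁ : X₁.A} {z₂ : X₂.A} (hz : onA f₁ z₁ = onA f₂ z₂) {x : V₁.V}
    (hx : x ∈ V₁.comp (X₁.orb z₁)) (hne : V₂.proj (X₂.orb z₂) (lin p x) ≠ 0) :
    onB f₂ (el h₂ z₂) ≤ onB f₁ (el h₁ z₁) := by
  by_contra hle
  refine hne ?_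
  rw [← F_el h₁] at hx
  have h3 : lin p x ∈ pushF f₂ V₂ (onB f₁ (el h₁ z₁)) := map_F p (le_pushF f₁ V₁ le_rfl hx)
  have h4 : pushF f₂ V₂ (onB f₁ (el h₁ z₁)) ≤ LinearMap.ker (V₂.proj (X₂.orb z₂)) := by
    refine iSup₂_le fun r hr y hy => V₂.proj_other (fun ho => ?_) (V₂.F_le_comp r hy)
    rcases X₂.orb_eq_iff.1 ho with h | h
    · rw [← h, el_idx] at hle
      exact hle hr
    · have h5 := idx_eq_of_le hr
      rw [idx_onB, h, idx_onB_el, hz, onA_α] at h5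
      exact Y.α_ne _ h5
  exact h4 h3

/-- Two summands of isomorphic pushforwards that interact nontrivially. -/
def Matched (z₁ : X₁.A) (z₂ : X₂.A) : Prop :=
  onA f₁ z₁ = onA f₂ z₂ ∧ ∃ x ∈ V₁.comp (X₁.orb z₁),
    V₁.proj (X₁.orb z₁) (lin q (V₂.proj (X₂.orb z₂) (lin p x))) ≠ 0

variable {p q}

/-- The components of `p` and of `q` are both nonzero, and each bounds the position in one
direction. -/
theorem Matched.onB_eq (h₁ : Function.Bijective X₁.idx) (h₂ : Function.Bijective X₂.idx)
    {z₁ : X₁.A} {z₂ : X₂.A} (h : Matched p q z₁ z₂) :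
    onB f₁ (el h₁ z₁) = onB f₂ (el h₂ z₂) := by
  obtain ⟨hz, x, hx, hne⟩ := h
  refine le_antisymm (onB_le_of_proj_ne_zero q h₂ h₁ hz.symm (V₂.proj_mem _ (lin p x)) hne)
    (onB_le_of_proj_ne_zero p h₁ h₂ hz hx fun h0 => hne ?_)
  rw [h0, map_zero, map_zero]

theorem Matched.α {z₁ : X₁.A} {z₂ : X₂.A} (h : Matched p q z₁ z₂) :
    Matched p q (X₁.α z₁) (X₂.α z₂) := by
  refine ⟨by rw [onA_α, onA_α, h.1], ?_⟩
  rw [X₁.orb_α, X₂.orb_α]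
  exact h.2

/-- Components between elements with equal image in `Y.B` commute with the structure maps. As lower
steps vanish in one-element blocks, a nonzero composite stays nonzero across the edge. -/
theorem Matched.γ (h₁ : Function.Bijective X₁.idx) (h₂ : Function.Bijective X₂.idx)
    {z₁ : X₁.A} {z₂ : X₂.A} (h : Matched p q z₁ z₂) :
    Matched p q (γ h₁ z₁) (γ h₂ z₂) := by
  have hB := h.onB_eq h₁ h₂
  have hβ : (X₁.β (el h₁ z₁)).map (onB f₁) = (X₂.β (el h₂ z₂)).map (onB f₂) := by
    rw [← onB_β, ← onB_β, hB]
  cases e₁ : X₁.β (el h₁ z₁) with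
  | none =>
    rw [e₁, Option.map_none, eq_comm, Option.map_eq_none_iff] at hβ
    rwa [γ_of_none h₁ e₁, γ_of_none h₂ hβ]
  | some c₁ =>
    rw [e₁, Option.map_some, eq_comm, Option.map_eq_some_iff] at hβ
    obtain ⟨c₂, e₂, hc⟩ := hβ
    rw [γ_of_some h₁ e₁, γ_of_some h₂ e₂]
    obtain ⟨hz, x, hx, hne⟩ := h
    refine ⟨by rw [← idx_onB, ← idx_onB, hc], ?_⟩
    rw [← F_el h₁] at hx
    obtain ⟨y, hy⟩ := exists_rel e₁ hx
    refine ⟨y, F_eq_comp h₁ V₁ c₁ ▸ rel_right hy, fun h0 => hne ?_⟩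
    have h3 := proj_rel_map q (h₂ := e₁) hB.symm hc (proj_rel_map p (h₂ := e₂) hB hc.symm hy)
    rw [h0, idx_el, idx_el] at h3
    exact eq_zero_of_mem_below h₁.1 (below_rel h3 (Submodule.zero_mem _))

/-- `p` preserves the summands of the pushforwards, so `o` lies over the same orbit as `z₁`; one of
its two elements then has the same image as `z₁`. -/
theorem exists_matched {z₁ : X₁.A} {x : V₁.V} (hx : x ∈ V₁.comp (X₁.orb z₁)) {o : X₂.Orbit}
    (hne : V₁.proj (X₁.orb z₁) (lin q (V₂.proj o (lin p x))) ≠ 0) :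
    ∃ z₂, X₂.orb z₂ = o ∧ Matched p q z₁ z₂ := by
  have ho : onOrbit f₂ o = Y.orb (onA f₁ z₁) := by
    by_contra ho
    have h1 : x ∈ (V₁.pushforward f₁ hf₁).comp (Y.orb (onA f₁ z₁)) :=
      le_iSup₂ (f := fun (o : X₁.Orbit) (_ : onOrbit f₁ o = Y.orb (onA f₁ z₁)) => V₁.comp o)
        (X₁.orb z₁) rfl hx
    have h2 : lin p x ∈ (V₂.pushforward f₂ hf₂).comp (Y.orb (onA f₁ z₁)) := map_comp p h1
    have h3 : (V₂.pushforward f₂ hf₂).comp (Y.orb (onA f₁ z₁)) ≤ LinearMap.ker (V₂.proj o) :=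
      iSup₂_le fun o' ho' y hy => V₂.proj_other (by rintro rfl; exact ho ho') hy
    have h4 : V₂.proj o (lin p x) = 0 := h3 h2
    rw [h4, map_zero, map_zero] at hne
    exact hne rfl
  obtain ⟨z, rfl⟩ := X₂.orb_surj o
  rcases Y.orb_eq_iff.1 ho with h | h
  · exact ⟨z, rfl, h.symm, x, hx, hne⟩
  · refine ⟨X₂.α z, X₂.orb_α z, ?_, x, hx, ?_⟩
    · rw [onA_α, h, Y.α_invol]
    · rwa [X₂.orb_α]

variable (hpq : p ≫ q = 𝟙 _)
include hpq

theorem lin_lin (x : V₁.V) : lin q (lin p x) = x :=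
  LinearMap.congr_fun (congrArg toLin hpq) x

/-- The identity of the summand at `z₁` is the sum, over the orbits of `X₂`, of the composites
passing through them; some term is nonzero. -/
theorem exists_matched_of_ne_bot {z₁ : X₁.A} (hne : V₁.comp (X₁.orb z₁) ≠ ⊥) :
    ∃ z₂, Matched p q z₁ z₂ := by
  let := Fintype.ofFinite X₂.Orbit
  obtain ⟨x, hx, hx0⟩ := Submodule.exists_mem_ne_zero_of_ne_bot hne
  have h1 : ∑ o, V₁.proj (X₁.orb z₁) (lin q (V₂.proj o (lin p x))) ≠ 0 := by
    rw [← map_sum, ← map_sum, V₂.sum_proj, lin_lin hpq, V₁.proj_same hx]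
    exact hx0
  obtain ⟨o, -, ho⟩ := Finset.exists_ne_zero_of_sum_ne_zero h1
  obtain ⟨z₂, -, h⟩ := exists_matched hx ho
  exact ⟨z₂, h⟩

/-- In the same decomposition of the identity, only the term through `z₂` can be nonzero. -/
theorem proj_lin_proj_lin {z₁ : X₁.A} {z₂ : X₂.A} (huniq : ∀ z, Matched p q z₁ z → z = z₂)
    {x : V₁.V} (hx : x ∈ V₁.comp (X₁.orb z₁)) :
    V₁.proj (X₁.orb z₁) (lin q (V₂.proj (X₂.orb z₂) (lin p x))) = x := by
  let := Fintype.ofFinite X₂.Orbit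
  have h1 : ∑ o, V₁.proj (X₁.orb z₁) (lin q (V₂.proj o (lin p x))) = x := by
    rw [← map_sum, ← map_sum, V₂.sum_proj, lin_lin hpq, V₁.proj_same hx]
  rw [Finset.sum_eq_single (X₂.orb z₂)] at h1
  · exact h1
  · intro o _ ho
    by_contra hne
    obtain ⟨z, rfl, hz⟩ := exists_matched hx hne
    exact ho (congrArg X₂.orb (huniq z hz))
  · exact fun h => absurd (Finset.mem_univ _) h

end Matched

end Rep

end Net

/-! ### Uniqueness of presentations -/

namespace Net

theorem injective_idx_of_height_le_one {X : Net.{u}} (h : X.height ≤ 1) :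
    Function.Injective X.idx := by
  intro b c hbc
  have h1 : Nat.card {d : X.B // X.idx d = X.idx c} ≤ 1 :=
    (le_ciSup (f := fun i : X.A => Nat.card {b : X.B // X.idx b = i})
      (Set.finite_range _).bddAbove (X.idx c)).trans h
  exact congrArg Subtype.val
    ((Finite.card_le_one_iff_subsingleton.1 h1).elim ⟨b, hbc⟩ ⟨c, rfl⟩)

theorem injective_onOrbit {X Y : Net.{u}} {g : X ⟶ Y} (hg : Function.Injective (onA g)) :
    Function.Injective (onOrbit g) := by
  intro o o' h
  obtain ⟨z, rfl⟩ := X.orb_surj o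
  obtain ⟨z', rfl⟩ := X.orb_surj o'
  rcases Y.orb_eq_iff.1 h with h | h
  · rw [hg h]
  · rw [← onA_α] at h
    rw [hg h, X.orb_α]

namespace Rep

variable {K : Type v} [Field K] {X Y : Net.{u}}

theorem exists_comp_ne_bot {V : Rep.{u, v, w} K X} (hV : ¬ IsZero V) :
    ∃ i, V.comp (X.orb i) ≠ ⊥ := by
  by_contra! h
  refine hV ((isZero_iff V).2 fun x => ?_)
  have h2 : (⊤ : Submodule K V.V) ≤ ⊥ := by
    rw [← V.comp_iSup]
    refine iSup_le fun o => ?_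
    obtain ⟨j, rfl⟩ := X.orb_surj o
    exact (h j).le
  exact h2 (Submodule.mem_top (x := x))

/-- The summands of a nonzero representation of a connected net of height at most one are all
nonzero. -/
theorem comp_ne_bot (hX : Function.Injective X.idx) (hc : X.Connected) {V : Rep.{u, v, w} K X}
    (hV : ¬ IsZero V) (i : X.A) : V.comp (X.orb i) ≠ ⊥ := by
  intro hi
  have h1 : ∀ j, j ∈ {j | V.comp (X.orb j) = ⊥} := by
    refine mem_of_connected hc ⟨i, hi⟩ (fun j hj => ?_) fun b c hbc hb => ?_
    · rwa [Set.mem_ofPred_eq, X.orb_α]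
    · rw [Set.mem_ofPred_eq, ← V.F_exhaustive, eq_bot_iff]
      refine iSup₂_le fun c' hc' x hx => ?_
      obtain rfl := hX hc'
      obtain ⟨y, hy⟩ := exists_rel (X.β_invol _ _ hbc) hx
      have hy0 : y ∈ V.comp (X.orb (X.idx b)) := V.F_le_comp b (rel_right hy)
      rw [Set.mem_ofPred_eq] at hb
      rw [hb, Submodule.mem_bot] at hy0
      exact eq_zero_of_mem_below hX (below_rel hy (hy0 ▸ Submodule.zero_mem _))
  obtain ⟨j, hj⟩ := exists_comp_ne_bot hV
  exact hj (h1 j)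

/-- An empty block would force its summand to vanish. -/
theorem bijective_idx (hX : Function.Injective X.idx) (hc : X.Connected) {V : Rep.{u, v, w} K X}
    (hV : ¬ IsZero V) : Function.Bijective X.idx := by
  refine ⟨hX, fun i => ?_⟩
  by_contra! h
  refine comp_ne_bot hX hc hV i ?_
  rw [← V.F_exhaustive, eq_bot_iff]
  exact iSup₂_le fun b hb => absurd hb (h b)

section Matched

variable {X₁ X₂ : Net.{u}} {f₁ : X₁ ⟶ Y} {f₂ : X₂ ⟶ Y} {hf₁ : BlockInjective f₁}
  {hf₂ : BlockInjective f₂} {V₁ : Rep.{u, v, w} K X₁} {V₂ : Rep.{u, v, w} K X₂}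
  {p : V₁.pushforward f₁ hf₁ ⟶ V₂.pushforward f₂ hf₂}
  {q : V₂.pushforward f₂ hf₂ ⟶ V₁.pushforward f₁ hf₁}

/-- Having a common partner is stable under both involutions and implies equal images under `f₂`, so
it generates a bisimulation. -/
theorem Matched.right_unique (h₁ : Function.Bijective X₁.idx) (h₂ : Function.Bijective X₂.idx)
    (hc₂ : X₂.Connected) (hn₂ : ¬ FactorsThroughCovering f₂) {z : X₁.A} {i j : X₂.A}
    (hi : Matched p q z i) (hj : Matched p q z j) : i = j :=
  eq_of_bisimilar h₂ hc₂ hn₂ (fun i j => ∃ z, Matched p q z i ∧ Matched p q z j)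
    (fun _ _ ⟨_, hi, hj⟩ => (hi.onB_eq h₁ h₂).symm.trans (hj.onB_eq h₁ h₂))
    (fun _ _ ⟨_, hi, hj⟩ => ⟨_, hi.α, hj.α⟩)
    (fun _ _ ⟨_, hi, hj⟩ => ⟨_, hi.γ h₁ h₂, hj.γ h₁ h₂⟩) ⟨z, hi, hj⟩

theorem Matched.left_unique (h₁ : Function.Bijective X₁.idx) (h₂ : Function.Bijective X₂.idx)
    (hc₁ : X₁.Connected) (hn₁ : ¬ FactorsThroughCovering f₁) {z : X₂.A} {i j : X₁.A}
    (hi : Matched p q i z) (hj : Matched p q j z) : i = j :=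
  eq_of_bisimilar h₁ hc₁ hn₁ (fun i j => ∃ z, Matched p q i z ∧ Matched p q j z)
    (fun _ _ ⟨_, hi, hj⟩ => (hi.onB_eq h₁ h₂).trans (hj.onB_eq h₁ h₂).symm)
    (fun _ _ ⟨_, hi, hj⟩ => ⟨_, hi.α, hj.α⟩)
    (fun _ _ ⟨_, hi, hj⟩ => ⟨_, hi.γ h₁ h₂, hj.γ h₁ h₂⟩) ⟨z, hi, hj⟩

/-- Noncovering connected nets whose representations have isomorphic pushforwards are
isomorphic. -/
theorem exists_iso_of_matched (h₁ : Function.Bijective X₁.idx) (h₂ : Function.Bijective X₂.idx)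
    (hc₁ : X₁.Connected) (hc₂ : X₂.Connected) (hn₁ : ¬ FactorsThroughCovering f₁)
    (hn₂ : ¬ FactorsThroughCovering f₂) (hV₁ : ∀ i, V₁.comp (X₁.orb i) ≠ ⊥)
    (hpq : p ≫ q = 𝟙 _) :
    ∃ g : X₁ ≅ X₂, g.hom ≫ f₂ = f₁ ∧ ∀ i j, Matched p q i j → j = onA g.hom i := by
  choose g hg using fun z => exists_matched_of_ne_bot hpq (hV₁ z)
  have hr : ∀ i j, Matched p q i j → j = g i := fun i j h =>
    h.right_unique h₁ h₂ hc₂ hn₂ (hg i)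
  have hα : ∀ i, g (X₁.α i) = X₂.α (g i) := fun i => (hr _ _ (hg i).α).symm
  have hγ : ∀ i, g (γ h₁ i) = γ h₂ (g i) := fun i => (hr _ _ ((hg i).γ h₁ h₂)).symm
  have hinj : Function.Injective g := fun i j h =>
    (hg i).left_unique h₁ h₂ hc₁ hn₁ (h ▸ hg j)
  -- The range is closed under both involutions of a connected net.
  have hsurj : Function.Surjective g := by
    refine mem_of_connected hc₂ (S := Set.range g) ⟨g hc₁.1.some, _, rfl⟩ ?_ ?_
    · rintro _ ⟨i, rfl⟩
      exact ⟨_, hα i⟩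
    · rintro b c hbc ⟨i, hi⟩
      refine ⟨γ h₁ i, ?_⟩
      rw [hγ, hi]
      exact γ_of_some h₂ (by rwa [el_idx])
  have hB : ∀ i, onB f₂ (el h₂ (g i)) = onB f₁ (el h₁ i) := fun i => ((hg i).onB_eq h₁ h₂).symm
  let F : X₁ ⟶ X₂ :=
    { f₁ := g
      f₂ := fun b => el h₂ (g (X₁.idx b))
      map_α := hα
      map_β := fun b => by
        have h3 : (X₁.β b).map (onB f₁) = (X₂.β (el h₂ (g (X₁.idx b)))).map (onB f₂) := by
          rw [← onB_β, ← onB_β, hB, el_idx]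
        cases e : X₁.β b with
        | none =>
          rw [e, Option.map_none, eq_comm, Option.map_eq_none_iff] at h3
          rw [h3, Option.map_none]
        | some c =>
          rw [e, Option.map_some, eq_comm, Option.map_eq_some_iff] at h3
          obtain ⟨c₂, e₂, -⟩ := h3
          rw [e₂, Option.map_some, ← el_idx h₂ c₂, ← γ_of_some h₂ e₂, ← hγ,
            γ_of_some h₁ (by rwa [el_idx])]
      map_idx := fun b => idx_el h₂ _
      mono := fun b c h => (congrArg (fun i => el h₂ (g i)) (idx_eq_of_le h)).le }
  have := Net.isIso_of_bijective h₁ h₂ F ⟨hinj, hsurj⟩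
  refine ⟨asIso F, Hom.ext (funext fun i => (hg i).1.symm) (funext fun b => ?_), hr⟩
  exact (hB _).trans (congrArg _ (el_idx h₁ b))

variable (g : X₁ ⟶ X₂) (p)

open Classical in
/-- The diagonal part of a morphism between pushforwards, along a morphism matching the
summands. -/
noncomputable def diagonal : V₁.V →ₗ[K] V₂.V :=
  letI := Fintype.ofFinite X₁.Orbit
  ∑ o, V₂.proj (onOrbit g o) ∘ₗ lin p ∘ₗ V₁.proj o

theorem diagonal_apply {o : X₁.Orbit} {x : V₁.V} (hx : x ∈ V₁.comp o) :
    diagonal p g x = V₂.proj (onOrbit g o) (lin p x) := by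
  classical
  let := Fintype.ofFinite X₁.Orbit
  unfold diagonal
  rw [LinearMap.sum_apply, Finset.sum_eq_single o]
  · rw [LinearMap.comp_apply, LinearMap.comp_apply, V₁.proj_same hx]
  · intro o' _ ho
    rw [LinearMap.comp_apply, LinearMap.comp_apply, V₁.proj_other ho.symm hx, map_zero, map_zero]
  · exact fun h => absurd (Finset.mem_univ _) h

variable {g}

theorem diagonal_proj (hg : Function.Injective (onA g)) (o : X₁.Orbit) (x : V₁.V) :
    diagonal p g (V₁.proj o x) = V₂.proj (onOrbit g o) (diagonal p g x) := by
  classical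
  let := Fintype.ofFinite X₁.Orbit
  conv_rhs => rw [← V₁.sum_proj x, map_sum, map_sum]
  rw [Finset.sum_eq_single o]
  · rw [diagonal_apply p g (V₁.proj_mem o x), V₂.proj_same (V₂.proj_mem _ _)]
  · intro o' _ ho
    rw [diagonal_apply p g (V₁.proj_mem o' x),
      V₂.proj_other (fun h => ho (injective_onOrbit hg h)) (V₂.proj_mem _ _)]
  · exact fun h => absurd (Finset.mem_univ _) h

variable {p}

/-- On each summand, `q` followed by projection is a left inverse, since the only matched partner of
`z` is `g z`. -/
theorem diagonal_injective (hg : Function.Injective (onA g)) (hpq : p ≫ q = 𝟙 _)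
    (hm : ∀ i j, Matched p q i j → j = onA g i) : Function.Injective (diagonal p g) := by
  let := Fintype.ofFinite X₁.Orbit
  refine (injective_iff_map_eq_zero _).2 fun x hx => ?_
  rw [← V₁.sum_proj x]
  refine Finset.sum_eq_zero fun o _ => ?_
  have h1 := diagonal_proj p hg o x
  rw [hx, map_zero, diagonal_apply p g (V₁.proj_mem o x)] at h1
  obtain ⟨z, rfl⟩ := X₁.orb_surj o
  rw [← proj_lin_proj_lin hpq (hm z) (V₁.proj_mem _ x), ← onOrbit_orb, h1, map_zero, map_zero]

/-- The two spaces have equal dimension because `p` is invertible, so the injective diagonal part is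
bijective. It respects the structure maps since `f₁` and `f₂ ∘ g` agree on `B`. -/
theorem nonempty_iso_of_matched (h₁ : Function.Bijective X₁.idx)
    (h₂ : Function.Bijective X₂.idx) (hg : Function.Bijective (onA g)) (hg' : BlockInjective g)
    (hgf : g ≫ f₂ = f₁) (hpq : p ≫ q = 𝟙 _) (hqp : q ≫ p = 𝟙 _)
    (hm : ∀ i j, Matched p q i j → j = onA g i) :
    Nonempty (V₁.pushforward g hg' ≅ V₂) := by
  have hfin : Module.finrank K V₁.V = Module.finrank K V₂.V :=
    (LinearEquiv.ofLinearMap (lin p) (lin q) (LinearMap.ext (lin_lin hqp))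
      (LinearMap.ext (lin_lin hpq))).finrank_eq
  have hinj := diagonal_injective hg.1 hpq hm
  have hsurj := (LinearMap.injective_iff_surjective_of_finrank_eq_finrank hfin).1 hinj
  have hB : ∀ b, onB f₁ b = onB f₂ (onB g b) := fun b => by rw [← hgf]; rfl
  have happ : ∀ (b : X₁.B) (x : V₁.V), x ∈ V₁.F b →
      diagonal p g x = V₂.proj (X₂.orb (X₂.idx (onB g b))) (lin p x) := fun b x hx => by
    rw [diagonal_apply p g (V₁.F_le_comp b hx), onOrbit_orb, idx_onB]
  let P : V₁.pushforward g hg' ⟶ V₂ := homOfPushforward g hg' (diagonal p g)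
    (fun b x hx => by
      rw [Submodule.mem_comap, happ b x hx, F_eq_comp h₂]
      exact V₂.proj_mem _ _)
    (fun b c hbc x y hxy => by
      rw [happ b x (rel_left hxy), happ c y (rel_right hxy)]
      exact proj_rel_map p (hB b) (hB c) hxy)
  have : IsIso P := by
    refine Rep.isIso_of_bijective P ⟨hinj, hsurj⟩ fun l y hy => ?_
    obtain ⟨i, hi⟩ := hg.2 (X₂.idx l)
    obtain ⟨x, rfl⟩ := hsurj y
    have hl : onB g (el h₁ i) = l := h₂.1 (by rw [idx_onB_el, hi])
    refine ⟨V₁.proj (X₁.orb i) x, ?_, ?_⟩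
    · exact le_pushF g V₁ hl.le (F_el h₁ V₁ i ▸ V₁.proj_mem _ x)
    · refine (diagonal_proj p hg.1 _ x).trans ?_
      rw [onOrbit_orb, hi]
      exact V₂.proj_same (V₂.F_le_comp l hy)
  exact ⟨asIso P⟩

end Matched

end Rep

/-- Uniqueness of presentations. -/
theorem Presents.unique {K : Type v} [Field K] {X₁ X₂ Y : Net.{u}} {f₁ : X₁ ⟶ Y} {f₂ : X₂ ⟶ Y}
    {V₁ : Rep.{u, v, w} K X₁} {V₂ : Rep.{u, v, w} K X₂} {W : Rep.{u, v, w} K Y}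
    (h₁ : Presents f₁ V₁ W) (h₂ : Presents f₂ V₂ W) :
    ∃ (g : X₁ ≅ X₂) (hg : BlockInjective g.hom),
      g.hom ≫ f₂ = f₁ ∧ Nonempty (V₁.pushforward g.hom hg ≅ V₂) := by
  obtain ⟨e₁⟩ := h₁.iso
  obtain ⟨e₂⟩ := h₂.iso
  have i₁ := injective_idx_of_height_le_one h₁.height_eq.le
  have b₁ := Rep.bijective_idx i₁ h₁.connected h₁.indecomposable.1
  have b₂ := Rep.bijective_idx (injective_idx_of_height_le_one h₂.height_eq.le) h₂.connected
    h₂.indecomposable.1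
  let e := e₁ ≪≫ e₂.symm
  obtain ⟨g, hgf, hm⟩ := Rep.exists_iso_of_matched b₁ b₂ h₁.connected h₂.connected h₁.not_factors
    h₂.not_factors (Rep.comp_ne_bot i₁ h₁.connected h₁.indecomposable.1) e.hom_inv_id
  have hg : Function.Bijective (onA g.hom) := by
    refine Function.bijective_iff_has_inverse.2 ⟨onA g.inv, fun i => ?_, fun i => ?_⟩
    · exact congrFun (congrArg Hom.f₁ g.hom_inv_id) i
    · exact congrFun (congrArg Hom.f₁ g.inv_hom_id) i
  exact ⟨g, blockInjective_of_injective i₁ _, hgf,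
    Rep.nonempty_iso_of_matched b₁ b₂ hg _ hgf e.hom_inv_id e.inv_hom_id hm⟩

end Net

/-! ### Restriction to components and existence for indecomposables -/

namespace Net

theorem card_block {X : Net.{u}} (hX : Function.Bijective X.idx) (i : X.A) :
    Nat.card {b : X.B // X.idx b = i} = 1 := by
  rw [Nat.card_eq_one_iff_unique]
  obtain ⟨b, rfl⟩ := hX.2 i
  exact ⟨⟨fun c d => Subtype.ext (hX.1 (c.2.trans d.2.symm))⟩, ⟨⟨b, rfl⟩⟩⟩

theorem height_eq_one {X : Net.{u}} (hX : Function.Bijective X.idx) [Nonempty X.A] :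
    X.height = 1 := by
  unfold height
  simp only [card_block hX, ciSup_const]

section Restrict

variable (X : Net.{u}) (S : Set X.A) (hα : ∀ i ∈ S, X.α i ∈ S)
  (hβ : ∀ b c, X.β b = some c → X.idx b ∈ S → X.idx c ∈ S)

/-- The restriction of a net to a set closed under the two involutions. -/
def restrict : Net.{u} where
  A := S
  B := {b : X.B // X.idx b ∈ S}
  α i := ⟨X.α i.1, hα i.1 i.2⟩
  α_invol i := Subtype.ext (X.α_invol _)
  α_ne i h := X.α_ne i.1 (congrArg Subtype.val h)
  idx b := ⟨X.idx b.1, b.2⟩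
  comparable_iff b c := (X.comparable_iff b.1 c.1).trans
    ⟨fun h => Subtype.ext h, fun h => congrArg Subtype.val h⟩
  β b := Option.pmap (fun c h => ⟨c, h⟩) (X.β b.1) fun c h => hβ b.1 c h b.2
  β_invol b c h := by
    rw [Option.pmap_eq_some_iff] at h ⊢
    obtain ⟨c', h', hc, rfl⟩ := h
    exact ⟨b.1, b.2, X.β_invol _ _ hc, rfl⟩
  β_ne b h := by
    rw [Option.pmap_eq_some_iff] at h
    obtain ⟨c', h', hc, rfl⟩ := h
    exact X.β_ne _ hc

/-- The inclusion of a restriction. -/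
def restrictι : X.restrict S hα hβ ⟶ X :=
  { f₁ := Subtype.val
    f₂ := Subtype.val
    map_α := fun _ => rfl
    map_β := fun b => by
      change X.β b.1 = Option.map Subtype.val (Option.pmap _ (X.β b.1) _)
      rw [Option.map_pmap, Option.pmap_eq_map, Option.map_id']
    map_idx := fun _ => rfl
    mono := fun _ _ h => h }

theorem restrict_bijective (hX : Function.Bijective X.idx) :
    Function.Bijective (X.restrict S hα hβ).idx := by
  refine ⟨fun b c h => Subtype.ext (hX.1 (congrArg Subtype.val h)), fun i => ?_⟩
  obtain ⟨b, hb⟩ := hX.2 i.1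
  exact ⟨⟨b, hb ▸ i.2⟩, Subtype.ext hb⟩

end Restrict

namespace Rep

variable {K : Type v} [Field K] {X Y : Net.{u}}

/-- The zero representation. -/
def zero (K : Type v) [Field K] (X : Net.{u}) : Rep.{u, v, w} K X where
  V := PUnit
  comp _ := ⊥
  comp_indep _ := disjoint_bot_left
  comp_iSup := Subsingleton.elim _ _
  F _ := ⊥
  F_mono _ _ _ := le_rfl
  F_exhaustive _ := Subsingleton.elim _ _
  φ _ _ _ := 0
  φ_symm _ _ _ := Subsingleton.elim _ _

section Restrict

variable {S : Set X.A} (hα : ∀ i ∈ S, X.α i ∈ S)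
  (hβ : ∀ b c, X.β b = some c → X.idx b ∈ S → X.idx c ∈ S)
  (V : Rep.{u, v, w} K X) (hV : ∀ i, i ∉ S → V.comp (X.orb i) = ⊥)

theorem restrict_β {b c : (X.restrict S hα hβ).B} (h : (X.restrict S hα hβ).β b = some c) :
    X.β b.1 = some c.1 :=
  β_onB (X.restrictι S hα hβ) h

theorem below_restrict (b : (X.restrict S hα hβ).B) :
    below (fun b : (X.restrict S hα hβ).B => V.F b.1) b = below V.F b.1 := by
  refine le_antisymm (iSup₂_le fun c hc => below_mono (F := V.F) (b := b.1) hc) ?_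
  refine iSup₂_le fun c hc => ?_
  exact below_mono (F := fun b : (X.restrict S hα hβ).B => V.F b.1)
    (c := ⟨c, by rw [idx_eq_of_le hc.le]; exact b.2⟩) hc

include hV

/-- The restriction of a representation to a set containing its support. -/
noncomputable def restrict : Rep.{u, v, w} K (X.restrict S hα hβ) :=
  ofRel (V := V.V) (fun o => V.comp (onOrbit (X.restrictι S hα hβ) o))
    (V.comp_indep.comp (injective_onOrbit Subtype.val_injective))
    (by
      rw [eq_top_iff, ← V.comp_iSup]
      refine iSup_le fun o => ?_
      obtain ⟨i, rfl⟩ := X.orb_surj o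
      by_cases hi : i ∈ S
      · exact le_iSup (fun o => V.comp (onOrbit (X.restrictι S hα hβ) o))
          ((X.restrict S hα hβ).orb ⟨i, hi⟩)
      · rw [hV i hi]
        exact bot_le)
    (fun b => V.F b.1) (fun _ _ h => V.F_mono h)
    (fun i => by
      change _ = V.comp (X.orb i.1)
      rw [← V.F_exhaustive]
      refine le_antisymm (iSup₂_le fun b hb => ?_) (iSup₂_le fun b hb => ?_)
      · exact le_iSup₂ (f := fun (b : X.B) (_ : X.idx b = i.1) => V.F b) b.1
          (congrArg Subtype.val hb)
      · exact le_iSup₂ (f := fun (b : (X.restrict S hα hβ).B)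
          (_ : (X.restrict S hα hβ).idx b = i) => V.F b.1) ⟨b, hb ▸ i.2⟩ (Subtype.ext hb))
    (fun b c h => V.rel b.1 c.1 (restrict_β hα hβ h))
    (fun _ _ _ _ _ h => rel_left h)
    (fun _ _ h _ hx => exists_rel (restrict_β hα hβ h) hx)
    (fun _ _ _ _ _ h => rel_symm h)
    (fun b c _ _ _ h hx => by
      rw [below_restrict] at hx ⊢
      exact rel_below h hx)

theorem pushforward_restrict (hf : BlockInjective (X.restrictι S hα hβ)) :
    Nonempty ((V.restrict hα hβ hV).pushforward (X.restrictι S hα hβ) hf ≅ V) := by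
  let p : (V.restrict hα hβ hV).pushforward (X.restrictι S hα hβ) hf ⟶ V :=
    homOfPushforward (V := V.restrict hα hβ hV) (X.restrictι S hα hβ) hf
      (LinearMap.id : V.V →ₗ[K] V.V) (fun _ _ hx => hx)
      (fun b c h (x y : V.V) hxy => by
        obtain ⟨y', hy', hb⟩ := exists_of_rel_ofRel _ _ _ _ _ _ _ _ _ _ _ hxy
        rw [below_restrict] at hb
        have h2 := Submodule.add_mem _ hy' (rel_of_below (restrict_β hα hβ h)
          (Submodule.zero_mem _) hb)
        rwa [Prod.mk_add_mk, add_zero, add_sub_cancel] at h2)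
  have : IsIso p := by
    refine isIso_of_bijective p Function.bijective_id fun l x hx => ⟨x, ?_, rfl⟩
    by_cases hl : X.idx l ∈ S
    · exact le_pushF (X.restrictι S hα hβ) (V.restrict hα hβ hV) (r := ⟨l, hl⟩) le_rfl hx
    · have h0 := V.F_le_comp l hx
      rw [hV _ hl, Submodule.mem_bot] at h0
      exact h0 ▸ Submodule.zero_mem _
  exact ⟨asIso p⟩

end Restrict

section Closed

variable (V : Rep.{u, v, w} K X) (S : Set X.A)

open Classical in
/-- The projection onto the sum of the summands indexed by a set. -/
noncomputable def projSet : V.V →ₗ[K] V.V :=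
  letI := Fintype.ofFinite X.Orbit
  ∑ o, if ∃ i ∈ S, X.orb i = o then V.proj o else 0

variable {S}

theorem projSet_of_exists {o : X.Orbit} (h : ∃ i ∈ S, X.orb i = o) {x : V.V}
    (hx : x ∈ V.comp o) : V.projSet S x = x := by
  classical
  let := Fintype.ofFinite X.Orbit
  unfold projSet
  rw [LinearMap.sum_apply, Finset.sum_eq_single o]
  · rw [if_pos h, V.proj_same hx]
  · intro o' _ ho
    split_ifs
    · exact V.proj_other ho.symm hx
    · rfl
  · exact fun h => absurd (Finset.mem_univ _) h

theorem projSet_of_not_exists {o : X.Orbit} (h : ¬ ∃ i ∈ S, X.orb i = o) {x : V.V}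
    (hx : x ∈ V.comp o) : V.projSet S x = 0 := by
  classical
  unfold projSet
  rw [LinearMap.sum_apply]
  refine Finset.sum_eq_zero fun o' _ => ?_
  split_ifs with h'
  · exact V.proj_other (by rintro rfl; exact h h') hx
  · rfl

theorem projSet_projSet (x : V.V) : V.projSet S (V.projSet S x) = V.projSet S x := by
  let := Fintype.ofFinite X.Orbit
  rw [← V.sum_proj x]
  simp only [map_sum]
  refine Finset.sum_congr rfl fun o _ => ?_
  by_cases h : ∃ i ∈ S, X.orb i = o
  · rw [V.projSet_of_exists h (V.proj_mem o x), V.projSet_of_exists h (V.proj_mem o x)]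
  · rw [V.projSet_of_not_exists h (V.proj_mem o x), map_zero]

variable (hα : ∀ i ∈ S, X.α i ∈ S)
  (hβ : ∀ b c, X.β b = some c → X.idx b ∈ S → X.idx c ∈ S)

include hα in
theorem exists_orb_iff {i : X.A} : (∃ j ∈ S, X.orb j = X.orb i) ↔ i ∈ S := by
  refine ⟨fun ⟨j, hj, h⟩ => ?_, fun h => ⟨i, h, rfl⟩⟩
  rcases X.orb_eq_iff.1 h with rfl | rfl
  · exact hj
  · rw [← X.α_invol i]
    exact hα _ hj

include hα hβ

variable {V}

/-- An indecomposable representation is supported on any closed set meeting its support. -/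
theorem IsIndecomposable.comp_eq_bot (hV : V.IsIndecomposable) {i : X.A} (hi : i ∈ S)
    (hne : V.comp (X.orb i) ≠ ⊥) {j : X.A} (hj : j ∉ S) : V.comp (X.orb j) = ⊥ := by
  let e : V ⟶ V := homMk (V.projSet S)
    (fun b x hx => by
      rw [Submodule.mem_comap]
      by_cases h : ∃ i ∈ S, X.orb i = X.orb (X.idx b)
      · rwa [V.projSet_of_exists h (V.F_le_comp b hx)]
      · rw [V.projSet_of_not_exists h (V.F_le_comp b hx)]
        exact Submodule.zero_mem _)
    (fun b c hbc x y hxy => by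
      have hx := V.F_le_comp b (rel_left hxy)
      have hy := V.F_le_comp c (rel_right hxy)
      by_cases h : X.idx b ∈ S
      · rwa [V.projSet_of_exists ⟨_, h, rfl⟩ hx,
          V.projSet_of_exists ⟨_, hβ b c hbc h, rfl⟩ hy]
      · have h' : X.idx c ∉ S := fun h' => h (hβ c b (X.β_invol _ _ hbc) h')
        rw [V.projSet_of_not_exists (fun h0 => h ((exists_orb_iff hα).1 h0)) hx,
          V.projSet_of_not_exists (fun h0 => h' ((exists_orb_iff hα).1 h0)) hy]
        exact Submodule.zero_mem _)
  rcases hV.eq_zero_or_eq_id e (hom_ext (LinearMap.ext V.projSet_projSet)) with h | h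
  · obtain ⟨x, hx, hx0⟩ := Submodule.exists_mem_ne_zero_of_ne_bot hne
    have h1 : V.projSet S x = 0 := LinearMap.congr_fun (congrArg toLin h) x
    exact absurd ((V.projSet_of_exists ⟨i, hi, rfl⟩ hx).symm.trans h1) hx0
  · refine eq_bot_iff.2 fun x hx => ?_
    have h1 : V.projSet S x = x := LinearMap.congr_fun (congrArg toLin h) x
    exact h1.symm.trans (V.projSet_of_not_exists (fun h0 => hj ((exists_orb_iff hα).1 h0)) hx)

end Closed

/-- Every indecomposable representation is presented by a string or a band. -/
theorem exists_presents (V : Rep.{u, v, w} K X) (hV : V.IsIndecomposable) :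
    ∃ (X' : Net.{u}) (f : X' ⟶ X) (V' : Rep.{u, v, w} K X'),
      Presents f V' V ∧ (X'.IsString ∨ X'.IsBand) := by
  classical
  -- A presentation with the fewest elements of `A` is chosen; minimality yields both connectedness
  -- and the absence of a covering.
  let P : ℕ → Prop := fun n =>
    ∃ (X' : Net.{u}) (h : Function.Bijective X'.idx) (f : X' ⟶ X) (V' : Rep.{u, v, w} K X'),
      Nat.card X'.A = n ∧
        Nonempty (V'.pushforward f (blockInjective_of_injective h.1 f) ≅ V)
  have hP : ∃ n, P n := by
    obtain ⟨X', h, f, V', e⟩ := exists_pushforward_iso V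
    exact ⟨_, X', h, f, V', rfl, e⟩
  obtain ⟨X', h, f, V', hcard, ⟨e⟩⟩ := Nat.find_spec hP
  have hmin : ∀ m, P m → Nat.card X'.A ≤ m := fun m hm => hcard.le.trans (Nat.find_min' hP hm)
  have hV' : V'.IsIndecomposable := isIndecomposable_of_pushforward f _ (hV.of_iso e.symm)
  obtain ⟨i, hi⟩ := exists_comp_ne_bot hV'.1
  have : Nonempty X'.A := ⟨i⟩
  have hc : X'.Connected := by
    let S : Set X'.A := {j | Relation.EqvGen X'.Linked i j}
    have hα : ∀ j ∈ S, X'.α j ∈ S := fun j hj => hj.trans _ _ _ (.rel _ _ (Or.inl rfl))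
    have hβ : ∀ b c, X'.β b = some c → X'.idx b ∈ S → X'.idx c ∈ S := fun b c hbc hb =>
      hb.trans _ _ _ (.rel _ _ (Or.inr ⟨b, c, hbc, rfl, rfl⟩))
    have hS : ∀ j, j ∉ S → V'.comp (X'.orb j) = ⊥ := fun j hj =>
      hV'.comp_eq_bot hα hβ (S := S) (i := i) (.refl _) hi hj
    have hr := X'.restrict_bijective S hα hβ h
    have hg := blockInjective_of_injective hr.1 (X'.restrictι S hα hβ)
    obtain ⟨e₁⟩ := V'.pushforward_restrict hα hβ hS hg
    obtain ⟨e₂⟩ := pushforward_comp (V := V'.restrict hα hβ hS) (X'.restrictι S hα hβ) hg f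
      (blockInjective_of_injective h.1 f) (blockInjective_of_injective hr.1 _)
    -- The component of `i` carries all of `V'`, so its restriction presents `V` as well and cannot
    -- be smaller.
    have hle := hmin (Nat.card S) ⟨X'.restrict S hα hβ, hr, X'.restrictι S hα hβ ≫ f,
      V'.restrict hα hβ hS, rfl, ⟨e₂ ≪≫ pushIso f _ e₁ ≪≫ e⟩⟩
    have hall : ∀ j, j ∈ S := fun j =>
      have hS' : S = Set.univ := Set.eq_of_subset_of_ncard_le (Set.subset_univ S)
        (by rwa [Set.ncard_univ, ← Nat.card_coe_set_eq])
      hS' ▸ Set.mem_univ j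
    exact ⟨⟨i⟩, fun j k => ((hall j).symm _ _).trans _ _ _ (hall k)⟩
  have hn : ¬ FactorsThroughCovering f := by
    rintro ⟨Z, c, g, ⟨-, hZ, n, hn, hA, -⟩, rfl⟩
    -- Pushing `V'` down to the target of the covering gives another presentation, with fewer
    -- elements because the fibres have at least two.
    obtain ⟨e₁⟩ := pushforward_comp (V := V') c (blockInjective_of_injective h.1 c) g
      (blockInjective_of_injective hZ.bijective.1 g) (blockInjective_of_injective h.1 _)
    have hle := hmin (Nat.card Z.A) ⟨Z, hZ.bijective, g, V'.pushforward c _, rfl,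
      ⟨e₁.symm ≪≫ e⟩⟩
    have hsurj : Function.Surjective (onA c) := fun j => by
      have hj := hA j
      have : Nonempty {i : X'.A // onA c i = j} := (Nat.card_pos_iff.1 (by omega)).1
      obtain ⟨i, hi⟩ := this
      exact ⟨i, hi⟩
    have hinj := (hsurj.bijective_of_nat_card_le hle).1
    have h1 : Nat.card {j : X'.A // onA c j = onA c i} ≤ 1 :=
      Finite.card_le_one_iff_subsingleton.2
        ⟨fun a b => Subtype.ext (hinj (a.2.trans b.2.symm))⟩
    have := hA (onA c i)
    omega
  exact ⟨X', f, V', ⟨height_eq_one h, hc, hn, hV', ⟨e⟩⟩, isString_or_isBand h hc⟩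

end Rep

/-! ### The zero representation -/

/-- A net of height at most one mapping to a given net, with an element over each element of
the given partitioned set. -/
def cover (X : Net.{u}) : Net.{u} where
  A := X.B × Bool
  B := X.B
  ordB :=
    { le := Eq
      lt := fun b c => b = c ∧ ¬ c = b
      le_refl := fun _ => rfl
      le_trans := fun _ _ _ => Eq.trans
      le_antisymm := fun _ _ h _ => h }
  α i := (i.1, !i.2)
  α_invol i := by simp
  α_ne i h := by simpa using congrArg Prod.snd h
  idx b := (b, false)
  comparable_iff b c := by
    rw [Prod.mk.injEq, and_iff_left rfl]
    exact ⟨fun h => h.elim id Eq.symm, Or.inl⟩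
  β := X.β
  β_invol := X.β_invol
  β_ne := X.β_ne

/-- The canonical morphism from the cover. -/
def coverHom (X : Net.{u}) : X.cover ⟶ X :=
  { f₁ := fun i => if i.2 then X.α (X.idx i.1) else X.idx i.1
    f₂ := id
    map_α := by
      rintro ⟨b, _ | _⟩
      · rfl
      · exact (X.α_invol _).symm
    map_β := fun b => (congrFun Option.map_id (X.β b)).symm
    map_idx := fun _ => rfl
    mono := fun b c h => le_of_eq h }

theorem height_cover_le (X : Net.{u}) : X.cover.height ≤ 1 := by
  refine ciSup_le' fun i => Finite.card_le_one_iff_subsingleton.2 ⟨fun b c => Subtype.ext ?_⟩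
  exact congrArg Prod.fst (b.2.trans c.2.symm)

theorem height_cover (X : Net.{u}) [Nonempty X.B] : X.cover.height = 1 := by
  refine le_antisymm X.height_cover_le ?_
  obtain ⟨b⟩ := ‹Nonempty X.B›
  refine le_trans ?_ (le_ciSup (f := fun i : X.cover.A => Nat.card {b : X.cover.B // X.cover.idx b = i})
    (Set.finite_range _).bddAbove (b, false))
  have : Nonempty {c : X.cover.B // X.cover.idx c = (b, false)} := ⟨⟨b, rfl⟩⟩
  exact Nat.one_le_iff_ne_zero.2 Nat.card_pos.ne'

end Net

theorem mainTheorem9 {K : Type v} [Field K] (X : Net.{u}) :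
    (∀ V : Net.Rep.{u, v, w} K X,
      ∃ (X' : Net.{u}) (hX' : X'.height ≤ 1) (f : X' ⟶ X) (V' : Net.Rep.{u, v, w} K X'),
        (Nonempty X.B → X'.height = 1) ∧
        (¬ IsZero V → ∀ i : X'.A, Nat.card {b : X'.B // X'.idx b = i} = 1) ∧
        Nonempty (V'.pushforward f (Net.blockInjective_of_height_le_one hX' f) ≅ V)) ∧
    (∀ V : Net.Rep.{u, v, w} K X, V.IsIndecomposable →
      ∃ (X' : Net.{u}) (f : X' ⟶ X) (V' : Net.Rep.{u, v, w} K X'),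
        Net.Presents f V' V ∧ (X'.IsString ∨ X'.IsBand) ∧
        ∀ (X'' : Net.{u}) (f'' : X'' ⟶ X) (V'' : Net.Rep.{u, v, w} K X''),
          Net.Presents f'' V'' V →
          ∃ (g : X' ≅ X'') (hg : Net.BlockInjective g.hom),
            g.hom ≫ f'' = f ∧ Nonempty (V'.pushforward g.hom hg ≅ V'')) := by
  refine ⟨fun V => ?_, fun V hV => ?_⟩
  · by_cases hV : IsZero V
    -- A zero representation has no pieces, so its net of pieces has height 0; `cover` supplies
    -- height 1 whenever `B` is nonempty.
    · refine ⟨X.cover, X.height_cover_le, X.coverHom, Net.Rep.zero K _,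
        fun _ => X.height_cover, fun h => absurd hV h, ⟨IsZero.iso ?_ hV⟩⟩
      exact (Net.Rep.isZero_iff _).2 fun x => Subsingleton.elim (α := PUnit) x 0
    · obtain ⟨X', h, f, V', ⟨e⟩⟩ := V.exists_pushforward_iso
      have hV' : ¬ IsZero V' := fun h0 =>
        hV (IsZero.of_iso ((Net.Rep.isZero_iff _).2 ((Net.Rep.isZero_iff V').1 h0)) e.symm)
      -- A nonzero summand guarantees that the net is nonempty, so its height is 1 and not the
      -- default value 0.
      obtain ⟨i, -⟩ := Net.Rep.exists_comp_ne_bot hV'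
      have : Nonempty X'.A := ⟨i⟩
      have hh := Net.height_eq_one h
      exact ⟨X', hh.le, f, V', fun _ => hh, fun _ => Net.card_block h, ⟨e⟩⟩
  · obtain ⟨X', f, V', h, h'⟩ := V.exists_presents hV
    exact ⟨X', f, V', h, h', fun X'' f'' V'' h'' => h.unique h''⟩
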